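/- Let $\mathbb{F}$ be an algebraically closed field of characteristic not $2$ or $3$. A Jacobi–Jordan (JJ) algebra is a vector space $\mathfrak{J}$ over $\mathbb{F}$ with a commutative bilinear product such that $x(yz)+y(zx)+z(xy)=0$. Let $\mathrm{S}^n(\mathfrak{J},\mathfrak{J})$ be the space of symmetric $n$-linear maps $\mathfrak{J}^n\to\mathfrak{J}$, and put $$\mathrm{d}f(x,y)=f(xy)-x f(y)-y f(x)\quad (f\in \mathrm{S}^1),$$ $$\mathrm{d}\varphi(x,y,z)=\varphi(x,yz)+\varphi(y,zx)+\varphi(z,xy)+x\varphi(y,z)+y\varphi(z,x)+z\varphi(x,y)\quad (\varphi\in \mathrm{S}^2),$$ $\mathrm{Z}^2=\ker(\mathrm{d}|_{\mathrm{S}^2})$, $\mathrm{B}^2=\mathrm{d}(\mathrm{S}^1)$, $\mathrm{H}^2(\mathfrak{J},\mathfrak{J})=\mathrm{Z}^2/\mathrm{B}^2$. A formal 1-parameter deformation of $\mathfrak{J}$ is a sequence $\varphi_0,\varphi_1,\varphi_2,\dots$ in $\mathrm{S}^2(\mathfrak{J},\mathfrak{J})$, with $\varphi_0$ the product of $\mathfrak{J}$,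 such that $(x\cdot y)_t=\sum_i t^i\varphi_i(x,y)$ makes $\mathfrak{J}[[t]]$ a JJ algebra over $\mathbb{F}[[t]]$. A cocycle $\varphi$ is called extendible if there is a formal 1-parameter deformation with $\varphi_1=\varphi$. We say that $\varphi$ defines a jump deformation $\mathfrak{J}\to\mathfrak{J}'$ if $xy+t\varphi(x,y)$ (with no higher terms) is a formal 1-parameter deformation of $\mathfrak{J}$ and, for all but finitely many nonzero $t\in\mathbb{F}$, the algebra $(\mathfrak{J},\,xy+t\varphi(x,y))$ is isomorphic to $\mathfrak{J}'$, where $\mathfrak{J}'\not\cong\mathfrak{J}$. Consider the following products on spaces with basis $e_1,\dots,e_m$ (products of basis vectors that are neither listed nor obtained from listed ones by commutativity are $0$); they are the nontrivial JJ algebras of dimension at most $5$ in the known classification. - $m=2$: $\mathfrak{J}_{1,2}$: $e_1^2=e_2$. - $m=3$: $\mathfrak{J}_{1,2}\oplus\mathbb{F}$: $e_1^2=e_2$; $\mathfrak{J}_{1,3}$: $e_1^2=e_3^2=e_2$. - $m=4$: $\mathfrak{J}_{1,2}\oplus\mathbb{F}^2$: $e_1^2=e_2$; $\mathfrak{J}_{1,3}\oplus\mathbb{F}$: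 $e_1^2=e_3^2=e_2$; $\mathfrak{J}_{1,2}^2$: $e_1^2=e_2$, $e_3^2=e_4$; $\mathfrak{J}_{1,4}$: $e_1^2=e_2$, $e_1e_3=e_4$; $\mathfrak{J}_{2,4}$: $e_1^2=e_3e_4=e_2$. - $m=5$: $\mathfrak{J}_{1,2}\oplus\mathbb{F}^3$: $e_1^2=e_2$; $\mathfrak{J}_{1,3}\oplus\mathbb{F}^2$: $e_1^2=e_3^2=e_2$; $\mathfrak{J}_{1,2}^2\oplus\mathbb{F}$: $e_1^2=e_2$, $e_3^2=e_4$; $\mathfrak{J}_{1,4}\oplus\mathbb{F}$: $e_1^2=e_2$, $e_1e_3=e_4$; $\mathfrak{J}_{2,4}\oplus\mathbb{F}$: $e_1^2=e_3e_4=e_2$; $\mathfrak{J}_{1,2}\oplus\mathfrak{J}_{1,3}$: $e_1^2=e_2$, $e_3^2=e_5^2=e_4$; $\mathfrak{J}_{1,5}$: $e_1^2=e_2$, $e_1e_3=e_5$, $e_3^2=e_4$; $\mathfrak{J}_{2,5}$: $e_1^2=e_2$, $e_1e_4=e_3^2=e_5$; $\mathfrak{J}_{3,5}$: $e_1^2=e_2$,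 $e_1e_4=e_3e_4=e_5$, $e_3^2=-e_2+e_5$; $\mathfrak{J}_{4,5}$: $e_1^2=e_2$, $e_3^2=e_4$, $e_5^2=-e_2+e_4$; $\mathfrak{J}_{5,5}$: $e_1^2=e_2$, $e_3^2=e_4$, $e_3e_5=-e_2+e_4$; $\mathfrak{J}_{6,5}$: $e_1^2=e_1e_4=e_2$, $e_1e_3=e_5$; $\mathfrak{J}_{7,5}$: $e_1^2=e_3^2=e_4e_5=e_2$; $\mathfrak{J}_{8,5}$: $e_1^2=e_2$, $e_1e_4=e_5$, $e_2e_4=-2e_1e_5=2e_3$. Let $e^{i,j}_k\in\mathrm{S}^2$ be the symmetric bilinear map with $(e_i,e_j)\mapsto e_k$ (and $(e_j,e_i)\mapsto e_k$) that vanishes on all other pairs of basis vectors. Then the following hold. (1) All these are JJ algebras, and $\dim\mathrm{H}^2(\mathfrak{J},\mathfrak{J})$ is: $0$ for $\mathfrak{J}_{1,2}$; $4$ for $\mathfrak{J}_{1,2}\oplus\mathbb{F}$; $2$ for $\mathfrak{J}_{1,3}$; $15$ for $\mathfrak{J}_{1,2}\oplus\mathbb{F}^2$; $10$ for $\mathfrak{J}_{1,3}\oplus\mathbb{F}$;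 $2$ for $\mathfrak{J}_{1,2}^2$; $4$ for $\mathfrak{J}_{1,4}$; $8$ for $\mathfrak{J}_{2,4}$; $36$ for $\mathfrak{J}_{1,2}\oplus\mathbb{F}^3$; $27$ for $\mathfrak{J}_{1,3}\oplus\mathbb{F}^2$; $12$ for $\mathfrak{J}_{1,2}^2\oplus\mathbb{F}$; $16$ for $\mathfrak{J}_{1,4}\oplus\mathbb{F}$; $22$ for $\mathfrak{J}_{2,4}\oplus\mathbb{F}$; $8$ for $\mathfrak{J}_{1,2}\oplus\mathfrak{J}_{1,3}$; $6,10,8,4,6,13,20,1$ for $\mathfrak{J}_{1,5},\mathfrak{J}_{2,5},\mathfrak{J}_{3,5},\mathfrak{J}_{4,5},\mathfrak{J}_{5,5},\mathfrak{J}_{6,5},\mathfrak{J}_{7,5},\mathfrak{J}_{8,5}$, respectively. (2) The following maps are cocycles, and their classes form a basis of $\mathrm{H}^2(\mathfrak{J},\mathfrak{J})$ (none for $\mathfrak{J}_{1,2}$): - $\mathfrak{J}_{1,2}\oplus \mathbb{F}$: $e^{1,3}_1-2e^{2,3}_2,\ e^{1,3}_3,\ e^{3,3}_2,\ e^{3,3}_3$;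 - $\mathfrak{J}_{1,3}$: $e^{1,3}_1-2e^{2,3}_2+2e^{3,3}_{3},\ e^{1,3}_3-2e^{3,3}_1$; - $\mathfrak{J}_{1,2}\oplus \mathbb{F}^{2}$: $e^{1,3}_1-2e^{2,3}_2,\ e^{1,4}_1-2e^{2,4}_2,\ e^{1,3}_3,\ e^{1,3}_4,\ e^{1,4}_3,\ e^{1,4}_4,\ e^{3,3}_2,\ e^{3,3}_3,\ e^{3,3}_4,\ e^{3,4}_2,\ e^{3,4}_3,\ e^{3,4}_4,\ e^{4,4}_2,\ e^{4,4}_3,\ e^{4,4}_4$; - $\mathfrak{J}_{1,3}\oplus \mathbb{F}$: $e^{1,3}_1-2e^{2,3}_2+2e^{3,3}_3,\ e^{1,4}_1-2e^{2,4}_2+e^{3,4}_3,\ e^{1,3}_3-2e^{3,3}_1,\ e^{1,4}_3-e^{3,4}_1,\ e^{1,1}_4,\ e^{1,3}_4,\ e^{1,4}_4,\ e^{3,4}_4,\ e^{4,4}_2,\ e^{4,4}_4$; - $\mathfrak{J}_{1,2}^{2}$: $e^{1,3}_1-2e^{2,3}_2,\ e^{1,3}_3-2e^{1,4}_4$; -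 $\mathfrak{J}_{1,4}$: $e^{1,4}_2-2e^{2,3}_2,\ e^{1,4}_4-2e^{2,3}_4,\ 2e^{3,3}_3-e^{3,4}_4,\ e^{3,3}_2$; - $\mathfrak{J}_{2,4}$: $e^{1,3}_1-2e^{2,3}_2+2e^{3,4}_4,\ e^{1,4}_1-2e^{2,4}_2+4e^{4,4}_4,\ e^{1,3}_3-e^{3,4}_1,\ e^{1,3}_4-2e^{3,3}_1,\ e^{1,4}_3-2e^{4,4}_1,\ e^{1,4}_4-e^{3,4}_1,\ 2e^{3,3}_3-e^{3,4}_4,\ e^{3,4}_3-2e^{4,4}_4$; - $\mathfrak{J}_{1,2}\oplus \mathbb{F}^{3}$: $e^{1,4}_1-2e^{2,4}_2,\ e^{1,3}_1-2e^{2,3}_2,\ e^{1,5}_1-2e^{2,5}_2,\ e^{1,i_{1}}_{i_2},\ e^{j_1,j_2}_j$ where $3\leq i_1,i_2\leq 5,\ 3\leq j_1\leq j_2\leq 5,\ 2\leq j\leq 5$; - $\mathfrak{J}_{1,3}\oplus \mathbb{F}^{2}$: $e^{1,3}_1-2e^{2,3}_2+2e^{3,3}_3,\ e^{1,4}_1-2e^{2,4}_2+e^{3,4}_3,\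 e^{1,5}_1-2e^{2,5}_2+e^{3,5}_3,\ e^{1,3}_3-2e^{3,3}_1,\ e^{1,4}_3-e^{3,4}_1,\ e^{1,5}_3-e^{3,5}_1,\ e^{1,1}_{j_1},\ e^{1,3}_{j_1},\ e^{1,j_1}_{j_2},\ e^{3,j_1}_{j_2},\ e^{j_1,j_2}_i$ where $j_1,j_2\in\{4,5\}$, $i\in\{2,4,5\}$ (each map taken once); - $\mathfrak{J}_{1,2}^{2}\oplus \mathbb{F}$: $e^{1,3}_1-2e^{2,3}_2,\ e^{1,3}_3-2e^{1,4}_4,\ e^{1,5}_1-2e^{2,5}_2,\ e^{3,5}_3-2e^{4,5}_4,\ e^{1,3}_5,\ e^{1,5}_4,\ e^{1,5}_5,\ e^{3,5}_2,\ e^{3,5}_5,\ e^{5,5}_2,\ e^{5,5}_4,\ e^{5,5}_5$; - $\mathfrak{J}_{1,4}\oplus \mathbb{F}$: $e^{1,5}_1-2e^{2,5}_2-e^{4,5}_{4},\ e^{1,4}_2-2e^{2,3}_2,\ e^{1,4}_4-2e^{2,3}_4,\ e^{1,4}_5-2e^{2,3}_5,\ e^{1,5}_3-2e^{2,5}_4,\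 e^{3,4}_4-2e^{3,3}_3,\ e^{3,5}_3-e^{4,5}_4,\ e^{1,5}_2,\ e^{1,5}_5,\ e^{3,3}_2,\ e^{3,3}_5,\ e^{3,5}_2,\ e^{3,5}_5,\ e^{5,5}_2,\ e^{5,5}_4,\ e^{5,5}_5$; - $\mathfrak{J}_{2,4}\oplus \mathbb{F}$: $e^{1,3}_1-2e^{2,3}_2+2e^{3,4}_{4},\ e^{1,4}_1-2e^{2,4}_2+4e^{4,4}_4,\ e^{1,5}_1-2e^{2,5}_2+2e^{4,5}_4,\ e^{1,3}_3-e^{3,4}_1,\ e^{1,3}_4-2e^{3,3}_1,\ e^{1,4}_3-2e^{4,4}_1,\ e^{1,4}_4-e^{3,4}_1,\ e^{1,5}_3-e^{4,5}_1,\ e^{1,5}_4-e^{3,5}_1,\ e^{3,4}_4-2e^{3,3}_3,\ e^{3,4}_3-2e^{4,4}_4,\ e^{3,5}_3-e^{4,5}_4,\ e^{1,1}_5,\ e^{1,3}_5,\ e^{1,4}_5,\ e^{1,5}_5,\ e^{3,3}_5,\ e^{3,5}_5,\ e^{4,4}_5,\ e^{4,5}_5,\ e^{5,5}_2,\ e^{5,5}_5$;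 - $\mathfrak{J}_{1,2}\oplus \mathfrak{J}_{1,3}$: $e^{1,3}_3-2e^{1,4}_4+e^{1,5}_{5},\ e^{3,5}_3-2e^{4,5}_4+2e^{5,5}_5,\ e^{1,3}_1-2e^{2,3}_2,\ e^{1,3}_5-e^{1,5}_3,\ e^{1,5}_1-2e^{2,5}_2,\ e^{3,5}_5-2e^{5,5}_3,\ e^{3,3}_2,\ e^{3,5}_2$; - $\mathfrak{J}_{1,5}$: $e^{3,5}_2-2e^{1,4}_2,\ e^{3,5}_4-2e^{1,4}_4,\ e^{3,5}_5-2e^{1,4}_5,\ e^{1,5}_2-2e^{2,3}_2,\ e^{1,5}_4-2e^{2,3}_4,\ e^{1,5}_5-2e^{2,3}_5$; - $\mathfrak{J}_{2,5}$: $e^{1,3}_1-2e^{2,3}_2-e^{3,4}_4,\ e^{1,3}_3-2e^{1,5}_5+4e^{2,4}_5,\ e^{1,4}_1-2e^{2,4}_2-2e^{4,4}_4,\ e^{3,4}_3+4e^{4,4}_4-2e^{4,5}_5,\ e^{1,3}_4-2e^{2,3}_5,\ e^{1,4}_3-e^{3,4}_4,\ e^{1,4}_4-2e^{2,4}_5,\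 e^{1,4}_2,\ e^{3,4}_2,\ e^{4,4}_2$; - $\mathfrak{J}_{3,5}$: $e^{1,3}_1-2e^{2,3}_2+2e^{3,4}_1-2e^{3,4}_3-e^{3,4}_4-2e^{3,5}_2-12e^{4,4}_4+6e^{4,5}_5,\ e^{1,3}_3+2e^{3,3}_1-2e^{3,3}_4-3e^{3,4}_4+2e^{3,5}_5,\ e^{1,5}_2-2e^{2,4}_2-e^{3,3}_1-e^{3,4}_1+e^{3,4}_3+2e^{4,4}_4-e^{4,5}_5,\ e^{3,3}_3-e^{3,4}_1+e^{3,4}_3+e^{3,4}_4+e^{3,5}_2-e^{3,5}_5+6e^{4,4}_4-3e^{4,5}_5,\ e^{1,3}_4-2e^{2,3}_5-2e^{3,3}_4,\ e^{1,5}_5-2e^{2,4}_5-e^{3,3}_4-2e^{3,4}_4+e^{3,5}_5,\ e^{4,4}_2,\ e^{4,4}_5$; - $\mathfrak{J}_{4,5}$: $e^{1,3}_1-2e^{2,3}_2+e^{3,5}_{5}-2e^{5,5}_3,\ e^{1,3}_3-2e^{1,4}_4+e^{1,5}_5+2e^{5,5}_1,\ e^{1,3}_5-e^{1,5}_3+e^{3,5}_1,\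 e^{1,5}_1-2e^{2,5}_2+e^{3,5}_3-2e^{4,5}_4+2e^{5,5}_5$; - $\mathfrak{J}_{5,5}$: $e^{1,3}_1-2e^{2,3}_2-2e^{3,5}_3-4e^{4,5}_2+4e^{4,5}_4-4e^{5,5}_5,\ e^{1,5}_1-2e^{2,5}_2+e^{3,5}_3-2e^{4,5}_4+2e^{5,5}_5,\ e^{1,3}_3-2e^{1,4}_4+e^{1,5}_5+2e^{3,5}_1,\ e^{1,3}_5+2e^{1,4}_2-2e^{1,4}_4+2e^{1,5}_5,\ e^{3,5}_5+2e^{4,5}_2-2e^{4,5}_4+4e^{5,5}_5,\ e^{5,5}_2$; - $\mathfrak{J}_{6,5}$: $e^{1,4}_1-2e^{2,4}_2+2e^{4,4}_4-e^{4,5}_5,\ e^{1,4}_3-2e^{2,4}_5+4e^{4,4}_3,\ e^{1,4}_4-2e^{2,4}_2+4e^{4,4}_4,\ e^{1,5}_2-2e^{2,3}_2+2e^{4,5}_2,\ e^{1,5}_5-2e^{2,3}_5+2e^{4,5}_5,\ e^{3,5}_5-2e^{3,3}_3,\ e^{3,5}_2-2e^{3,3}_4,\ e^{3,4}_3-e^{4,5}_5,\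 e^{3,4}_4-e^{4,5}_2,\ e^{3,3}_2,\ e^{3,3}_5,\ e^{4,4}_2,\ e^{4,4}_5$; - $\mathfrak{J}_{7,5}$: $e^{1,3}_1-2e^{2,3}_2+2e^{3,3}_{3}+2e^{4,5}_3,\ e^{1,4}_1-2e^{2,4}_2+e^{3,4}_3+2e^{4,5}_5,\ e^{1,5}_1-2e^{2,5}_2+e^{3,5}_3+4e^{5,5}_5,\ e^{1,3}_4-e^{3,5}_1,\ e^{1,3}_5-e^{3,4}_1,\ e^{1,4}_3-e^{3,4}_1,\ e^{1,4}_4-e^{4,5}_1,\ e^{1,5}_3-e^{3,5}_1,\ \ e^{1,5}_5-e^{4,5}_1,\ e^{3,4}_4-e^{4,5}_3,\ e^{3,5}_5-e^{4,5}_3,\ e^{1,3}_3-2e^{3,3}_1,\ e^{1,4}_5-2e^{4,4}_1,\ e^{1,5}_4-2e^{5,5}_1,\ e^{3,5}_3-2e^{3,3}_4, \ e^{3,4}_3-2e^{3,3}_5,\ e^{3,4}_5-2e^{4,4}_3,\ e^{3,5}_4-2e^{5,5}_3,\ e^{4,5}_5-2e^{4,4}_4,\ e^{4,5}_4-2e^{5,5}_5$;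 - $\mathfrak{J}_{8,5}$: $e^{3,4}_3-2e^{4,4}_4+e^{4,5}_5+2e^{5,5}_3$. (3) Among the cocycles listed in (2), exactly the following are extendible (none for the algebras that are not mentioned): - $\mathfrak{J}_{1,2}\oplus \mathbb{F}$: $e^{3,3}_2$; - $\mathfrak{J}_{1,2}\oplus \mathbb{F}^{2}$: $e^{1,3}_4,\ e^{1,4}_3,\ e^{3,3}_2,\ e^{3,3}_4,\ e^{3,4}_2,\ e^{4,4}_2,\ e^{4,4}_3$; - $\mathfrak{J}_{1,3}\oplus \mathbb{F}$: $e^{1,1}_4,\ e^{1,3}_4,\ e^{4,4}_2$; - $\mathfrak{J}_{1,4}$: $e^{3,3}_2$; - $\mathfrak{J}_{1,2}\oplus \mathbb{F}^{3}$: $e^{1,i_{1}}_{i_2},\ e^{j_1,j_2}_j$ where $3\leq i_1\neq i_2\leq 5,\ 3\leq j_1\leq j_2\leq 5,\ 2\leq j\leq 5,\ j\neq j_1, j_2$; - $\mathfrak{J}_{1,3}\oplus \mathbb{F}^{2}$: $e^{1,1}_{j_1},\ e^{1,3}_{j_1},\ e^{1,j_1}_{j_2},\ e^{3,j_1}_{j_2},\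 e^{j_1,j_1}_2,\ e^{j_1,j_1}_{j_2},\ e^{4,5}_2$ where $j_1,j_2\in\{4,5\}$, $j_1\neq j_2$; - $\mathfrak{J}_{1,2}^{2}\oplus \mathbb{F}$: $e^{1,3}_5,\ e^{1,5}_4,\ e^{3,5}_2,\ e^{5,5}_2,\ e^{5,5}_4$; - $\mathfrak{J}_{1,4}\oplus \mathbb{F}$: $e^{1,4}_5-2e^{2,3}_5,\ e^{1,5}_3-2e^{2,5}_4,\ e^{1,5}_2,\ e^{3,3}_2,\ e^{3,3}_5,\ e^{3,5}_2,\ e^{5,5}_2,\ e^{5,5}_4$; - $\mathfrak{J}_{2,4}\oplus \mathbb{F}$: $e^{1,1}_5,\ e^{1,3}_5,\ e^{1,4}_5,\ e^{3,3}_5,\ e^{4,4}_5,\ e^{5,5}_2$; - $\mathfrak{J}_{1,2}\oplus \mathfrak{J}_{1,3}$: $e^{3,3}_2,\ e^{3,5}_2$; - $\mathfrak{J}_{1,5}$: $e^{3,5}_2-2e^{1,4}_2,\ e^{1,5}_4-2e^{2,3}_4$; - $\mathfrak{J}_{2,5}$: $e^{1,3}_4-2e^{2,3}_5,\ e^{1,4}_2,\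 e^{3,4}_2,\ e^{4,4}_2$; - $\mathfrak{J}_{3,5}$: $e^{1,3}_4-2e^{2,3}_5-2e^{3,3}_4,\ e^{4,4}_2,\ e^{4,4}_5$; - $\mathfrak{J}_{5,5}$: $e^{5,5}_2$; - $\mathfrak{J}_{6,5}$: $e^{1,4}_3-2e^{2,4}_5+4e^{4,4}_3,\ e^{3,5}_2-2e^{3,3}_4,\ e^{3,3}_2,\ e^{3,3}_5,\ e^{4,4}_2,\ e^{4,4}_5$. (4) Consider the diagrams with the following arrows. - Dimension 3: $\mathfrak{J}_{1,2}\oplus\mathbb{F}\to\mathfrak{J}_{1,3}$. - Dimension 4: $\mathfrak{J}_{1,2}\oplus\mathbb{F}^2\to\mathfrak{J}_{1,4},\ \mathfrak{J}_{1,3}\oplus\mathbb{F}$; $\mathfrak{J}_{1,4}\to\mathfrak{J}_{1,2}^2$; $\mathfrak{J}_{1,3}\oplus\mathbb{F}\to\mathfrak{J}_{1,2}^2,\ \mathfrak{J}_{2,4}$. - Dimension 5: $\mathfrak{J}_{1,2}\oplus\mathbb{F}^3\to\mathfrak{J}_{1,4}\oplus\mathbb{F},\ \mathfrak{J}_{1,3}\oplus\mathbb{F}^2$;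 $\mathfrak{J}_{1,4}\oplus\mathbb{F}\to\mathfrak{J}_{1,2}^2\oplus\mathbb{F},\ \mathfrak{J}_{6,5}$; $\mathfrak{J}_{1,3}\oplus\mathbb{F}^2\to\mathfrak{J}_{1,2}^2\oplus\mathbb{F},\ \mathfrak{J}_{2,4}\oplus\mathbb{F}$; $\mathfrak{J}_{1,2}^2\oplus\mathbb{F}\to\mathfrak{J}_{1,5},\ \mathfrak{J}_{2,5},\ \mathfrak{J}_{1,2}\oplus\mathfrak{J}_{1,3}$; $\mathfrak{J}_{2,4}\oplus\mathbb{F}\to\mathfrak{J}_{1,2}\oplus\mathfrak{J}_{1,3},\ \mathfrak{J}_{2,5},\ \mathfrak{J}_{3,5},\ \mathfrak{J}_{7,5}$; $\mathfrak{J}_{6,5}\to\mathfrak{J}_{5,5},\ \mathfrak{J}_{3,5}$; $\mathfrak{J}_{1,5}\to\mathfrak{J}_{8,5}$; $\mathfrak{J}_{2,5}\to\mathfrak{J}_{8,5},\ \mathfrak{J}_{5,5}$; $\mathfrak{J}_{1,2}\oplus\mathfrak{J}_{1,3}\to\mathfrak{J}_{4,5}$; $\mathfrak{J}_{5,5}\to\mathfrak{J}_{4,5}$;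 $\mathfrak{J}_{3,5}\to\mathfrak{J}_{4,5},\ \mathfrak{J}_{8,5}$. Each cocycle listed in (3) for an algebra $\mathfrak{J}$ defines a jump deformation $\mathfrak{J}\to\mathfrak{J}'$ to one of the above algebras that is reached from $\mathfrak{J}$ by a nonempty directed path in the diagrams; and each arrow $\mathfrak{J}\to\mathfrak{J}'$ of the diagrams is a jump deformation defined by one of the cocycles listed in (3) for $\mathfrak{J}$. -/

import Mathlib

set_option maxSynthPendingDepth 3

section General

variable {F : Type*} [Field F] {V W : Type*} [AddCommGroup V] [Module F V]
  [AddCommGroup W] [Module F W]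

/-- The Jacobi-Jordan identities for a binary operation: commutativity and the Jacobi identity. -/
def IsJacobiJordan {A : Type*} [AddCommGroup A] (op : A → A → A) : Prop :=
  (∀ x y, op x y = op y x) ∧
    ∀ x y z, op x (op y z) + op y (op z x) + op z (op x y) = 0

/-- Bilinear maps `V × V → V`. A (not necessarily associative) algebra structure on the vector
space `V` is such a map. -/
abbrev BilinMap (F V : Type*) [Field F] [AddCommGroup V] [Module F V] : Type _ :=
  V →ₗ[F] V →ₗ[F] V

/-- `μ` makes `V` a Jacobi-Jordan algebra. -/
def IsJJAlgebra (μ : BilinMap F V) : Prop := IsJacobiJordan fun x y => μ x y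

/-- Isomorphism of the algebras `(V, μ)` and `(W, ν)`. -/
def AlgIso (μ : BilinMap F V) (ν : BilinMap F W) : Prop :=
  ∃ e : V ≃ₗ[F] W, ∀ x y, e (μ x y) = ν (e x) (e y)

/-- The space `S²(J, J)` of symmetric bilinear maps. -/
def symBilin (F V : Type*) [Field F] [AddCommGroup V] [Module F V] :
    Submodule F (BilinMap F V) where
  carrier := {φ | ∀ x y, φ x y = φ y x}
  add_mem' := by
    intro a b ha hb x y
    simp only [LinearMap.add_apply, ha x y, hb x y]
  zero_mem' := by
    intro x y
    simp
  smul_mem' := by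
    intro c a ha x y
    simp only [LinearMap.smul_apply, ha x y]

/-- The differential on `S¹(J, J) = End J`: `df (x, y) = f (x y) - x f(y) - y f(x)`. -/
def d1 (μ : BilinMap F V) : (V →ₗ[F] V) →ₗ[F] BilinMap F V where
  toFun f := LinearMap.mk₂ F (fun x y => f (μ x y) - μ x (f y) - μ y (f x))
    (by intro x x' y; simp only [map_add, LinearMap.add_apply]; abel)
    (by intro c x y; simp only [map_smul, LinearMap.smul_apply, smul_sub])
    (by intro x y y'; simp only [map_add, LinearMap.add_apply]; abel)
    (by intro c x y; simp only [map_smul, LinearMap.smul_apply, smul_sub])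
  map_add' f g := by
    ext x y
    simp only [LinearMap.mk₂_apply, LinearMap.add_apply, map_add]
    abel
  map_smul' c f := by
    ext x y
    simp only [LinearMap.mk₂_apply, LinearMap.smul_apply, map_smul, smul_sub, RingHom.id_apply]

/-- The differential on `S²(J, J)`:
`dφ (x, y, z) = φ(x, yz) + φ(y, zx) + φ(z, xy) + x φ(y, z) + y φ(z, x) + z φ(x, y)`. -/
def d2 (μ φ : BilinMap F V) (x y z : V) : V :=
  φ x (μ y z) + φ y (μ z x) + φ z (μ x y) + μ x (φ y z) + μ y (φ z x) + μ z (φ x y)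

/-- The space `Z²(J, J)` of 2-cocycles: the symmetric bilinear maps killed by the differential. -/
def Z2 (μ : BilinMap F V) : Submodule F (BilinMap F V) where
  carrier := {φ | φ ∈ symBilin F V ∧ ∀ x y z, d2 μ φ x y z = 0}
  add_mem' := by
    rintro a b ⟨ha, ha'⟩ ⟨hb, hb'⟩
    refine ⟨add_mem ha hb, fun x y z => ?_⟩
    have h := congrArg₂ (· + ·) (ha' x y z) (hb' x y z)
    simp only [d2, LinearMap.add_apply, map_add, add_zero] at h ⊢
    rw [← h]
    abel
  zero_mem' := ⟨zero_mem _, fun x y z => by simp [d2]⟩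
  smul_mem' := by
    rintro c a ⟨ha, ha'⟩
    refine ⟨Submodule.smul_mem _ c ha, fun x y z => ?_⟩
    have h := congrArg (c • ·) (ha' x y z)
    simpa only [d2, LinearMap.smul_apply, map_smul, smul_add, smul_zero] using h

/-- The space `B²(J, J)` of 2-coboundaries, the image of `S¹(J, J)` under the differential. -/
def B2 (μ : BilinMap F V) : Submodule F (BilinMap F V) := LinearMap.range (d1 μ)

/-- Coboundaries of a Jacobi-Jordan algebra are cocycles. -/
theorem B2_le_Z2 {μ : BilinMap F V} (hμ : IsJJAlgebra μ) : B2 μ ≤ Z2 μ := by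
  obtain ⟨hc, hJ⟩ := hμ
  rintro _ ⟨f, rfl⟩
  refine ⟨fun x y => ?_, fun x y z => ?_⟩
  · change f (μ x y) - μ x (f y) - μ y (f x) = f (μ y x) - μ y (f x) - μ x (f y)
    rw [show μ y x = μ x y from hc y x]
    abel
  · have h0 := congrArg f (hJ x y z)
    have h1 := hJ (f x) y z
    have h2 := hJ (f y) z x
    have h3 := hJ (f z) x y
    replace hc : ∀ a b, μ a b = μ b a := hc
    dsimp only at h0 h1 h2 h3
    simp only [map_add, map_zero] at h0
    simp only [d1, d2, LinearMap.coe_mk, AddHom.coe_mk, LinearMap.mk₂_apply, map_sub]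
    rw [hc z (f x)] at h1
    rw [hc x (f y)] at h2
    rw [hc y (f z)] at h3
    rw [hc (μ y z) (f x), hc (μ z x) (f y), hc (μ x y) (f z), hc z (f x), hc z (f y), hc x (f y),
      hc x (f z), hc y (f z), hc y (f x)]
    linear_combination (norm := abel) h0 - h1 - h2 - h3

/-- The adjoint 2-cohomology `H²(J, J) = Z²(J, J) / B²(J, J)`. -/
abbrev H2 (μ : BilinMap F V) : Type _ := Z2 μ ⧸ (B2 μ).submoduleOf (Z2 μ)

/-- The class in `H²(J, J)` of a cocycle. -/
def H2.mk (μ : BilinMap F V) (φ : BilinMap F V) (h : φ ∈ Z2 μ) : H2 μ :=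
  ((B2 μ).submoduleOf (Z2 μ)).mkQ ⟨φ, h⟩

/-- The `F[[t]]`-bilinear operation on `J[[t]]` with `(x · y)_t = ∑ tⁱ φᵢ(x, y)` for `x, y ∈ J`.
An element `∑ tⁿ fₙ` of `J[[t]]` is given by its sequence of coefficients `f : ℕ → J`. -/
def formalMul (φ : ℕ → BilinMap F V) (f g : ℕ → V) : ℕ → V := fun n =>
  ∑ p ∈ Finset.HasAntidiagonal.antidiagonal n, ∑ q ∈ Finset.HasAntidiagonal.antidiagonal p.2, φ p.1 (f q.1) (g q.2)

/-- The sequence `φ` is a formal 1-parameter deformation of the algebra `(V, μ)`: its terms are in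
`S²(J, J)`, it starts with the multiplication of the algebra, and it makes `J[[t]]` a
Jacobi-Jordan algebra. -/
def IsFormalDeformation (μ : BilinMap F V) (φ : ℕ → BilinMap F V) : Prop :=
  φ 0 = μ ∧ (∀ n, φ n ∈ symBilin F V) ∧ IsJacobiJordan (formalMul φ)

/-- The infinitesimal deformation `μ + t φ` (over `F[t]/(t²)`) given by the cocycle `φ` extends to
a formal 1-parameter deformation. -/
def IsExtendible (μ φ : BilinMap F V) : Prop :=
  ∃ ψ : ℕ → BilinMap F V, IsFormalDeformation μ ψ ∧ ψ 1 = φ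

/-- The sequence `μ, φ, 0, 0, …`, that is, the family `μ + t φ` without higher order terms. -/
def linearFamily (μ φ : BilinMap F V) : ℕ → BilinMap F V
  | 0 => μ
  | 1 => φ
  | _ => 0

/-- The value at the parameter `t ∈ F` of a family that is polynomial in `t`. -/
noncomputable def specialize (φ : ℕ → BilinMap F V) (t : F) : BilinMap F V :=
  ∑ᶠ n, t ^ n • φ n

/-- `φ` is a formal 1-parameter deformation of `(V, μ)`, polynomial in the parameter, and a jump
deformation to `(W, ν)`: for all nonzero values of the parameter near the origin (in the Zariski
topology, that is, for all but finitely many) it gives an algebra isomorphic to `(W, ν)`,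
which is not isomorphic to the original algebra. -/
def IsJumpDeformation (μ : BilinMap F V) (φ : ℕ → BilinMap F V) (ν : BilinMap F W) : Prop :=
  IsFormalDeformation μ φ ∧ (Function.support φ).Finite ∧
    (∃ S : Finset F, ∀ t : F, t ≠ 0 → t ∉ S → AlgIso (specialize φ t) ν) ∧ ¬ AlgIso μ ν

end General

section LowDimension

/-- A finite integral combination of symmetric bilinear maps `e^{i,j}_k`: a list of entries
`(q, i, j, k)`, each of which stands for the summand `q e^{i,j}_k`. -/
abbrev Combination : Type := List (ℤ × ℕ × ℕ × ℕ)

/-- The coefficient at `e_k` of the value at `(e_i, e_j)` of a combination of maps `e^{i,j}_k`;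
here `e^{i,j}_k` sends `(e_i, e_j)` and `(e_j, e_i)` to `e_k`, and all other pairs of basis vectors
to `0`. -/
def Combination.coeff (c : Combination) (i j k : ℕ) : ℤ :=
  (c.map fun s =>
    if (s.2.1 = i ∧ s.2.2.1 = j ∨ s.2.1 = j ∧ s.2.2.1 = i) ∧ s.2.2.2 = k then s.1 else 0).sum

/-- The bilinear map on `F^n` defined by a combination of maps `e^{i,j}_k`. The basis vectors are
numbered from `1`, so that `e_i` is the standard basis vector with index `i - 1` in `Fin n`. -/
def Combination.toBilin (F : Type*) [Field F] (n : ℕ) (c : Combination) :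
    BilinMap F (Fin n → F) :=
  LinearMap.mk₂ F
    (fun x y (k : Fin n) =>
      ∑ i : Fin n, ∑ j : Fin n, (c.coeff (i + 1) (j + 1) (k + 1) : F) * (x i * y j))
    (by intro x x' y; funext k
        simp only [Pi.add_apply, add_mul, mul_add, Finset.sum_add_distrib])
    (by intro a x y; funext k
        simp only [Pi.smul_apply, smul_eq_mul, Finset.mul_sum]
        exact Finset.sum_congr rfl fun i _ => Finset.sum_congr rfl fun j _ => by ring)
    (by intro x y y'; funext k
        simp only [Pi.add_apply, mul_add, Finset.sum_add_distrib])
    (by intro a x y; funext k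
        simp only [Pi.smul_apply, smul_eq_mul, Finset.mul_sum]
        exact Finset.sum_congr rfl fun i _ => Finset.sum_congr rfl fun j _ => by ring)

theorem Combination.toBilin_apply (F : Type*) [Field F] (n : ℕ) (c : Combination)
    (x y : Fin n → F) (k : Fin n) :
    c.toBilin F n x y k =
      ∑ i : Fin n, ∑ j : Fin n, (c.coeff (i + 1) (j + 1) (k + 1) : F) * (x i * y j) :=
  rfl

/-- Names of the nontrivial Jacobi-Jordan algebras of dimension at most 5 in the classification
over algebraically closed fields of characteristic not 2 or 3. `J12` is `J_{1,2}`, and so on;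
underscores stand for direct sums and a final `F`, `F2`, `F3` for a summand `F`, `F²`, `F³` with
zero multiplication. -/
inductive JJName : Type
  | J12
  | J12_F | J13
  | J12_F2 | J13_F | J12_J12 | J14 | J24
  | J12_F3 | J13_F2 | J12_J12_F | J14_F | J24_F | J12_J13
  | J15 | J25 | J35 | J45 | J55 | J65 | J75 | J85

namespace JJName

/-- The dimension of the algebra. -/
def dim : JJName → ℕ
  | .J12 => 2
  | .J12_F | .J13 => 3
  | .J12_F2 | .J13_F | .J12_J12 | .J14 | .J24 => 4
  | _ => 5

/-- The multiplication tables: an entry `(q, i, j, k)` stands for a summand `q e_k` of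
`e_i e_j = e_j e_i`; products that are not listed are zero. -/
def table : JJName → Combination
  | .J12 => [(1, 1, 1, 2)]
  | .J12_F => [(1, 1, 1, 2)]
  | .J13 => [(1, 1, 1, 2), (1, 3, 3, 2)]
  | .J12_F2 => [(1, 1, 1, 2)]
  | .J13_F => [(1, 1, 1, 2), (1, 3, 3, 2)]
  | .J12_J12 => [(1, 1, 1, 2), (1, 3, 3, 4)]
  | .J14 => [(1, 1, 1, 2), (1, 1, 3, 4)]
  | .J24 => [(1, 1, 1, 2), (1, 3, 4, 2)]
  | .J12_F3 => [(1, 1, 1, 2)]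
  | .J13_F2 => [(1, 1, 1, 2), (1, 3, 3, 2)]
  | .J12_J12_F => [(1, 1, 1, 2), (1, 3, 3, 4)]
  | .J14_F => [(1, 1, 1, 2), (1, 1, 3, 4)]
  | .J24_F => [(1, 1, 1, 2), (1, 3, 4, 2)]
  | .J12_J13 => [(1, 1, 1, 2), (1, 3, 3, 4), (1, 5, 5, 4)]
  | .J15 => [(1, 1, 1, 2), (1, 1, 3, 5), (1, 3, 3, 4)]
  | .J25 => [(1, 1, 1, 2), (1, 1, 4, 5), (1, 3, 3, 5)]
  | .J35 => [(1, 1, 1, 2), (1, 1, 4, 5), (1, 3, 4, 5), (-1, 3, 3, 2), (1, 3, 3, 5)]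
  | .J45 => [(1, 1, 1, 2), (1, 3, 3, 4), (-1, 5, 5, 2), (1, 5, 5, 4)]
  | .J55 => [(1, 1, 1, 2), (1, 3, 3, 4), (-1, 3, 5, 2), (1, 3, 5, 4)]
  | .J65 => [(1, 1, 1, 2), (1, 1, 4, 2), (1, 1, 3, 5)]
  | .J75 => [(1, 1, 1, 2), (1, 3, 3, 2), (1, 4, 5, 2)]
  | .J85 => [(1, 1, 1, 2), (1, 1, 4, 5), (2, 2, 4, 3), (-1, 1, 5, 3)]

/-- The multiplication of the algebra with the given name, on `F^n`. -/
def mul (F : Type*) [Field F] (X : JJName) : BilinMap F (Fin X.dim → F) :=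
  X.table.toBilin F X.dim

/-- The bilinear map on the algebra with the given name that a combination of maps `e^{i,j}_k`
defines. -/
def cochain (F : Type*) [Field F] (X : JJName) (c : Combination) : BilinMap F (Fin X.dim → F) :=
  c.toBilin F X.dim

/-- The table of the dimensions of `H²(J, J)`. -/
def dimH2 : JJName → ℕ
  | .J12 => 0
  | .J12_F => 4
  | .J13 => 2
  | .J12_F2 => 15
  | .J13_F => 10
  | .J12_J12 => 2
  | .J14 => 4
  | .J24 => 8
  | .J12_F3 => 36
  | .J13_F2 => 27
  | .J12_J12_F => 12
  | .J14_F => 16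
  | .J24_F => 22
  | .J12_J13 => 8
  | .J15 => 6
  | .J25 => 10
  | .J35 => 8
  | .J45 => 4
  | .J55 => 6
  | .J65 => 13
  | .J75 => 20
  | .J85 => 1

/-- The representative cocycles of `H²(J, J)`. -/
def representatives : JJName → List Combination
  | .J12 => []
  | .J12_F =>
    [ [(1, 1, 3, 1), (-2, 2, 3, 2)], [(1, 1, 3, 3)], [(1, 3, 3, 2)], [(1, 3, 3, 3)] ]
  | .J13 =>
    [ [(1, 1, 3, 1), (-2, 2, 3, 2), (2, 3, 3, 3)], [(1, 1, 3, 3), (-2, 3, 3, 1)] ]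
  | .J12_F2 =>
    [ [(1, 1, 3, 1), (-2, 2, 3, 2)], [(1, 1, 4, 1), (-2, 2, 4, 2)], [(1, 1, 3, 3)],
      [(1, 1, 3, 4)], [(1, 1, 4, 3)], [(1, 1, 4, 4)], [(1, 3, 3, 2)], [(1, 3, 3, 3)],
      [(1, 3, 3, 4)], [(1, 3, 4, 2)], [(1, 3, 4, 3)], [(1, 3, 4, 4)], [(1, 4, 4, 2)],
      [(1, 4, 4, 3)], [(1, 4, 4, 4)] ]
  | .J13_F =>
    [ [(1, 1, 3, 1), (-2, 2, 3, 2), (2, 3, 3, 3)], [(1, 1, 4, 1), (-2, 2, 4, 2), (1, 3, 4, 3)],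
      [(1, 1, 3, 3), (-2, 3, 3, 1)], [(1, 1, 4, 3), (-1, 3, 4, 1)], [(1, 1, 1, 4)],
      [(1, 1, 3, 4)], [(1, 1, 4, 4)], [(1, 3, 4, 4)], [(1, 4, 4, 2)], [(1, 4, 4, 4)] ]
  | .J12_J12 =>
    [ [(1, 1, 3, 1), (-2, 2, 3, 2)], [(1, 1, 3, 3), (-2, 1, 4, 4)] ]
  | .J14 =>
    [ [(1, 1, 4, 2), (-2, 2, 3, 2)], [(1, 1, 4, 4), (-2, 2, 3, 4)],
      [(2, 3, 3, 3), (-1, 3, 4, 4)], [(1, 3, 3, 2)] ]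
  | .J24 =>
    [ [(1, 1, 3, 1), (-2, 2, 3, 2), (2, 3, 4, 4)], [(1, 1, 4, 1), (-2, 2, 4, 2), (4, 4, 4, 4)],
      [(1, 1, 3, 3), (-1, 3, 4, 1)], [(1, 1, 3, 4), (-2, 3, 3, 1)],
      [(1, 1, 4, 3), (-2, 4, 4, 1)], [(1, 1, 4, 4), (-1, 3, 4, 1)],
      [(2, 3, 3, 3), (-1, 3, 4, 4)], [(1, 3, 4, 3), (-2, 4, 4, 4)] ]
  | .J12_F3 =>
    [ [(1, 1, 4, 1), (-2, 2, 4, 2)], [(1, 1, 3, 1), (-2, 2, 3, 2)],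
      [(1, 1, 5, 1), (-2, 2, 5, 2)], [(1, 1, 3, 3)], [(1, 1, 3, 4)], [(1, 1, 3, 5)],
      [(1, 1, 4, 3)], [(1, 1, 4, 4)], [(1, 1, 4, 5)], [(1, 1, 5, 3)], [(1, 1, 5, 4)],
      [(1, 1, 5, 5)], [(1, 3, 3, 2)], [(1, 3, 3, 3)], [(1, 3, 3, 4)], [(1, 3, 3, 5)],
      [(1, 3, 4, 2)], [(1, 3, 4, 3)], [(1, 3, 4, 4)], [(1, 3, 4, 5)], [(1, 3, 5, 2)],
      [(1, 3, 5, 3)], [(1, 3, 5, 4)], [(1, 3, 5, 5)], [(1, 4, 4, 2)], [(1, 4, 4, 3)],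
      [(1, 4, 4, 4)], [(1, 4, 4, 5)], [(1, 4, 5, 2)], [(1, 4, 5, 3)], [(1, 4, 5, 4)],
      [(1, 4, 5, 5)], [(1, 5, 5, 2)], [(1, 5, 5, 3)], [(1, 5, 5, 4)], [(1, 5, 5, 5)] ]
  | .J13_F2 =>
    [ [(1, 1, 3, 1), (-2, 2, 3, 2), (2, 3, 3, 3)], [(1, 1, 4, 1), (-2, 2, 4, 2), (1, 3, 4, 3)],
      [(1, 1, 5, 1), (-2, 2, 5, 2), (1, 3, 5, 3)], [(1, 1, 3, 3), (-2, 3, 3, 1)],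
      [(1, 1, 4, 3), (-1, 3, 4, 1)], [(1, 1, 5, 3), (-1, 3, 5, 1)], [(1, 1, 1, 4)],
      [(1, 1, 1, 5)], [(1, 1, 3, 4)], [(1, 1, 3, 5)], [(1, 1, 4, 4)], [(1, 1, 4, 5)],
      [(1, 1, 5, 4)], [(1, 1, 5, 5)], [(1, 3, 4, 4)], [(1, 3, 4, 5)], [(1, 3, 5, 4)],
      [(1, 3, 5, 5)], [(1, 4, 4, 2)], [(1, 4, 4, 4)], [(1, 4, 4, 5)], [(1, 4, 5, 2)],
      [(1, 4, 5, 4)], [(1, 4, 5, 5)], [(1, 5, 5, 2)], [(1, 5, 5, 4)], [(1, 5, 5, 5)] ]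
  | .J12_J12_F =>
    [ [(1, 1, 3, 1), (-2, 2, 3, 2)], [(1, 1, 3, 3), (-2, 1, 4, 4)],
      [(1, 1, 5, 1), (-2, 2, 5, 2)], [(1, 3, 5, 3), (-2, 4, 5, 4)], [(1, 1, 3, 5)],
      [(1, 1, 5, 4)], [(1, 1, 5, 5)], [(1, 3, 5, 2)], [(1, 3, 5, 5)], [(1, 5, 5, 2)],
      [(1, 5, 5, 4)], [(1, 5, 5, 5)] ]
  | .J14_F =>
    [ [(1, 1, 5, 1), (-2, 2, 5, 2), (-1, 4, 5, 4)], [(1, 1, 4, 2), (-2, 2, 3, 2)],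
      [(1, 1, 4, 4), (-2, 2, 3, 4)], [(1, 1, 4, 5), (-2, 2, 3, 5)],
      [(1, 1, 5, 3), (-2, 2, 5, 4)], [(1, 3, 4, 4), (-2, 3, 3, 3)],
      [(1, 3, 5, 3), (-1, 4, 5, 4)], [(1, 1, 5, 2)], [(1, 1, 5, 5)], [(1, 3, 3, 2)],
      [(1, 3, 3, 5)], [(1, 3, 5, 2)], [(1, 3, 5, 5)], [(1, 5, 5, 2)], [(1, 5, 5, 4)],
      [(1, 5, 5, 5)] ]
  | .J24_F =>
    [ [(1, 1, 3, 1), (-2, 2, 3, 2), (2, 3, 4, 4)], [(1, 1, 4, 1), (-2, 2, 4, 2), (4, 4, 4, 4)],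
      [(1, 1, 5, 1), (-2, 2, 5, 2), (2, 4, 5, 4)], [(1, 1, 3, 3), (-1, 3, 4, 1)],
      [(1, 1, 3, 4), (-2, 3, 3, 1)], [(1, 1, 4, 3), (-2, 4, 4, 1)],
      [(1, 1, 4, 4), (-1, 3, 4, 1)], [(1, 1, 5, 3), (-1, 4, 5, 1)],
      [(1, 1, 5, 4), (-1, 3, 5, 1)], [(1, 3, 4, 4), (-2, 3, 3, 3)],
      [(1, 3, 4, 3), (-2, 4, 4, 4)], [(1, 3, 5, 3), (-1, 4, 5, 4)], [(1, 1, 1, 5)],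
      [(1, 1, 3, 5)], [(1, 1, 4, 5)], [(1, 1, 5, 5)], [(1, 3, 3, 5)], [(1, 3, 5, 5)],
      [(1, 4, 4, 5)], [(1, 4, 5, 5)], [(1, 5, 5, 2)], [(1, 5, 5, 5)] ]
  | .J12_J13 =>
    [ [(1, 1, 3, 3), (-2, 1, 4, 4), (1, 1, 5, 5)], [(1, 3, 5, 3), (-2, 4, 5, 4), (2, 5, 5, 5)],
      [(1, 1, 3, 1), (-2, 2, 3, 2)], [(1, 1, 3, 5), (-1, 1, 5, 3)],
      [(1, 1, 5, 1), (-2, 2, 5, 2)], [(1, 3, 5, 5), (-2, 5, 5, 3)], [(1, 3, 3, 2)],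
      [(1, 3, 5, 2)] ]
  | .J15 =>
    [ [(1, 3, 5, 2), (-2, 1, 4, 2)], [(1, 3, 5, 4), (-2, 1, 4, 4)],
      [(1, 3, 5, 5), (-2, 1, 4, 5)], [(1, 1, 5, 2), (-2, 2, 3, 2)],
      [(1, 1, 5, 4), (-2, 2, 3, 4)], [(1, 1, 5, 5), (-2, 2, 3, 5)] ]
  | .J25 =>
    [ [(1, 1, 3, 1), (-2, 2, 3, 2), (-1, 3, 4, 4)],
      [(1, 1, 3, 3), (-2, 1, 5, 5), (4, 2, 4, 5)],
      [(1, 1, 4, 1), (-2, 2, 4, 2), (-2, 4, 4, 4)],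
      [(1, 3, 4, 3), (4, 4, 4, 4), (-2, 4, 5, 5)], [(1, 1, 3, 4), (-2, 2, 3, 5)],
      [(1, 1, 4, 3), (-1, 3, 4, 4)], [(1, 1, 4, 4), (-2, 2, 4, 5)], [(1, 1, 4, 2)],
      [(1, 3, 4, 2)], [(1, 4, 4, 2)] ]
  | .J35 =>
    [ [(1, 1, 3, 1), (-2, 2, 3, 2), (2, 3, 4, 1), (-2, 3, 4, 3), (-1, 3, 4, 4), (-2, 3, 5, 2),
       (-12, 4, 4, 4), (6, 4, 5, 5)],
      [(1, 1, 3, 3), (2, 3, 3, 1), (-2, 3, 3, 4), (-3, 3, 4, 4), (2, 3, 5, 5)],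
      [(1, 1, 5, 2), (-2, 2, 4, 2), (-1, 3, 3, 1), (-1, 3, 4, 1), (1, 3, 4, 3), (2, 4, 4, 4),
       (-1, 4, 5, 5)],
      [(1, 3, 3, 3), (-1, 3, 4, 1), (1, 3, 4, 3), (1, 3, 4, 4), (1, 3, 5, 2), (-1, 3, 5, 5),
       (6, 4, 4, 4), (-3, 4, 5, 5)], [(1, 1, 3, 4), (-2, 2, 3, 5), (-2, 3, 3, 4)],
      [(1, 1, 5, 5), (-2, 2, 4, 5), (-1, 3, 3, 4), (-2, 3, 4, 4), (1, 3, 5, 5)],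
      [(1, 4, 4, 2)], [(1, 4, 4, 5)] ]
  | .J45 =>
    [ [(1, 1, 3, 1), (-2, 2, 3, 2), (1, 3, 5, 5), (-2, 5, 5, 3)],
      [(1, 1, 3, 3), (-2, 1, 4, 4), (1, 1, 5, 5), (2, 5, 5, 1)],
      [(1, 1, 3, 5), (-1, 1, 5, 3), (1, 3, 5, 1)],
      [(1, 1, 5, 1), (-2, 2, 5, 2), (1, 3, 5, 3), (-2, 4, 5, 4), (2, 5, 5, 5)] ]
  | .J55 =>
    [ [(1, 1, 3, 1), (-2, 2, 3, 2), (-2, 3, 5, 3), (-4, 4, 5, 2), (4, 4, 5, 4), (-4, 5, 5, 5)],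
      [(1, 1, 5, 1), (-2, 2, 5, 2), (1, 3, 5, 3), (-2, 4, 5, 4), (2, 5, 5, 5)],
      [(1, 1, 3, 3), (-2, 1, 4, 4), (1, 1, 5, 5), (2, 3, 5, 1)],
      [(1, 1, 3, 5), (2, 1, 4, 2), (-2, 1, 4, 4), (2, 1, 5, 5)],
      [(1, 3, 5, 5), (2, 4, 5, 2), (-2, 4, 5, 4), (4, 5, 5, 5)], [(1, 5, 5, 2)] ]
  | .J65 =>
    [ [(1, 1, 4, 1), (-2, 2, 4, 2), (2, 4, 4, 4), (-1, 4, 5, 5)],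
      [(1, 1, 4, 3), (-2, 2, 4, 5), (4, 4, 4, 3)], [(1, 1, 4, 4), (-2, 2, 4, 2), (4, 4, 4, 4)],
      [(1, 1, 5, 2), (-2, 2, 3, 2), (2, 4, 5, 2)], [(1, 1, 5, 5), (-2, 2, 3, 5), (2, 4, 5, 5)],
      [(1, 3, 5, 5), (-2, 3, 3, 3)], [(1, 3, 5, 2), (-2, 3, 3, 4)],
      [(1, 3, 4, 3), (-1, 4, 5, 5)], [(1, 3, 4, 4), (-1, 4, 5, 2)], [(1, 3, 3, 2)],
      [(1, 3, 3, 5)], [(1, 4, 4, 2)], [(1, 4, 4, 5)] ]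
  | .J75 =>
    [ [(1, 1, 3, 1), (-2, 2, 3, 2), (2, 3, 3, 3), (2, 4, 5, 3)],
      [(1, 1, 4, 1), (-2, 2, 4, 2), (1, 3, 4, 3), (2, 4, 5, 5)],
      [(1, 1, 5, 1), (-2, 2, 5, 2), (1, 3, 5, 3), (4, 5, 5, 5)], [(1, 1, 3, 4), (-1, 3, 5, 1)],
      [(1, 1, 3, 5), (-1, 3, 4, 1)], [(1, 1, 4, 3), (-1, 3, 4, 1)],
      [(1, 1, 4, 4), (-1, 4, 5, 1)], [(1, 1, 5, 3), (-1, 3, 5, 1)],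
      [(1, 1, 5, 5), (-1, 4, 5, 1)], [(1, 3, 4, 4), (-1, 4, 5, 3)],
      [(1, 3, 5, 5), (-1, 4, 5, 3)], [(1, 1, 3, 3), (-2, 3, 3, 1)],
      [(1, 1, 4, 5), (-2, 4, 4, 1)], [(1, 1, 5, 4), (-2, 5, 5, 1)],
      [(1, 3, 5, 3), (-2, 3, 3, 4)], [(1, 3, 4, 3), (-2, 3, 3, 5)],
      [(1, 3, 4, 5), (-2, 4, 4, 3)], [(1, 3, 5, 4), (-2, 5, 5, 3)],
      [(1, 4, 5, 5), (-2, 4, 4, 4)], [(1, 4, 5, 4), (-2, 5, 5, 5)] ]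
  | .J85 =>
    [ [(1, 3, 4, 3), (-2, 4, 4, 4), (1, 4, 5, 5), (2, 5, 5, 3)] ]

/-- Those of the representative cocycles that define extendible infinitesimal deformations. -/
def extendible : JJName → List Combination
  | .J12_F =>
    [ [(1, 3, 3, 2)] ]
  | .J12_F2 =>
    [ [(1, 1, 3, 4)], [(1, 1, 4, 3)], [(1, 3, 3, 2)], [(1, 3, 3, 4)], [(1, 3, 4, 2)],
      [(1, 4, 4, 2)], [(1, 4, 4, 3)] ]
  | .J13_F =>
    [ [(1, 1, 1, 4)], [(1, 1, 3, 4)], [(1, 4, 4, 2)] ]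
  | .J14 =>
    [ [(1, 3, 3, 2)] ]
  | .J12_F3 =>
    [ [(1, 1, 3, 4)], [(1, 1, 3, 5)], [(1, 1, 4, 3)], [(1, 1, 4, 5)], [(1, 1, 5, 3)],
      [(1, 1, 5, 4)], [(1, 3, 3, 2)], [(1, 3, 3, 4)], [(1, 3, 3, 5)], [(1, 3, 4, 2)],
      [(1, 3, 4, 5)], [(1, 3, 5, 2)], [(1, 3, 5, 4)], [(1, 4, 4, 2)], [(1, 4, 4, 3)],
      [(1, 4, 4, 5)], [(1, 4, 5, 2)], [(1, 4, 5, 3)], [(1, 5, 5, 2)], [(1, 5, 5, 3)],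
      [(1, 5, 5, 4)] ]
  | .J13_F2 =>
    [ [(1, 1, 1, 4)], [(1, 1, 1, 5)], [(1, 1, 3, 4)], [(1, 1, 3, 5)], [(1, 1, 4, 5)],
      [(1, 1, 5, 4)], [(1, 3, 4, 5)], [(1, 3, 5, 4)], [(1, 4, 4, 2)], [(1, 5, 5, 2)],
      [(1, 4, 4, 5)], [(1, 5, 5, 4)], [(1, 4, 5, 2)] ]
  | .J12_J12_F =>
    [ [(1, 1, 3, 5)], [(1, 1, 5, 4)], [(1, 3, 5, 2)], [(1, 5, 5, 2)], [(1, 5, 5, 4)] ]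
  | .J14_F =>
    [ [(1, 1, 4, 5), (-2, 2, 3, 5)], [(1, 1, 5, 3), (-2, 2, 5, 4)], [(1, 1, 5, 2)],
      [(1, 3, 3, 2)], [(1, 3, 3, 5)], [(1, 3, 5, 2)], [(1, 5, 5, 2)], [(1, 5, 5, 4)] ]
  | .J24_F =>
    [ [(1, 1, 1, 5)], [(1, 1, 3, 5)], [(1, 1, 4, 5)], [(1, 3, 3, 5)], [(1, 4, 4, 5)],
      [(1, 5, 5, 2)] ]
  | .J12_J13 =>
    [ [(1, 3, 3, 2)], [(1, 3, 5, 2)] ]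
  | .J15 =>
    [ [(1, 3, 5, 2), (-2, 1, 4, 2)], [(1, 1, 5, 4), (-2, 2, 3, 4)] ]
  | .J25 =>
    [ [(1, 1, 3, 4), (-2, 2, 3, 5)], [(1, 1, 4, 2)], [(1, 3, 4, 2)], [(1, 4, 4, 2)] ]
  | .J35 =>
    [ [(1, 1, 3, 4), (-2, 2, 3, 5), (-2, 3, 3, 4)], [(1, 4, 4, 2)], [(1, 4, 4, 5)] ]
  | .J55 =>
    [ [(1, 5, 5, 2)] ]
  | .J65 =>
    [ [(1, 1, 4, 3), (-2, 2, 4, 5), (4, 4, 4, 3)], [(1, 3, 5, 2), (-2, 3, 3, 4)],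
      [(1, 3, 3, 2)], [(1, 3, 3, 5)], [(1, 4, 4, 2)], [(1, 4, 4, 5)] ]
  | _ => []

/-- The arrows of the deformation diagrams in dimensions 3, 4 and 5: the names at the heads of the
arrows that start at the given name. -/
def arrows : JJName → List JJName
  | .J12_F => [.J13]
  | .J12_F2 => [.J14, .J13_F]
  | .J14 => [.J12_J12]
  | .J13_F => [.J12_J12, .J24]
  | .J12_F3 => [.J14_F, .J13_F2]
  | .J14_F => [.J12_J12_F, .J65]
  | .J13_F2 => [.J12_J12_F, .J24_F]
  | .J12_J12_F => [.J15, .J25, .J12_J13]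
  | .J24_F => [.J12_J13, .J25, .J35, .J75]
  | .J65 => [.J55, .J35]
  | .J15 => [.J85]
  | .J25 => [.J85, .J55]
  | .J12_J13 => [.J45]
  | .J55 => [.J45]
  | .J35 => [.J45, .J85]
  | _ => []

end JJName

end LowDimension

/-! All tables have integer coefficients, so cohomology and obstructions are governed by integer
linear systems of bounded size. The characteristic enters through divisions: every pivot met in the
eliminations divides a power of 6, hence is invertible in `F`, and one integer computation serves
all admissible fields. The eliminations are evaluated in the kernel; only their soundness has to be
proved, namely that a common zero of the input forms is a common zero of the output.

Cohomology (`Combination.cocycle_basis`). The cocycle equations bound dim Z² from above by their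
number of free variables. In the other direction the map (a, f) ↦ ∑ a_s φ_s + df lands in Z², and
its kernel is bounded by the free variables of a second system. When the two counts add up to at
most the dimension of the source, rank-nullity forces the image to be all of Z². The unknowns a_s
come last in the second system and are all pivots, so back substitution kills them on the kernel:
the φ_s are independent modulo coboundaries.

Extendibility. Each listed extendible cocycle has outputs disjoint from its inputs, so its own
Jacobiator vanishes and μ + tφ is already a deformation. The others are excluded in two ways. In a
Jacobi-Jordan algebra over a domain with 2 and 3 nonzero the cube of each multiplication is zero, so
multiplications have trace zero; over F[[t]] the coefficient of t shows that φ₁ must have trace zero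
as well (`sum_structureConstants_eq_zero`). For cocycles that pass this test, dφ₂ plus the
Jacobiator of φ₁ must vanish (`jacobiator_order_two`), and a linear functional that is zero on all
dφ₂ but not on that Jacobiator gives a contradiction (`Combination.not_isExtendible_of_obstructs`).

Jump deformations. If the basis can be graded so that μ has degree 0 and φ a nonzero degree d, a
d-th root of ±t turns μ + tφ into μ ± φ, and an integral change of basis reaches the target. Five
families are not handled by such a grading. Four of them are pencils of ternary quadratic forms with
three distinct singular members, which `algIso_J45` recognises as J_{4,5}; the fifth is treated by
explicit vectors. The finitely many exceptional values of t are where these constructions break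
down. Source and target are not isomorphic because their H² have different dimensions. Algebraic
closedness is needed only for the roots used in these isomorphisms. -/

/-! ### Integer linear forms and fraction-free elimination -/

/-- An integral linear form in variables indexed by natural numbers: a list of terms
`(variable, coefficient)`. -/
abbrev LinForm : Type := List (ℕ × ℤ)

/-- A nonzero integer whose only prime factors are `2` and `3` (of bounded multiplicity). -/
def IsSmooth (c : ℤ) : Bool := (6 ^ 40) % c.natAbs == 0

/-- A divisor of 6^40 that vanished in `F` would make 6 nilpotent, hence zero. The test also rejects
0, since the remainder modulo 0 is the number itself. -/
theorem IsSmooth.cast_ne_zero {F : Type*} [Field F] (h6 : (6 : F) ≠ 0) {c : ℤ}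
    (h : IsSmooth c = true) : (c : F) ≠ 0 := by
  intro h0
  have h1 : c.natAbs ∣ 6 ^ 40 := Nat.dvd_of_mod_eq_zero (by simpa [IsSmooth] using h)
  have h2 : c ∣ (6 : ℤ) ^ 40 := by
    rw [← Int.natAbs_dvd_natAbs]
    simpa [Int.natAbs_pow] using h1
  obtain ⟨d, hd⟩ := h2
  have h3 : (6 : F) ^ 40 = 0 := by
    have := congrArg (Int.cast : ℤ → F) hd
    rw [Int.cast_mul, h0, zero_mul, Int.cast_pow] at this
    exact_mod_cast this
  exact h6 (pow_eq_zero_iff (by norm_num) |>.mp h3)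

namespace LinForm

/-- The value of a linear form. -/
def eval {R : Type*} [CommRing R] (x : ℕ → R) (r : LinForm) : R :=
  (r.map fun p => (p.2 : R) * x p.1).sum

/-- The Boolean test for zero, in a form that reduces quickly. -/
def isZero : ℤ → Bool
  | .ofNat n => n.beq 0
  | .negSucc _ => false

theorem isZero_iff (a : ℤ) : isZero a = true ↔ a = 0 := by
  cases a with
  | ofNat n => simp [isZero]
  | negSucc n => simp [isZero]

/-- Add the term `(v, a)` to a sorted linear form. -/
def insertTerm (v : ℕ) (a : ℤ) : LinForm → LinForm
  | [] => [(v, a)]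
  | (w, b) :: r =>
    bif v.blt w then (v, a) :: (w, b) :: r
    else bif v.beq w then (bif isZero (a + b) then r else (v, a + b) :: r)
    else (w, b) :: insertTerm v a r

/-- Collect a list of terms into a sorted linear form. -/
def collect (l : List (ℕ × ℤ)) : LinForm :=
  l.foldr (fun p r => bif isZero p.2 then r else insertTerm p.1 p.2 r) []

/-- The combination `a • r + s`. -/
def addMul (a : ℤ) (r s : LinForm) : LinForm :=
  r.foldr (fun p t => insertTerm p.1 (a * p.2) t) s

/-- The coefficient of a variable. -/
def coeffAt (v : ℕ) : LinForm → ℤ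
  | [] => 0
  | (w, b) :: r => bif v.beq w then b else coeffAt v r

/-- Cancel the leading variable of `b` in `r`. -/
def reduceBy (r b : LinForm) : LinForm :=
  match b with
  | [] => r
  | (v, c) :: _ =>
    bif isZero (coeffAt v r) then r
    else bif isZero (c - 1) then addMul (-coeffAt v r) b r
    else addMul (-coeffAt v r) b (addMul c r [])

/-- Insert a form into a list that is sorted by leading variables. -/
def insertForm (r : LinForm) : List LinForm → List LinForm
  | [] => [r]
  | s :: B => bif (r.headD (0, 0)).1.blt (s.headD (0, 0)).1 then r :: s :: B else s :: insertForm r B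

/-- Reduce a form by an echelon list and add the remainder to the list. -/
def addForm (B : List LinForm) (r : LinForm) : List LinForm :=
  match B.foldl reduceBy r with
  | [] => B
  | p :: t => insertForm (p :: t) B

/-- Fraction free Gaussian elimination. -/
def echelon (rows : List LinForm) : List LinForm := rows.foldl addForm []

/-- The leading variable of the form comes before all others and its coefficient is invertible. -/
def isPivotForm : LinForm → Bool
  | [] => false
  | (v, c) :: t => IsSmooth c && t.all fun p => v.blt p.1

/-- The leading variables. -/
def pivots (B : List LinForm) : List ℕ := B.map fun r => (r.headD (0, 0)).1

section eval

variable {R : Type*} [CommRing R] (x : ℕ → R)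

@[simp] theorem eval_nil : eval x [] = 0 := rfl

@[simp] theorem eval_cons (p : ℕ × ℤ) (r : LinForm) :
    eval x (p :: r) = (p.2 : R) * x p.1 + eval x r := by
  simp [eval]

@[simp] theorem eval_append (r s : LinForm) : eval x (r ++ s) = eval x r + eval x s := by
  simp [eval]

theorem eval_flatMap {ι : Type*} (l : List ι) (f : ι → LinForm) :
    eval x (l.flatMap f) = (l.map fun i => eval x (f i)).sum := by
  induction l with
  | nil => rfl
  | cons a l ih => simp [ih]

theorem eval_insertTerm (v : ℕ) (a : ℤ) (r : LinForm) :
    eval x (insertTerm v a r) = (a : R) * x v + eval x r := by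
  induction r with
  | nil => simp [insertTerm]
  | cons p r ih =>
    obtain ⟨w, b⟩ := p
    simp only [insertTerm, Bool.cond_eq_ite, isZero_iff, Nat.blt_eq, Nat.beq_eq]
    split_ifs with h1 h2 h3
    · simp
    · subst h2
      have : (a : R) + b = 0 := by exact_mod_cast congrArg (Int.cast : ℤ → R) h3
      simp only [eval_cons]
      linear_combination (-x v) * this
    · subst h2
      simp only [eval_cons, Int.cast_add]
      ring
    · simp only [eval_cons, ih]
      ring

theorem eval_collect (l : List (ℕ × ℤ)) : eval x (collect l) = eval x l := by
  induction l with
  | nil => rfl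
  | cons p l ih =>
    have : collect (p :: l) = bif isZero p.2 then collect l else insertTerm p.1 p.2 (collect l) := rfl
    simp only [this, Bool.cond_eq_ite, isZero_iff]
    split_ifs with h
    · simp [h, ih]
    · rw [eval_insertTerm, ih, eval_cons]

theorem eval_addMul (a : ℤ) (r s : LinForm) :
    eval x (addMul a r s) = (a : R) * eval x r + eval x s := by
  induction r with
  | nil => simp [addMul]
  | cons p r ih =>
    have : addMul a (p :: r) s = insertTerm p.1 (a * p.2) (addMul a r s) := rfl
    rw [this, eval_insertTerm, ih, eval_cons]
    push_cast
    ring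

/-- The result is an integer combination of `r` and `b`. That the leading variable really cancels is
irrelevant here: the echelon shape is tested afterwards on the output. -/
theorem eval_reduceBy {r b : LinForm} (hr : eval x r = 0) (hb : eval x b = 0) :
    eval x (reduceBy r b) = 0 := by
  unfold reduceBy
  split
  · exact hr
  · simp only [Bool.cond_eq_ite]
    split_ifs
    · exact hr
    · simp [eval_addMul, hr, hb]
    · simp [eval_addMul, hr, hb]

theorem mem_insertForm {r s : LinForm} {B : List LinForm} (h : s ∈ insertForm r B) :
    s = r ∨ s ∈ B := by
  induction B with
  | nil => simpa [insertForm] using h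
  | cons t B ih =>
    simp only [insertForm, Bool.cond_eq_ite] at h
    split_ifs at h
    · simpa using h
    · rcases List.mem_cons.1 h with h | h
      · simp [h]
      · rcases ih h with h | h <;> simp [h]

theorem eval_foldl_reduceBy {B : List LinForm} (hB : ∀ b ∈ B, eval x b = 0) {r : LinForm}
    (hr : eval x r = 0) : eval x (B.foldl reduceBy r) = 0 := by
  induction B generalizing r with
  | nil => exact hr
  | cons b B ih =>
    exact ih (fun c hc => hB c (List.mem_cons_of_mem _ hc))
      (eval_reduceBy x hr (hB b List.mem_cons_self))

theorem eval_addForm {B : List LinForm} (hB : ∀ b ∈ B, eval x b = 0) {r : LinForm}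
    (hr : eval x r = 0) : ∀ b ∈ addForm B r, eval x b = 0 := by
  intro b hb
  have h := eval_foldl_reduceBy x hB hr
  unfold addForm at hb
  split at hb
  · exact hB b hb
  · next p t heq =>
    rw [heq] at h
    rcases mem_insertForm hb with rfl | hb
    · exact h
    · exact hB b hb

/-- This is the only property of the elimination that the proof uses. Solutions are never lost; the
converse inclusion is replaced by dimension counts. -/
theorem eval_echelon {rows : List LinForm} (h : ∀ r ∈ rows, eval x r = 0) :
    ∀ b ∈ echelon rows, eval x b = 0 := by
  have key : ∀ (rows B : List LinForm), (∀ r ∈ rows, eval x r = 0) → (∀ b ∈ B, eval x b = 0) →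
      ∀ b ∈ rows.foldl addForm B, eval x b = 0 := by
    intro rows
    induction rows with
    | nil => intro B _ hB; exact hB
    | cons r rows ih =>
      intro B hr hB
      exact ih _ (fun s hs => hr s (List.mem_cons_of_mem _ hs))
        (eval_addForm x hB (hr r List.mem_cons_self))
  exact key rows [] h (by simp)

theorem eval_eq_zero_of_forall {r : LinForm} (h : ∀ p ∈ r, x p.1 = 0) : eval x r = 0 := by
  induction r with
  | nil => rfl
  | cons p r ih =>
    rw [eval_cons, h p List.mem_cons_self, ih fun q hq => h q (List.mem_cons_of_mem _ hq)]
    simp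

/-- Carries values computed in the integers over to the field. -/
theorem eval_map {S : Type*} [CommRing S] (f : R →+* S) (r : LinForm) :
    eval (fun v => f (x v)) r = f (eval x r) := by
  induction r with
  | nil => simp
  | cons p r ih => simp [ih]

end eval

section Field

variable {F : Type*} [Field F]

/-- Back substitution: a common zero of an echelon list of forms that vanishes at all non-pivot
variables from `v₀` on vanishes at all variables from `v₀` on. -/
theorem eq_zero_of_echelon (h6 : (6 : F) ≠ 0) {B : List LinForm} (hB : B.all isPivotForm = true)
    (x : ℕ → F) (hx : ∀ b ∈ B, eval x b = 0) {N v₀ : ℕ} (hN : ∀ v, N ≤ v → x v = 0)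
    (h0 : ∀ v, v₀ ≤ v → v ∉ pivots B → x v = 0) : ∀ v, v₀ ≤ v → x v = 0 := by
  -- Descending induction on `v`: the tail of a pivot form contains only later variables, which
  -- already vanish.
  have key : ∀ k v, N - v ≤ k → v₀ ≤ v → x v = 0 := by
    intro k
    induction k with
    | zero => intro v hv _; exact hN v (by omega)
    | succ k ih =>
      intro v hv hv0
      by_cases hNv : N ≤ v
      · exact hN v hNv
      by_cases hp : v ∈ pivots B
      · obtain ⟨b, hb, rfl⟩ := List.mem_map.1 hp
        have h1 := List.all_eq_true.1 hB b hb
        have h2 := hx b hb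
        match b, h1, h2 with
        | (w, c) :: t, h1, h2 =>
          simp only [isPivotForm, Bool.and_eq_true, List.all_eq_true, Nat.blt_eq] at h1
          simp only [List.headD_cons] at hv hv0 hNv ⊢
          have h3 : eval x t = 0 := eval_eq_zero_of_forall x fun p hp => by
            have := h1.2 p hp
            exact ih p.1 (by omega) (by omega)
          rw [eval_cons, h3, add_zero] at h2
          exact (mul_eq_zero.1 h2).resolve_left (IsSmooth.cast_ne_zero h6 h1.1)
      · exact h0 v hv0 hp
  exact fun v hv => key _ v le_rfl hv

/-- The dimension of a space of common zeros of an echelon list of forms is at most the number of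
non-pivot variables. -/
theorem finrank_le_of_echelon (h6 : (6 : F) ≠ 0) {M : Type*} [AddCommGroup M] [Module F M]
    (x : M →ₗ[F] ℕ → F) (hinj : Function.Injective x) {B : List LinForm}
    (hB : B.all isPivotForm = true) (hx : ∀ m, ∀ b ∈ B, eval (x m) b = 0) {N : ℕ}
    (hN : ∀ m v, N ≤ v → x m v = 0) (L : List ℕ)
    (hL : ∀ m v, v ∉ pivots B → v ∉ L → x m v = 0) : Module.finrank F M ≤ L.length := by
  -- Restriction to the free coordinates; it is injective because these determine the pivot
  -- variables by back substitution.
  let y : M →ₗ[F] Fin L.length → F := LinearMap.pi fun i => LinearMap.proj (L.get i) ∘ₗ x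
  have hy : Function.Injective y := by
    rw [injective_iff_map_eq_zero]
    intro m hm
    apply hinj
    rw [map_zero]
    funext v
    refine eq_zero_of_echelon h6 hB (x m) (hx m) (v₀ := 0) (hN m) ?_ v (Nat.zero_le v)
    intro w _ hw
    by_cases hwL : w ∈ L
    · obtain ⟨i, rfl⟩ := List.mem_iff_get.1 hwL
      exact congrFun hm i
    · exact hL m w hw hwL
  simpa using LinearMap.finrank_le_finrank_of_injective hy

end Field

end LinForm

/-! ### Structure constants and the Jacobiator tensor -/

section Tensor

variable {R : Type*} [CommRing R] {n : ℕ}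

/-- The bilinear operation on `R^n` with the given structure constants. -/
def tensorMul (S : Fin n → Fin n → Fin n → R) (x y : Fin n → R) : Fin n → R := fun k =>
  ∑ i, ∑ j, S i j k * (x i * y j)

/-- The coefficients of the trilinear map `x (y z) + y (z x) + z (x y)`, where the outer products
are taken with structure constants `S` and the inner ones with `T`. -/
def jacobiator (S T : Fin n → Fin n → Fin n → R) (i j k m : Fin n) : R :=
  ∑ l, (S i l m * T j k l + S j l m * T k i l + S k l m * T i j l)

theorem tensorMul_tensorMul (S T : Fin n → Fin n → Fin n → R) (x y z : Fin n → R) (m : Fin n) :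
    tensorMul S x (tensorMul T y z) m =
      ∑ i, ∑ j, ∑ k, (∑ l, S i l m * T j k l) * (x i * y j * z k) := by
  unfold tensorMul
  refine Finset.sum_congr rfl fun i _ => ?_
  simp only [Finset.mul_sum, Finset.sum_mul]
  rw [Finset.sum_comm]
  refine Finset.sum_congr rfl fun j _ => ?_
  rw [Finset.sum_comm]
  refine Finset.sum_congr rfl fun k _ => Finset.sum_congr rfl fun l _ => ?_
  ring

/-- The three summands become sums over the same monomials after a cyclic renaming of the summation
indices. Taking `S` and `T` separate lets one formula cover the Jacobi identity and both halves of
the differential. -/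
theorem tensorMul_cyclic_sum (S T : Fin n → Fin n → Fin n → R) (x y z : Fin n → R) (m : Fin n) :
    tensorMul S x (tensorMul T y z) m + tensorMul S y (tensorMul T z x) m +
        tensorMul S z (tensorMul T x y) m =
      ∑ i, ∑ j, ∑ k, jacobiator S T i j k m * (x i * y j * z k) := by
  rw [tensorMul_tensorMul, tensorMul_tensorMul, tensorMul_tensorMul]
  have h1 : ∑ i, ∑ j, ∑ k, (∑ l, S i l m * T j k l) * (y i * z j * x k) =
      ∑ i, ∑ j, ∑ k, (∑ l, S j l m * T k i l) * (x i * y j * z k) := by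
    rw [Finset.sum_congr rfl fun i _ => Finset.sum_comm, Finset.sum_comm]
    refine Finset.sum_congr rfl fun i _ => Finset.sum_congr rfl fun j _ =>
      Finset.sum_congr rfl fun k _ => ?_
    ring
  have h2 : ∑ i, ∑ j, ∑ k, (∑ l, S i l m * T j k l) * (z i * x j * y k) =
      ∑ i, ∑ j, ∑ k, (∑ l, S k l m * T i j l) * (x i * y j * z k) := by
    rw [Finset.sum_comm, Finset.sum_congr rfl fun i _ => Finset.sum_comm]
    refine Finset.sum_congr rfl fun i _ => Finset.sum_congr rfl fun j _ =>
      Finset.sum_congr rfl fun k _ => ?_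
    ring
  rw [h1, h2]
  simp only [← Finset.sum_add_distrib]
  refine Finset.sum_congr rfl fun i _ => Finset.sum_congr rfl fun j _ =>
    Finset.sum_congr rfl fun k _ => ?_
  rw [jacobiator, Finset.sum_add_distrib, Finset.sum_add_distrib]
  ring

theorem jacobiator_rotate (S T : Fin n → Fin n → Fin n → R) (i j k m : Fin n) :
    jacobiator S T j k i m = jacobiator S T i j k m :=
  Finset.sum_congr rfl fun l _ => by ring

/-- Together with `jacobiator_rotate` this makes the Jacobiator symmetric in its three arguments, so
that sorted triples suffice. Only the inner tensor has to be symmetric. -/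
theorem jacobiator_swap {S T : Fin n → Fin n → Fin n → R} (hT : ∀ i j k, T i j k = T j i k)
    (i j k m : Fin n) : jacobiator S T j i k m = jacobiator S T i j k m :=
  Finset.sum_congr rfl fun l _ => by rw [hT i k, hT k j, hT j i]; ring

/-- A symmetric function of three indices vanishes if it does so at sorted triples. -/
theorem eq_zero_of_sorted {G : Fin n → Fin n → Fin n → R} (hr : ∀ i j k, G j k i = G i j k)
    (hs : ∀ i j k, G j i k = G i j k) (h : ∀ i j k, i ≤ j → j ≤ k → G i j k = 0)
    (i j k : Fin n) : G i j k = 0 := by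
  rcases le_total i j with h1 | h1 <;> rcases le_total j k with h2 | h2 <;>
    rcases le_total i k with h3 | h3
  · exact h _ _ _ h1 h2
  · exact h _ _ _ h1 h2
  · rw [hr k i j, ← hs k i j]; exact h _ _ _ h3 h2
  · rw [hr k i j]; exact h _ _ _ h3 h1
  · rw [← hs i j k]; exact h _ _ _ h1 h3
  · rw [← hr i j k]; exact h _ _ _ h2 h3
  · rw [← hr i j k, ← hs j k i]; exact h _ _ _ h2 h1
  · rw [← hr i j k, ← hs j k i]; exact h _ _ _ h2 h1

theorem jacobiator_map {S' : Type*} [CommRing S'] (f : R →+* S')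
    (S T : Fin n → Fin n → Fin n → R) (i j k m : Fin n) :
    jacobiator (fun i j k => f (S i j k)) (fun i j k => f (T i j k)) i j k m =
      f (jacobiator S T i j k m) := by
  simp [jacobiator]

end Tensor

/-! ### Bilinear maps on F^n in terms of structure constants -/

section Bilinear

variable {F : Type*} [Field F] {n : ℕ}

/-- The structure constants of a bilinear map. -/
def structureConstants (φ : BilinMap F (Fin n → F)) (i j k : Fin n) : F :=
  φ (Pi.single i 1) (Pi.single j 1) k

theorem linearMap_apply_eq_sum {W : Type*} [AddCommGroup W] [Module F W]
    (f : (Fin n → F) →ₗ[F] W) (x : Fin n → F) : f x = ∑ i, x i • f (Pi.single i 1) := by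
  conv_lhs => rw [← Finset.univ_sum_single x]
  rw [map_sum]
  refine Finset.sum_congr rfl fun i _ => ?_
  rw [← map_smul, ← Pi.single_smul, smul_eq_mul, mul_one]

theorem apply_eq_tensorMul (φ : BilinMap F (Fin n → F)) (x y : Fin n → F) :
    φ x y = tensorMul (structureConstants φ) x y := by
  funext k
  rw [linearMap_apply_eq_sum φ x, LinearMap.sum_apply, Finset.sum_apply]
  refine Finset.sum_congr rfl fun i _ => ?_
  rw [LinearMap.smul_apply, linearMap_apply_eq_sum (φ (Pi.single i 1)) y, Pi.smul_apply,
    Finset.sum_apply, Finset.smul_sum]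
  refine Finset.sum_congr rfl fun j _ => ?_
  simp only [Pi.smul_apply, smul_eq_mul, structureConstants]
  ring

theorem bilin_ext {φ ψ : BilinMap F (Fin n → F)}
    (h : ∀ i j k, structureConstants φ i j k = structureConstants ψ i j k) : φ = ψ := by
  refine LinearMap.ext fun x => LinearMap.ext fun y => ?_
  rw [apply_eq_tensorMul, apply_eq_tensorMul, show structureConstants φ = structureConstants ψ from
    funext fun i => funext fun j => funext fun k => h i j k]

theorem tensorMul_single (S : Fin n → Fin n → Fin n → F) (i j k : Fin n) :
    tensorMul S (Pi.single i 1) (Pi.single j 1) k = S i j k := by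
  simp [tensorMul, Pi.single_apply]

theorem d2_eq_sum (μ φ : BilinMap F (Fin n → F)) (x y z : Fin n → F) (m : Fin n) :
    d2 μ φ x y z m = ∑ i, ∑ j, ∑ k,
      (jacobiator (structureConstants φ) (structureConstants μ) i j k m +
        jacobiator (structureConstants μ) (structureConstants φ) i j k m) *
          (x i * y j * z k) := by
  have h1 := tensorMul_cyclic_sum (structureConstants φ) (structureConstants μ) x y z m
  have h2 := tensorMul_cyclic_sum (structureConstants μ) (structureConstants φ) x y z m
  simp only [← apply_eq_tensorMul] at h1 h2
  simp only [add_mul, Finset.sum_add_distrib]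
  rw [← h1, ← h2]
  simp only [d2, Pi.add_apply]
  ring

theorem sum_single_mul {R : Type*} [CommRing R] (G : Fin n → Fin n → Fin n → R) (i j k : Fin n) :
    ∑ a, ∑ b, ∑ c, G a b c * ((Pi.single i 1 : Fin n → R) a * (Pi.single j 1 : Fin n → R) b *
      (Pi.single k 1 : Fin n → R) c) = G i j k := by
  simp [Pi.single_apply]

theorem d2_single (μ φ : BilinMap F (Fin n → F)) (i j k m : Fin n) :
    d2 μ φ (Pi.single i 1) (Pi.single j 1) (Pi.single k 1) m =
      jacobiator (structureConstants φ) (structureConstants μ) i j k m +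
        jacobiator (structureConstants μ) (structureConstants φ) i j k m := by
  rw [d2_eq_sum, sum_single_mul]

theorem mem_symBilin_iff (φ : BilinMap F (Fin n → F)) :
    φ ∈ symBilin F (Fin n → F) ↔
      ∀ i j k, structureConstants φ i j k = structureConstants φ j i k := by
  refine ⟨fun h i j k => congrFun (h _ _) k, fun h x y => ?_⟩
  rw [apply_eq_tensorMul, apply_eq_tensorMul]
  funext k
  unfold tensorMul
  rw [Finset.sum_comm]
  refine Finset.sum_congr rfl fun i _ => Finset.sum_congr rfl fun j _ => ?_
  rw [h j i]
  ring

/-- By trilinearity it is enough to test the differential at basis vectors, where it splits into the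
two mixed Jacobiators. -/
theorem mem_Z2_iff (μ φ : BilinMap F (Fin n → F)) :
    φ ∈ Z2 μ ↔ φ ∈ symBilin F (Fin n → F) ∧ ∀ i j k m,
      jacobiator (structureConstants φ) (structureConstants μ) i j k m +
        jacobiator (structureConstants μ) (structureConstants φ) i j k m = 0 := by
  refine and_congr_right fun _ => ⟨fun h i j k m => ?_, fun h x y z => ?_⟩
  · rw [← d2_single, h]
    rfl
  · funext m
    rw [d2_eq_sum]
    simp [h]

theorem isJJAlgebra_iff (μ : BilinMap F (Fin n → F)) :
    IsJJAlgebra μ ↔ μ ∈ symBilin F (Fin n → F) ∧ ∀ i j k m,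
      jacobiator (structureConstants μ) (structureConstants μ) i j k m = 0 := by
  have key (x y z : Fin n → F) (m : Fin n) : (μ x (μ y z) + μ y (μ z x) + μ z (μ x y)) m =
      ∑ i, ∑ j, ∑ k, jacobiator (structureConstants μ) (structureConstants μ) i j k m *
        (x i * y j * z k) := by
    rw [← tensorMul_cyclic_sum]
    simp only [← apply_eq_tensorMul, Pi.add_apply]
  refine and_congr_right fun _ => ⟨fun h i j k m => ?_, fun h x y z => ?_⟩
  · rw [← sum_single_mul (fun i j k => jacobiator (structureConstants μ) (structureConstants μ)
      i j k m) i j k, ← key]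
    exact congrFun (h _ _ _) m
  · funext m
    rw [key]
    simp [h]

end Bilinear

/-! ### Integral tables and the linear systems for cocycles and coboundaries -/

namespace Combination

/-- The structure constants of a combination, with indices that start at `0`. -/
def entry (c : Combination) (i j k : ℕ) : ℤ :=
  c.foldr (fun s r => bif s.2.2.2.beq (k + 1) && (s.2.1.beq (i + 1) && s.2.2.1.beq (j + 1) ||
    s.2.1.beq (j + 1) && s.2.2.1.beq (i + 1)) then s.1 + r else r) 0

/-- `entry` is written with Boolean tests for fast evaluation and counts indices from 0, while the
tables count from 1. -/
theorem entry_eq_coeff (c : Combination) (i j k : ℕ) :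
    c.entry i j k = c.coeff (i + 1) (j + 1) (k + 1) := by
  induction c with
  | nil => rfl
  | cons s c ih =>
    have h1 : coeff (s :: c) (i + 1) (j + 1) (k + 1) =
        (if (s.2.1 = i + 1 ∧ s.2.2.1 = j + 1 ∨ s.2.1 = j + 1 ∧ s.2.2.1 = i + 1) ∧
          s.2.2.2 = k + 1 then s.1 else 0) + coeff c (i + 1) (j + 1) (k + 1) := rfl
    have h2 : entry (s :: c) i j k = bif s.2.2.2.beq (k + 1) && (s.2.1.beq (i + 1) &&
        s.2.2.1.beq (j + 1) || s.2.1.beq (j + 1) && s.2.2.1.beq (i + 1)) then s.1 + entry c i j k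
          else entry c i j k := rfl
    rw [h1, h2, ih]
    simp only [Bool.cond_eq_ite, Bool.and_eq_true, Bool.or_eq_true, Nat.beq_eq,
      and_comm (b := s.2.2.2 = k + 1)]
    split_ifs <;> simp

theorem coeff_comm (c : Combination) (i j k : ℕ) : c.coeff i j k = c.coeff j i k := by
  unfold coeff
  refine congrArg List.sum (List.map_congr_left fun s _ => ?_)
  simp only [or_comm]

theorem entry_comm (c : Combination) (i j k : ℕ) : c.entry i j k = c.entry j i k := by
  rw [entry_eq_coeff, entry_eq_coeff, coeff_comm]

variable {F : Type*} [Field F] {n : ℕ}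

theorem structureConstants_toBilin (c : Combination) (i j k : Fin n) :
    structureConstants (c.toBilin F n) i j k = (c.entry i j k : F) := by
  rw [entry_eq_coeff]
  exact tensorMul_single (fun i j k : Fin n => (c.coeff (i + 1) (j + 1) (k + 1) : F)) i j k

theorem toBilin_mem_symBilin (c : Combination) : c.toBilin F n ∈ symBilin F (Fin n → F) :=
  (mem_symBilin_iff _).2 fun i j k => by simp only [structureConstants_toBilin, c.entry_comm i j]

end Combination

/-- The variable for the entry `(i, j, k)` of the structure constants of a symmetric bilinear map
on `F^n`. -/
def triVar (n i j k : ℕ) : ℕ := (max i j * n + min i j) * n + k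

/-- The variable is one of those for a symmetric bilinear map. -/
def isTriVar (n v : ℕ) : Bool := v.blt (n ^ 3) && (v / n % n).ble (v / n / n)

/-- The variables below `N` that are selected by `p` and are not pivots. -/
def freeVars (N : ℕ) (p : ℕ → Bool) (P : List ℕ) : List ℕ :=
  (List.range N).filter fun v => p v && !P.contains v

namespace Combination

/-- The terms of `d φ (e_i, e_j, e_k)_m` in the entries of `φ`. -/
def d2Terms (n : ℕ) (c : Combination) (i j k m : ℕ) : List (ℕ × ℤ) :=
  (List.range n).flatMap fun l =>
    [(triVar n i l m, c.entry j k l), (triVar n j l m, c.entry k i l),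
     (triVar n k l m, c.entry i j l), (triVar n j k l, c.entry i l m),
     (triVar n k i l, c.entry j l m), (triVar n i j l, c.entry k l m)]

/-- The equations `d φ (e_i, e_j, e_k)_m = 0` for `i ≤ j ≤ k`. -/
def d2Forms (n : ℕ) (c : Combination) : List LinForm :=
  (List.range n).flatMap fun k => (List.range (k + 1)).flatMap fun j =>
    (List.range (j + 1)).flatMap fun i => (List.range n).map fun m =>
      LinForm.collect (d2Terms n c i j k m)

/-- The terms of `(∑ s, a_s φ_s + d f) (e_i, e_j)_k` in the entries of `f` and the `a_s`, where
`φ_s` runs through `reps`. -/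
def d1Terms (n : ℕ) (c : Combination) (reps : List Combination) (i j k : ℕ) : List (ℕ × ℤ) :=
  ((List.range n).flatMap fun l =>
    [(l * n + k, c.entry i j l), (j * n + l, -c.entry i l k), (i * n + l, -c.entry j l k)]) ++
  (List.range reps.length).map fun s => (n * n + s, (reps.getD s []).entry i j k)

/-- The equations `(∑ s, a_s φ_s + d f) (e_i, e_j)_k = 0` for `i ≤ j`. -/
def d1Forms (n : ℕ) (c : Combination) (reps : List Combination) : List LinForm :=
  (List.range n).flatMap fun j => (List.range (j + 1)).flatMap fun i =>
    (List.range n).map fun k => LinForm.collect (d1Terms n c reps i j k)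

/-- The combination `b` satisfies the equations of a cocycle for the algebra `c`. -/
def isCocycle (n : ℕ) (c b : Combination) : Bool :=
  (d2Forms n c).all fun r =>
    LinForm.isZero (LinForm.eval (fun v => b.entry (v / n / n) (v / n % n) (v % n)) r)

/-- The elimination certificate for a basis of the second cohomology of the algebra `c`. -/
def isBasisH2 (n : ℕ) (c : Combination) (reps : List Combination) : Bool :=
  let B₂ := LinForm.echelon (d2Forms n c)
  let B₁ := LinForm.echelon (d1Forms n c reps)
  B₂.all LinForm.isPivotForm && (B₁.all LinForm.isPivotForm &&
    ((List.range reps.length).all (fun s => (LinForm.pivots B₁).contains (n * n + s)) &&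
      ((freeVars (n * n) (fun _ => true) (LinForm.pivots B₁)).length +
        (freeVars (n ^ 3) (isTriVar n) (LinForm.pivots B₂)).length).ble (reps.length + n * n)))

section

variable {R : Type*} [CommRing R] {n : ℕ}

theorem sum_map_range (f : ℕ → R) : ((List.range n).map f).sum = ∑ l : Fin n, f l := by
  rw [← List.sum_toFinset f (List.nodup_range), List.toFinset_range, Finset.sum_range]

/-- The link between the symbolic equations and the differential. The unknowns occur through
`triVar`, which is symmetric in its first two indices, so symmetry of the cochain is built into the
system. -/
theorem eval_d2Terms (x : ℕ → R) (c : Combination) (i j k m : Fin n) :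
    LinForm.eval x (d2Terms n c i j k m) =
      jacobiator (fun i j k : Fin n => x (triVar n i j k)) (fun i j k => (c.entry i j k : R)) i j k m
      + jacobiator (fun i j k => (c.entry i j k : R)) (fun i j k : Fin n => x (triVar n i j k))
        i j k m := by
  rw [d2Terms, LinForm.eval_flatMap, sum_map_range, jacobiator, jacobiator,
    ← Finset.sum_add_distrib]
  refine Finset.sum_congr rfl fun l _ => ?_
  simp only [LinForm.eval_cons, LinForm.eval_nil]
  ring

theorem triVar_lt (i j k : Fin n) : triVar n i j k < n ^ 3 := by
  have h1 : max (i : ℕ) j < n := max_lt i.2 j.2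
  have h2 : min (i : ℕ) j < n := (min_le_left _ _).trans_lt i.2
  have h3 : max (i : ℕ) j * n + min (i : ℕ) j < n * n := by nlinarith
  have := k.2
  unfold triVar
  nlinarith

theorem triVar_div_div (i j k : Fin n) : triVar n i j k / n / n = max (i : ℕ) j := by
  have hn : 0 < n := i.pos
  rw [triVar, Nat.add_div_of_dvd_right (Dvd.intro_left _ rfl), Nat.mul_div_cancel _ hn,
    Nat.div_eq_of_lt k.2, add_zero, Nat.add_div_of_dvd_right (Dvd.intro_left _ rfl),
    Nat.mul_div_cancel _ hn, Nat.div_eq_of_lt ((min_le_left _ _).trans_lt i.2), add_zero]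

theorem triVar_div_mod (i j k : Fin n) : triVar n i j k / n % n = min (i : ℕ) j := by
  have hn : 0 < n := i.pos
  rw [triVar, Nat.add_div_of_dvd_right (Dvd.intro_left _ rfl), Nat.mul_div_cancel _ hn,
    Nat.div_eq_of_lt k.2, add_zero, Nat.mul_add_mod', Nat.mod_eq_of_lt ((min_le_left _ _).trans_lt i.2)]

theorem triVar_mod (i j k : Fin n) : triVar n i j k % n = k := by
  rw [triVar, Nat.mul_add_mod', Nat.mod_eq_of_lt k.2]

theorem mem_d2Forms (c : Combination) {i j k m : ℕ} (h1 : i ≤ j) (h2 : j ≤ k) (h3 : k < n)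
    (h4 : m < n) : LinForm.collect (d2Terms n c i j k m) ∈ d2Forms n c := by
  simp only [d2Forms, List.mem_flatMap, List.mem_map, List.mem_range]
  exact ⟨k, h3, j, by omega, i, by omega, m, h4, rfl⟩

/-- The structure constants of a combination that passes the test satisfy the cocycle
condition. -/
theorem jacobiator_eq_zero_of_isCocycle {c b : Combination} (h : isCocycle n c b = true)
    (i j k m : Fin n) :
    jacobiator (fun i j k => (b.entry i j k : R)) (fun i j k => (c.entry i j k : R)) i j k m +
      jacobiator (fun i j k => (c.entry i j k : R)) (fun i j k => (b.entry i j k : R)) i j k m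
        = 0 := by
  -- The test inspects only triples with i ≤ j ≤ k; symmetry supplies the others.
  refine eq_zero_of_sorted (G := fun i j k => jacobiator (fun i j k => (b.entry i j k : R))
    (fun i j k => (c.entry i j k : R)) i j k m + jacobiator (fun i j k => (c.entry i j k : R))
      (fun i j k => (b.entry i j k : R)) i j k m) ?_ ?_ ?_ i j k
  · intro i j k
    simp only [jacobiator_rotate]
  · intro i j k
    exact congrArg₂ (· + ·) (jacobiator_swap (fun i j k => by rw [c.entry_comm]) i j k m)
      (jacobiator_swap (fun i j k => by rw [b.entry_comm]) i j k m)
  · intro i j k h1 h2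
    have h3 := (LinForm.isZero_iff _).1
      (List.all_eq_true.1 h _ (mem_d2Forms c (Fin.le_def.1 h1) (Fin.le_def.1 h2) k.2 m.2))
    rw [LinForm.eval_collect, eval_d2Terms] at h3
    have h4 : ∀ i j k : Fin n, b.entry (triVar n i j k / n / n) (triVar n i j k / n % n)
        (triVar n i j k % n) = b.entry i j k := by
      intro i j k
      rw [triVar_div_div, triVar_div_mod, triVar_mod]
      rcases le_total (i : ℕ) j with hij | hij
      · rw [max_eq_right hij, min_eq_left hij, b.entry_comm]
      · rw [max_eq_left hij, min_eq_right hij]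
    -- Up to here the identity is one between integers; the canonical ring homomorphism transports
    -- it to `R`.
    simp only [h4] at h3
    have h5 := congrArg (Int.castRingHom R) h3
    rw [map_add, ← jacobiator_map, ← jacobiator_map] at h5
    simpa using h5

end

section

variable {F : Type*} [Field F] {n : ℕ}

theorem toBilin_mem_Z2 {c b : Combination} (h : isCocycle n c b = true) :
    b.toBilin F n ∈ Z2 (c.toBilin F n) := by
  refine (mem_Z2_iff _ _).2 ⟨toBilin_mem_symBilin b, fun i j k m => ?_⟩
  have h1 : ∀ c : Combination, structureConstants (c.toBilin F n) =
      fun i j k : Fin n => (c.entry i j k : F) := fun c => funext fun i => funext fun j =>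
    funext fun k => structureConstants_toBilin c i j k
  rw [h1, h1]
  exact jacobiator_eq_zero_of_isCocycle h i j k m

/-- The differential of μ, taken with respect to μ itself, is twice its Jacobiator. Hence the
cocycle test also checks the Jacobi identity once 2 is invertible. -/
theorem isJJAlgebra_toBilin (h2 : (2 : F) ≠ 0) {c : Combination}
    (h : isCocycle n c c = true) : IsJJAlgebra (c.toBilin F n) := by
  refine (isJJAlgebra_iff _).2 ⟨toBilin_mem_symBilin c, fun i j k m => ?_⟩
  have h1 := ((mem_Z2_iff _ _).1 (toBilin_mem_Z2 (F := F) h)).2 i j k m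
  rw [← two_mul] at h1
  exact (mul_eq_zero.1 h1).resolve_left h2

/-- The entries of a symmetric bilinear map as a function of the variables. -/
def bilinCoords (F : Type*) [Field F] (n : ℕ) : BilinMap F (Fin n → F) →ₗ[F] ℕ → F where
  toFun φ v := if h : isTriVar n v = true ∧ 0 < n then
    φ (Pi.single ⟨v / n % n, Nat.mod_lt _ h.2⟩ 1) (Pi.single ⟨v / n / n % n, Nat.mod_lt _ h.2⟩ 1)
      ⟨v % n, Nat.mod_lt _ h.2⟩ else 0
  map_add' φ ψ := by
    funext v
    by_cases h : isTriVar n v = true ∧ 0 < n <;> simp [h]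
  map_smul' a φ := by
    funext v
    by_cases h : isTriVar n v = true ∧ 0 < n <;> simp [h]

theorem isTriVar_triVar (i j k : Fin n) : isTriVar n (triVar n i j k) = true := by
  rw [isTriVar, triVar_div_div, triVar_div_mod, Bool.and_eq_true, Nat.blt_eq, Nat.ble_eq]
  exact ⟨triVar_lt i j k, min_le_max⟩

/-- The reductions modulo `n` in `bilinCoords` only provide the bounds for `Fin n` and change
nothing at these variables. Symmetry of φ is used when the larger index comes first. -/
theorem bilinCoords_triVar {φ : BilinMap F (Fin n → F)} (hφ : φ ∈ symBilin F (Fin n → F))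
    (i j k : Fin n) : bilinCoords F n φ (triVar n i j k) = structureConstants φ i j k := by
  have hn : 0 < n := i.pos
  have h : isTriVar n (triVar n i j k) = true ∧ 0 < n := ⟨isTriVar_triVar i j k, hn⟩
  simp only [bilinCoords, LinearMap.coe_mk, AddHom.coe_mk, h, and_self, dite_true, triVar_div_div,
    triVar_div_mod, triVar_mod, Fin.eta]
  have hm : max (i : ℕ) j % n = max (i : ℕ) j := Nat.mod_eq_of_lt (max_lt i.2 j.2)
  simp only [hm]
  rcases le_total (i : ℕ) j with hij | hij
  · simp only [max_eq_right hij, min_eq_left hij, Fin.eta]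
    rfl
  · simp only [max_eq_left hij, min_eq_right hij, Fin.eta]
    exact ((mem_symBilin_iff φ).1 hφ j i k)

/-- A cocycle is determined by its entries at the variables that are not pivots. Only an upper bound
is needed; equality comes out of the count in `cocycle_basis`. -/
theorem finrank_Z2_le (h6 : (6 : F) ≠ 0) {c : Combination}
    (h : (LinForm.echelon (d2Forms n c)).all LinForm.isPivotForm = true) :
    Module.finrank F (Z2 (c.toBilin F n)) ≤
      (freeVars (n ^ 3) (isTriVar n) (LinForm.pivots (LinForm.echelon (d2Forms n c)))).length := by
  refine LinForm.finrank_le_of_echelon h6 (bilinCoords F n ∘ₗ (Z2 (c.toBilin F n)).subtype) ?_ h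
    (N := n ^ 3) ?_ ?_ _ ?_
  · rintro ⟨φ, hφ⟩ ⟨ψ, hψ⟩ h
    refine Subtype.ext (bilin_ext fun i j k => ?_)
    rw [← bilinCoords_triVar hφ.1, ← bilinCoords_triVar hψ.1]
    exact congrFun h _
  · rintro ⟨φ, hφ⟩
    refine LinForm.eval_echelon _ fun r hr => ?_
    simp only [d2Forms, List.mem_flatMap, List.mem_map, List.mem_range] at hr
    obtain ⟨k, hk, j, hj, i, hi, m, hm, rfl⟩ := hr
    have h1 := ((mem_Z2_iff _ _).1 hφ).2 ⟨i, by omega⟩ ⟨j, by omega⟩ ⟨k, hk⟩ ⟨m, hm⟩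
    rw [LinForm.eval_collect]
    refine (eval_d2Terms _ c ⟨i, by omega⟩ ⟨j, by omega⟩ ⟨k, hk⟩ ⟨m, hm⟩).trans ?_
    rw [← h1]
    simp only [LinearMap.comp_apply, Submodule.subtype_apply, bilinCoords_triVar hφ.1]
    congr 1 <;> congr 1 <;> funext i j k <;> exact (structureConstants_toBilin c i j k).symm
  · rintro ⟨φ, hφ⟩ v hv
    have : ¬ isTriVar n v = true := by simp [isTriVar, Nat.not_lt.2 hv]
    simp [bilinCoords, this]
  · rintro ⟨φ, hφ⟩ v hv hvL
    by_cases h : isTriVar n v = true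
    · refine absurd ?_ hvL
      have h1 := h
      rw [isTriVar, Bool.and_eq_true, Nat.blt_eq] at h1
      simp only [freeVars, List.mem_filter, List.mem_range, h, Bool.true_and, Bool.not_eq_true']
      exact ⟨h1.1, by simpa using hv⟩
    · simp [bilinCoords, h]

/-- The linear map `(a, f) ↦ ∑ s, a_s φ_s + d f`. -/
noncomputable def cochainMap (F : Type*) [Field F] (n : ℕ) (c : Combination)
    (reps : List Combination) :
    ((Fin reps.length → F) × ((Fin n → F) →ₗ[F] Fin n → F)) →ₗ[F] BilinMap F (Fin n → F) :=
  (Fintype.linearCombination F fun s => (reps.get s).toBilin F n).coprod (d1 (c.toBilin F n))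

/-- The coordinates of a pair `(a, f)` as a function of the variables. -/
def pairCoords (F : Type*) [Field F] (n r : ℕ) :
    ((Fin r → F) × ((Fin n → F) →ₗ[F] Fin n → F)) →ₗ[F] ℕ → F where
  toFun p v :=
    if h : v < n * n then
      p.2 (Pi.single ⟨v / n, Nat.div_lt_of_lt_mul h⟩ 1)
        ⟨v % n, Nat.mod_lt _ (Nat.pos_of_lt_mul_right h)⟩
    else if h : v - n * n < r then p.1 ⟨v - n * n, h⟩ else 0
  map_add' p q := by
    funext v
    by_cases h : v < n * n
    · simp [h]
    · by_cases h' : v - n * n < r <;> simp [h, h']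
  map_smul' a p := by
    funext v
    by_cases h : v < n * n
    · simp [h]
    · by_cases h' : v - n * n < r <;> simp [h, h']

theorem pairCoords_end {r : ℕ} (p : (Fin r → F) × ((Fin n → F) →ₗ[F] Fin n → F)) (i j : Fin n) :
    pairCoords F n r p (i * n + j) = p.2 (Pi.single i 1) j := by
  have h : (i : ℕ) * n + j < n * n := by nlinarith [i.2, j.2]
  have hn : 0 < n := i.pos
  have h1 : ((i : ℕ) * n + j) / n = i := by
    rw [Nat.add_div_of_dvd_right (Dvd.intro_left _ rfl), Nat.mul_div_cancel _ hn,
      Nat.div_eq_of_lt j.2, add_zero]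
  have h2 : ((i : ℕ) * n + j) % n = j := by
    rw [Nat.mul_add_mod', Nat.mod_eq_of_lt j.2]
  simp only [pairCoords, LinearMap.coe_mk, AddHom.coe_mk, h, dite_true, h1, h2, Fin.eta]

theorem pairCoords_coeff {r : ℕ} (p : (Fin r → F) × ((Fin n → F) →ₗ[F] Fin n → F)) (s : Fin r) :
    pairCoords F n r p (n * n + s) = p.1 s := by
  simp [pairCoords]

theorem pairCoords_of_le {r : ℕ} (p : (Fin r → F) × ((Fin n → F) →ₗ[F] Fin n → F)) {v : ℕ}
    (h : n * n + r ≤ v) : pairCoords F n r p v = 0 := by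
  have h1 : ¬ v < n * n := by omega
  have h2 : ¬ v - n * n < r := by omega
  simp [pairCoords, h1, h2]

theorem structureConstants_d1 (c : Combination) (f : (Fin n → F) →ₗ[F] Fin n → F)
    (i j k : Fin n) : structureConstants (d1 (c.toBilin F n) f) i j k =
      ∑ l : Fin n, ((c.entry i j l : F) * f (Pi.single l 1) k +
        (-(c.entry i l k : F) * f (Pi.single j 1) l) +
        (-(c.entry j l k : F) * f (Pi.single i 1) l)) := by
  have h1 := fun x => linearMap_apply_eq_sum f x
  have h2 := fun i => linearMap_apply_eq_sum (c.toBilin F n (Pi.single i 1))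
  have h3 : ∀ i l k, c.toBilin F n (Pi.single i 1) (Pi.single l 1) k = (c.entry i l k : F) :=
    fun i l k => structureConstants_toBilin c i l k
  change (f (c.toBilin F n (Pi.single i 1) (Pi.single j 1)) -
    c.toBilin F n (Pi.single i 1) (f (Pi.single j 1)) -
    c.toBilin F n (Pi.single j 1) (f (Pi.single i 1))) k = _
  rw [h1 (c.toBilin F n (Pi.single i 1) (Pi.single j 1)), h2 i (f (Pi.single j 1)),
    h2 j (f (Pi.single i 1))]
  simp only [Pi.sub_apply, Finset.sum_apply, Pi.smul_apply, smul_eq_mul, h3,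
    ← Finset.sum_sub_distrib]
  refine Finset.sum_congr rfl fun l _ => ?_
  ring

/-- Identifies the kernel of `cochainMap` with the solutions of the second linear system: the
entries of `f` occupy the variables below `n * n`, the coefficients of the representatives the ones
from there on. -/
theorem structureConstants_cochainMap (c : Combination) (reps : List Combination)
    (p : (Fin reps.length → F) × ((Fin n → F) →ₗ[F] Fin n → F)) (i j k : Fin n) :
    structureConstants (cochainMap F n c reps p) i j k =
      LinForm.eval (pairCoords F n reps.length p) (d1Terms n c reps i j k) := by
  have h1 : structureConstants (cochainMap F n c reps p) i j k =
      (∑ s, p.1 s * ((reps.get s).entry i j k : F)) +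
        structureConstants (d1 (c.toBilin F n) p.2) i j k := by
    simp only [structureConstants, cochainMap, LinearMap.coprod_apply,
      Fintype.linearCombination_apply, LinearMap.add_apply, Pi.add_apply, LinearMap.sum_apply,
      Finset.sum_apply, LinearMap.smul_apply, Pi.smul_apply, smul_eq_mul]
    simp only [← structureConstants_toBilin]
    rfl
  rw [h1, structureConstants_d1, d1Terms, LinForm.eval_append, LinForm.eval_flatMap,
    sum_map_range, add_comm]
  congr 1
  · refine Finset.sum_congr rfl fun l _ => ?_
    simp only [LinForm.eval_cons, LinForm.eval_nil, pairCoords_end, Int.cast_neg]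
    ring
  · rw [LinForm.eval, List.map_map, sum_map_range]
    refine Finset.sum_congr rfl fun s _ => ?_
    simp only [Function.comp, pairCoords_coeff]
    rw [List.getD_eq_getElem _ _ s.2, mul_comm]
    rfl

theorem eval_d1Forms_eq_zero {c : Combination} {reps : List Combination}
    {p : (Fin reps.length → F) × ((Fin n → F) →ₗ[F] Fin n → F)}
    (hp : cochainMap F n c reps p = 0) :
    ∀ b ∈ LinForm.echelon (d1Forms n c reps), LinForm.eval (pairCoords F n reps.length p) b = 0 := by
  refine LinForm.eval_echelon _ fun r hr => ?_
  simp only [d1Forms, List.mem_flatMap, List.mem_map, List.mem_range] at hr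
  obtain ⟨j, hj, i, hi, k, hk, rfl⟩ := hr
  rw [LinForm.eval_collect]
  refine (structureConstants_cochainMap c reps p ⟨i, by omega⟩ ⟨j, hj⟩ ⟨k, hk⟩).symm.trans ?_
  rw [hp]
  rfl

/-- The certificate shows that the representatives are independent modulo coboundaries and that
they span the cocycles together with the coboundaries. -/
theorem cocycle_basis (h6 : (6 : F) ≠ 0) {c : Combination} {reps : List Combination}
    (hc : isCocycle n c c = true) (hr : ∀ b ∈ reps, isCocycle n c b = true)
    (h : isBasisH2 n c reps = true) :
    (∀ (a : Fin reps.length → F) (f : (Fin n → F) →ₗ[F] Fin n → F),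
      ∑ s, a s • (reps.get s).toBilin F n + d1 (c.toBilin F n) f = 0 → a = 0) ∧
    (∀ z ∈ Z2 (c.toBilin F n), ∃ (a : Fin reps.length → F) (f : (Fin n → F) →ₗ[F] Fin n → F),
      z = ∑ s, a s • (reps.get s).toBilin F n + d1 (c.toBilin F n) f) := by
  simp only [isBasisH2, Bool.and_eq_true, Nat.ble_eq] at h
  obtain ⟨hB2, hB1, hs, hle⟩ := h
  have happ : ∀ p : (Fin reps.length → F) × ((Fin n → F) →ₗ[F] Fin n → F),
      cochainMap F n c reps p =
        ∑ s, p.1 s • (reps.get s).toBilin F n + d1 (c.toBilin F n) p.2 := fun p => by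
    rw [cochainMap, LinearMap.coprod_apply, Fintype.linearCombination_apply]
  have hpiv : ∀ s < reps.length,
      n * n + s ∈ LinForm.pivots (LinForm.echelon (d1Forms n c reps)) := fun s hsr => by
    simpa using List.all_eq_true.1 hs s (List.mem_range.2 hsr)
  have hind : ∀ p, cochainMap F n c reps p = 0 → p.1 = 0 := by
    intro p hp
    funext s
    rw [← pairCoords_coeff p s]
    -- The coefficients a_s are the last variables and are all pivots, so back substitution started
    -- at `n * n` forces them to vanish, whatever the endomorphism is.
    refine LinForm.eq_zero_of_echelon h6 hB1 _ (eval_d1Forms_eq_zero hp) (N := n * n + reps.length)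
      (v₀ := n * n) (fun v hv => pairCoords_of_le p hv) ?_ _ (Nat.le_add_right _ _)
    intro v hv hvp
    by_cases hv' : v < n * n + reps.length
    · exact absurd (by simpa [Nat.add_sub_cancel' hv] using hpiv (v - n * n) (by omega)) hvp
    · exact pairCoords_of_le p (not_lt.1 hv')
  have hker : Module.finrank F (LinearMap.ker (cochainMap F n c reps)) ≤ (freeVars (n * n)
      (fun _ => true) (LinForm.pivots (LinForm.echelon (d1Forms n c reps)))).length := by
    refine LinForm.finrank_le_of_echelon h6 (pairCoords F n reps.length ∘ₗ
      (LinearMap.ker (cochainMap F n c reps)).subtype) ?_ hB1 (N := n * n + reps.length) ?_ ?_ _ ?_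
    · rintro ⟨p, hp⟩ ⟨q, hq⟩ h
      refine Subtype.ext (Prod.ext (funext fun s => ?_) ?_)
      · rw [← pairCoords_coeff p s, ← pairCoords_coeff q s]
        exact congrFun h _
      · refine LinearMap.ext fun x => ?_
        rw [linearMap_apply_eq_sum p.2, linearMap_apply_eq_sum q.2]
        refine Finset.sum_congr rfl fun i _ => congrArg _ (funext fun j => ?_)
        rw [← pairCoords_end p i j, ← pairCoords_end q i j]
        exact congrFun h _
    · rintro ⟨p, hp⟩
      exact eval_d1Forms_eq_zero hp
    · rintro ⟨p, hp⟩ v hv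
      exact pairCoords_of_le p hv
    · rintro ⟨p, hp⟩ v hvp hvL
      by_cases hv : v < n * n
      · refine absurd ?_ hvL
        simpa [freeVars, hv] using hvp
      · by_cases hv' : v < n * n + reps.length
        · have h1 := hpiv (v - n * n) (by omega)
          rw [Nat.add_sub_cancel' (not_lt.1 hv)] at h1
          exact absurd h1 hvp
        · exact pairCoords_of_le p (not_lt.1 hv')
  have hrange : LinearMap.range (cochainMap F n c reps) ≤ Z2 (c.toBilin F n) := by
    rintro _ ⟨p, rfl⟩
    rw [happ]
    have h2 : (2 : F) ≠ 0 := fun h0 => h6 (by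
      rw [show (6 : F) = 2 * 3 by norm_num, h0, zero_mul])
    exact add_mem (Submodule.sum_mem _ fun s _ => Submodule.smul_mem _ _
      (toBilin_mem_Z2 (hr _ (List.get_mem _ _))))
      (B2_le_Z2 (isJJAlgebra_toBilin h2 hc) ⟨p.2, rfl⟩)
  refine ⟨fun a f h0 => hind (a, f) ((happ (a, f)).trans h0), fun z hz => ?_⟩
  -- The rank is at least r + n² minus the free variables of the second system. By the certificate
  -- this is at least the number of free variables of the cocycle system, which bounds dim Z² from
  -- above.
  have heq : LinearMap.range (cochainMap F n c reps) = Z2 (c.toBilin F n) := by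
    refine Submodule.eq_of_le_of_finrank_le hrange ?_
    have h1 := LinearMap.finrank_range_add_finrank_ker (cochainMap F n c reps)
    have h2 : Module.finrank F ((Fin reps.length → F) × ((Fin n → F) →ₗ[F] Fin n → F)) =
        reps.length + n * n := by
      simp [Module.finrank_prod, Module.finrank_linearMap]
    have h3 := finrank_Z2_le (n := n) h6 hB2
    omega
  rw [← heq] at hz
  obtain ⟨p, rfl⟩ := hz
  exact ⟨p.1, p.2, happ p⟩

end

end Combination

/-! ### Bases of H² and invariance under isomorphism -/

section

variable {F : Type*} [Field F] {V W : Type*} [AddCommGroup V] [Module F V]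
  [AddCommGroup W] [Module F W]

theorem H2.mk_eq_zero_iff {μ φ : BilinMap F V} (h : φ ∈ Z2 μ) : H2.mk μ φ h = 0 ↔ φ ∈ B2 μ := by
  rw [H2.mk, Submodule.mkQ_apply, Submodule.Quotient.mk_eq_zero]
  exact Iff.rfl

theorem H2.mk_surjective (μ : BilinMap F V) (q : H2 μ) : ∃ φ h, q = H2.mk μ φ h := by
  obtain ⟨⟨φ, h⟩, rfl⟩ := Submodule.Quotient.mk_surjective _ q
  exact ⟨φ, h, rfl⟩

theorem H2.sum_smul_mk {ι : Type*} [Fintype ι] (μ : BilinMap F V) (a : ι → F)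
    (φ : ι → BilinMap F V) (h : ∀ i, φ i ∈ Z2 μ) :
    ∑ i, a i • H2.mk μ (φ i) (h i) =
      H2.mk μ (∑ i, a i • φ i) (Submodule.sum_mem _ fun i _ => Submodule.smul_mem _ _ (h i)) := by
  unfold H2.mk
  simp only [← map_smul, ← map_sum]
  congr 1
  refine Subtype.ext ?_
  simp

/-- Representatives that are independent modulo coboundaries and that span the cocycles together
with the coboundaries give a basis of the second cohomology. -/
theorem H2.basis {r : ℕ} {μ : BilinMap F V} (hμ : IsJJAlgebra μ) (φ : Fin r → BilinMap F V)
    (h : ∀ i, φ i ∈ Z2 μ)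
    (hind : ∀ (a : Fin r → F) (f : V →ₗ[F] V), ∑ i, a i • φ i + d1 μ f = 0 → a = 0)
    (hspan : ∀ z ∈ Z2 μ, ∃ (a : Fin r → F) (f : V →ₗ[F] V), z = ∑ i, a i • φ i + d1 μ f) :
    LinearIndependent F (fun i => H2.mk μ (φ i) (h i)) ∧
      Submodule.span F (Set.range fun i => H2.mk μ (φ i) (h i)) = ⊤ := by
  constructor
  · rw [Fintype.linearIndependent_iff]
    intro a ha
    rw [H2.sum_smul_mk, H2.mk_eq_zero_iff] at ha
    obtain ⟨f, hf⟩ := ha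
    -- A relation in H² says that the combination equals some df; the sign moves df to the other
    -- side.
    refine congrFun (hind a (-f) ?_)
    rw [map_neg, hf, add_neg_cancel]
  · rw [eq_top_iff]
    rintro q -
    obtain ⟨z, hz, rfl⟩ := H2.mk_surjective μ q
    obtain ⟨a, f, rfl⟩ := hspan z hz
    have hd : d1 μ f ∈ Z2 μ := B2_le_Z2 hμ ⟨f, rfl⟩
    have hs : ∑ i, a i • φ i ∈ Z2 μ :=
      Submodule.sum_mem _ fun i _ => Submodule.smul_mem _ _ (h i)
    have h1 : H2.mk μ (∑ i, a i • φ i + d1 μ f) hz = H2.mk μ _ hs + H2.mk μ _ hd := by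
      unfold H2.mk
      rw [← map_add]
      rfl
    rw [h1, (H2.mk_eq_zero_iff hd).2 ⟨f, rfl⟩, add_zero, ← H2.sum_smul_mk μ a φ h]
    exact Submodule.sum_mem _ fun i _ => Submodule.smul_mem _ _ (Submodule.subset_span ⟨i, rfl⟩)

theorem finrank_H2_eq_of_basis {r : ℕ} {μ : BilinMap F V} {b : Fin r → H2 μ}
    (h : LinearIndependent F b ∧ Submodule.span F (Set.range b) = ⊤) :
    Module.finrank F (H2 μ) = r := by
  rw [Module.finrank_eq_card_basis (Module.Basis.mk h.1 h.2.ge), Fintype.card_fin]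

/-- Transport of bilinear maps along a linear equivalence. -/
def bilinCongr (e : V ≃ₗ[F] W) : BilinMap F V ≃ₗ[F] BilinMap F W :=
  e.arrowCongr (e.arrowCongr e)

theorem bilinCongr_apply (e : V ≃ₗ[F] W) (φ : BilinMap F V) (x y : W) :
    bilinCongr e φ x y = e (φ (e.symm x) (e.symm y)) := rfl

theorem AlgIso.symm {μ : BilinMap F V} {ν : BilinMap F W} (h : AlgIso μ ν) : AlgIso ν μ := by
  obtain ⟨e, he⟩ := h
  refine ⟨e.symm, fun x y => ?_⟩
  rw [LinearEquiv.symm_apply_eq, he, e.apply_symm_apply, e.apply_symm_apply]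

theorem AlgIso.trans {U : Type*} [AddCommGroup U] [Module F U] {μ : BilinMap F V}
    {ν : BilinMap F W} {ρ : BilinMap F U} (h : AlgIso μ ν) (h' : AlgIso ν ρ) : AlgIso μ ρ := by
  obtain ⟨e, he⟩ := h
  obtain ⟨e', he'⟩ := h'
  exact ⟨e.trans e', fun x y => by simp only [LinearEquiv.trans_apply, he, he']⟩

/-- Transport of structure. The inclusion alone is enough, since the inverse isomorphism gives the
opposite inequality of dimensions. -/
theorem map_Z2_le {μ : BilinMap F V} {ν : BilinMap F W} (e : V ≃ₗ[F] W)
    (he : ∀ x y, e (μ x y) = ν (e x) (e y)) :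
    (Z2 μ).map (bilinCongr e : BilinMap F V →ₗ[F] BilinMap F W) ≤ Z2 ν := by
  rintro _ ⟨φ, ⟨hφ, hφ'⟩, rfl⟩
  have he' : ∀ x y, e.symm (ν x y) = μ (e.symm x) (e.symm y) := fun x y => by
    rw [LinearEquiv.symm_apply_eq, he, e.apply_symm_apply, e.apply_symm_apply]
  have hν : ∀ x y, ν x (e y) = e (μ (e.symm x) y) := fun x y => by
    rw [he, e.apply_symm_apply]
  refine ⟨fun x y => ?_, fun x y z => ?_⟩
  · simp only [LinearEquiv.coe_coe, bilinCongr_apply, hφ (e.symm x)]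
  · have := congrArg e (hφ' (e.symm x) (e.symm y) (e.symm z))
    simp only [d2, map_add, map_zero] at this
    simp only [d2, LinearEquiv.coe_coe, bilinCongr_apply, he', hν]
    exact this

theorem map_B2_le {μ : BilinMap F V} {ν : BilinMap F W} (e : V ≃ₗ[F] W)
    (he : ∀ x y, e (μ x y) = ν (e x) (e y)) :
    (B2 μ).map (bilinCongr e : BilinMap F V →ₗ[F] BilinMap F W) ≤ B2 ν := by
  rintro _ ⟨_, ⟨f, rfl⟩, rfl⟩
  refine ⟨e.arrowCongr e f, LinearMap.ext fun x => LinearMap.ext fun y => ?_⟩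
  have hν : ∀ x y, ν x (e y) = e (μ (e.symm x) y) := fun x y => by
    rw [he, e.apply_symm_apply]
  have he' : e.symm (ν x y) = μ (e.symm x) (e.symm y) := by
    rw [LinearEquiv.symm_apply_eq, he, e.apply_symm_apply, e.apply_symm_apply]
  change e (f (e.symm (ν x y))) - ν x (e (f (e.symm y))) - ν y (e (f (e.symm x))) =
    e (f (μ (e.symm x) (e.symm y)) - μ (e.symm x) (f (e.symm y)) - μ (e.symm y) (f (e.symm x)))
  rw [he', hν, hν, map_sub, map_sub]

/-- Reduces invariance of dim H² to that of dim Z² and dim B², so no map between the quotients has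
to be built. -/
theorem finrank_H2_add [FiniteDimensional F V] {μ : BilinMap F V} (hμ : IsJJAlgebra μ) :
    Module.finrank F (H2 μ) + Module.finrank F (B2 μ) = Module.finrank F (Z2 μ) := by
  rw [← (Submodule.submoduleOfEquivOfLe (B2_le_Z2 hμ)).finrank_eq]
  exact Submodule.finrank_quotient_add_finrank _

theorem AlgIso.finrank_le [FiniteDimensional F W] {μ : BilinMap F V} {ν : BilinMap F W}
    (h : AlgIso μ ν) : Module.finrank F (Z2 μ) ≤ Module.finrank F (Z2 ν) ∧
      Module.finrank F (B2 μ) ≤ Module.finrank F (B2 ν) := by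
  obtain ⟨e, he⟩ := h
  rw [← LinearEquiv.finrank_map_eq (bilinCongr e) (Z2 μ),
    ← LinearEquiv.finrank_map_eq (bilinCongr e) (B2 μ)]
  exact ⟨Submodule.finrank_mono (map_Z2_le e he), Submodule.finrank_mono (map_B2_le e he)⟩

/-- The dimension of the second cohomology is an invariant. -/
theorem AlgIso.finrank_H2_eq [FiniteDimensional F V] [FiniteDimensional F W] {μ : BilinMap F V}
    {ν : BilinMap F W} (hμ : IsJJAlgebra μ) (hν : IsJJAlgebra ν) (h : AlgIso μ ν) :
    Module.finrank F (H2 μ) = Module.finrank F (H2 ν) := by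
  have h1 := h.finrank_le
  have h2 := h.symm.finrank_le
  have h3 := finrank_H2_add hμ
  have h4 := finrank_H2_add hν
  omega

end

/-! ### Nilpotency and trace of multiplication operators -/

section

variable {R : Type*} [CommRing R] {n : ℕ}

theorem tensorMul_comm {S : Fin n → Fin n → Fin n → R} (hS : ∀ i j k, S i j k = S j i k)
    (x y : Fin n → R) : tensorMul S x y = tensorMul S y x := by
  funext k
  unfold tensorMul
  rw [Finset.sum_comm]
  refine Finset.sum_congr rfl fun i _ => Finset.sum_congr rfl fun j _ => ?_
  rw [hS, mul_comm (x j)]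

theorem tensorMul_smul_right (S : Fin n → Fin n → Fin n → R) (x y : Fin n → R) (a : R) :
    tensorMul S x (a • y) = a • tensorMul S x y := by
  funext k
  simp only [tensorMul, Pi.smul_apply, smul_eq_mul, Finset.mul_sum]
  refine Finset.sum_congr rfl fun i _ => Finset.sum_congr rfl fun j _ => ?_
  ring

theorem tensorMul_jacobi {S : Fin n → Fin n → Fin n → R}
    (hJ : ∀ i j k m, jacobiator S S i j k m = 0) (x y z : Fin n → R) :
    tensorMul S x (tensorMul S y z) + tensorMul S y (tensorMul S z x) +
      tensorMul S z (tensorMul S x y) = 0 := by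
  funext m
  rw [Pi.add_apply, Pi.add_apply, tensorMul_cyclic_sum]
  simp [hJ]

/-- In a Jacobi-Jordan algebra the cube of every multiplication operator vanishes. -/
theorem tensorMul_cube_eq_zero [IsDomain R] (h2 : (2 : R) ≠ 0) (h3 : (3 : R) ≠ 0)
    {S : Fin n → Fin n → Fin n → R} (hS : ∀ i j k, S i j k = S j i k)
    (hJ : ∀ i j k m, jacobiator S S i j k m = 0) (x y : Fin n → R) :
    tensorMul S x (tensorMul S x (tensorMul S x y)) = 0 := by
  have hc := tensorMul_comm hS
  have hJ' := tensorMul_jacobi hJ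
  -- The Jacobi identity for x, x, y reads x²y = -2x(xy); for x, x, x it gives 3x·x² = 0.
  have hq : ∀ y, tensorMul S (tensorMul S x x) y = (-2 : R) • tensorMul S x (tensorMul S x y) := by
    intro y
    have h1 := hJ' x x y
    rw [hc y x, hc y (tensorMul S x x)] at h1
    rw [eq_neg_of_add_eq_zero_right h1, ← two_smul R, neg_smul]
  have hx : tensorMul S x (tensorMul S x x) = 0 := by
    have h1 := hJ' x x x
    have h4 : (3 : R) • tensorMul S x (tensorMul S x x) = 0 := by
      rw [← h1, show (3 : R) = 1 + 1 + 1 by norm_num, add_smul, add_smul, one_smul]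
    exact (smul_eq_zero.1 h4).resolve_left h3
  -- In x²(xy) + x(yx²) + y(x²x) = 0 the last term vanishes and each of the others equals -2
  -- x(x(xy)), which leaves -4 x(x(xy)) = 0.
  have h1 := hJ' (tensorMul S x x) x y
  have h0 : tensorMul S y (0 : Fin n → R) = 0 := by
    funext k
    simp [tensorMul]
  rw [hc y (tensorMul S x x), hq, hq, hc (tensorMul S x x) x, hx, h0, add_zero,
    tensorMul_smul_right, ← add_smul, smul_eq_zero] at h1
  refine h1.resolve_left fun h => ?_
  have h4 : (2 : R) * 2 = 0 := by linear_combination -h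
  exact h2 (mul_self_eq_zero.1 h4)

/-- In a Jacobi-Jordan algebra every multiplication operator has trace zero. -/
theorem sum_structure_eq_zero [IsDomain R] (h2 : (2 : R) ≠ 0) (h3 : (3 : R) ≠ 0)
    {S : Fin n → Fin n → Fin n → R} (hS : ∀ i j k, S i j k = S j i k)
    (hJ : ∀ i j k m, jacobiator S S i j k m = 0) (a : Fin n) : ∑ j, S a j j = 0 := by
  let L : Matrix (Fin n) (Fin n) R := Matrix.of fun k j => S a j k
  have hL : ∀ y, L.mulVec y = tensorMul S (Pi.single a 1) y := by
    intro y
    funext k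
    simp [tensorMul, Matrix.mulVec, dotProduct, L, Pi.single_apply]
  have hL3 : L ^ 3 = 0 := by
    refine Matrix.ext_of_mulVec_single fun i => ?_
    rw [pow_succ, pow_two, ← Matrix.mulVec_mulVec, ← Matrix.mulVec_mulVec, hL, hL, hL,
      tensorMul_cube_eq_zero h2 h3 hS hJ, Matrix.zero_mulVec]
  -- The trace of a nilpotent matrix is nilpotent, hence zero in a domain. This is applied below
  -- with R = F[[t]].
  have h := Matrix.isNilpotent_trace_of_isNilpotent (M := L) ⟨3, hL3⟩
  exact h.eq_zero

end

/-! ### Formal deformations as structures over power series -/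

section

open PowerSeries

variable {F : Type*} [Field F] {n : ℕ}

/-- A sequence of vectors as a vector of power series. -/
noncomputable def seqToSeries (f : ℕ → Fin n → F) (i : Fin n) : F⟦X⟧ := PowerSeries.mk fun s => f s i

/-- The structure constants of a family of bilinear maps. -/
noncomputable def familyConstants (φ : ℕ → BilinMap F (Fin n → F)) (i j k : Fin n) : F⟦X⟧ :=
  PowerSeries.mk fun s => structureConstants (φ s) i j k

theorem seqToSeries_injective : Function.Injective (seqToSeries (F := F) (n := n)) := by
  intro f g h
  funext s i
  have := congrArg (PowerSeries.coeff s) (congrFun h i)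
  simpa [seqToSeries] using this

theorem seqToSeries_add (f g : ℕ → Fin n → F) :
    seqToSeries (f + g) = seqToSeries f + seqToSeries g := by
  funext i
  ext s
  simp [seqToSeries]

/-- The nested convolution is the coefficient of a product of three power series. So J[[t]] is
F[[t]]^n with structure constants in F[[t]], and the results over commutative rings apply to it. -/
theorem seqToSeries_formalMul (φ : ℕ → BilinMap F (Fin n → F)) (f g : ℕ → Fin n → F) :
    seqToSeries (formalMul φ f g) =
      tensorMul (familyConstants φ) (seqToSeries f) (seqToSeries g) := by
  funext k
  ext N
  simp only [seqToSeries, familyConstants, tensorMul, formalMul, map_sum, PowerSeries.coeff_mul,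
    PowerSeries.coeff_mk, Finset.sum_apply, apply_eq_tensorMul, Finset.mul_sum]
  rw [Finset.sum_congr rfl fun p _ => Finset.sum_comm, Finset.sum_comm]
  refine Finset.sum_congr rfl fun i _ => ?_
  rw [Finset.sum_congr rfl fun p _ => Finset.sum_comm, Finset.sum_comm]

theorem isJacobiJordan_formalMul {φ : ℕ → BilinMap F (Fin n → F)}
    (hS : ∀ i j k, familyConstants φ i j k = familyConstants φ j i k)
    (hJ : ∀ i j k m, jacobiator (familyConstants φ) (familyConstants φ) i j k m = 0) :
    IsJacobiJordan (formalMul φ) := by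
  refine ⟨fun f g => seqToSeries_injective ?_, fun f g h => seqToSeries_injective ?_⟩
  · rw [seqToSeries_formalMul, seqToSeries_formalMul, tensorMul_comm hS]
  · simp only [seqToSeries_add, seqToSeries_formalMul]
    rw [tensorMul_jacobi hJ]
    funext i
    ext s
    simp [seqToSeries]

theorem familyConstants_comm {μ : BilinMap F (Fin n → F)} {φ : ℕ → BilinMap F (Fin n → F)}
    (h : IsFormalDeformation μ φ) (i j k : Fin n) :
    familyConstants φ i j k = familyConstants φ j i k := by
  ext s
  simp only [familyConstants, PowerSeries.coeff_mk]
  exact (mem_symBilin_iff _).1 (h.2.1 s) i j k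

theorem jacobiator_familyConstants {μ : BilinMap F (Fin n → F)} {φ : ℕ → BilinMap F (Fin n → F)}
    (h : IsFormalDeformation μ φ) (i j k m : Fin n) :
    jacobiator (familyConstants φ) (familyConstants φ) i j k m = 0 := by
  -- Constant sequences represent the standard basis over F[[t]]; the Jacobi identity at these gives
  -- the tensor identity.
  have hsingle : ∀ i : Fin n, seqToSeries (fun s => if s = 0 then Pi.single i (1 : F) else 0) =
      Pi.single i 1 := by
    intro i
    funext j
    ext s
    by_cases hij : j = i
    · subst hij
      by_cases hs : s = 0 <;> simp [seqToSeries, hs, PowerSeries.coeff_one]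
    · by_cases hs : s = 0 <;> simp [seqToSeries, hs, hij]
  have h1 := h.2.2.2 (fun s => if s = 0 then Pi.single i (1 : F) else 0)
    (fun s => if s = 0 then Pi.single j (1 : F) else 0)
    (fun s => if s = 0 then Pi.single k (1 : F) else 0)
  have h2 := congrFun (congrArg seqToSeries h1) m
  simp only [seqToSeries_add, seqToSeries_formalMul, hsingle, Pi.add_apply] at h2
  rw [tensorMul_cyclic_sum, sum_single_mul (fun i j k => jacobiator (familyConstants φ)
    (familyConstants φ) i j k m)] at h2
  rw [h2]
  ext s
  simp [seqToSeries]

/-- The equation of order two of a formal deformation. -/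
theorem jacobiator_order_two {μ : BilinMap F (Fin n → F)} {φ : ℕ → BilinMap F (Fin n → F)}
    (h : IsFormalDeformation μ φ) (i j k m : Fin n) :
    jacobiator (structureConstants (φ 2)) (structureConstants μ) i j k m +
      jacobiator (structureConstants μ) (structureConstants (φ 2)) i j k m +
      jacobiator (structureConstants (φ 1)) (structureConstants (φ 1)) i j k m = 0 := by
  have h1 := congrArg (PowerSeries.coeff 2) (jacobiator_familyConstants h i j k m)
  have h2 : Finset.HasAntidiagonal.antidiagonal 2 = {(0, 2), (1, 1), (2, 0)} := rfl
  simp only [jacobiator, map_sum, map_add, PowerSeries.coeff_mul, h2, familyConstants,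
    PowerSeries.coeff_mk, map_zero] at h1
  rw [← h1, jacobiator, jacobiator, jacobiator, ← Finset.sum_add_distrib,
    ← Finset.sum_add_distrib, ← h.1]
  refine Finset.sum_congr rfl fun l _ => ?_
  simp
  ring

/-- The infinitesimal part of a formal deformation consists of operators with trace zero. -/
theorem sum_structureConstants_eq_zero (h2 : (2 : F) ≠ 0) (h3 : (3 : F) ≠ 0)
    {μ : BilinMap F (Fin n → F)} {φ : ℕ → BilinMap F (Fin n → F)} (h : IsFormalDeformation μ φ)
    (a : Fin n) : ∑ j, structureConstants (φ 1) a j j = 0 := by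
  have hne : ∀ m : ℕ, (m : F) ≠ 0 → (m : F⟦X⟧) ≠ 0 := by
    intro m hm h0
    apply hm
    have := congrArg PowerSeries.constantCoeff h0
    simpa using this
  have h4 := sum_structure_eq_zero (R := F⟦X⟧) (by exact_mod_cast hne 2 (by exact_mod_cast h2))
    (by exact_mod_cast hne 3 (by exact_mod_cast h3)) (familyConstants_comm h)
    (jacobiator_familyConstants h) a
  have h5 := congrArg (PowerSeries.coeff 1) h4
  simpa [familyConstants] using h5

end

/-! ### Deformations that are linear in the parameter -/

section

open PowerSeries

variable {F : Type*} [Field F] {n : ℕ}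

/-- A cocycle whose Jacobiator vanishes defines a linear deformation. -/
theorem isFormalDeformation_linearFamily {μ φ : BilinMap F (Fin n → F)}
    (hμ : μ ∈ symBilin F (Fin n → F))
    (hJ : ∀ i j k m, jacobiator (structureConstants μ) (structureConstants μ) i j k m = 0)
    (hφ : φ ∈ Z2 μ)
    (hφ' : ∀ i j k m, jacobiator (structureConstants φ) (structureConstants φ) i j k m = 0) :
    IsFormalDeformation μ (linearFamily μ φ) := by
  have hsym : ∀ s, linearFamily μ φ s ∈ symBilin F (Fin n → F) := by
    intro s
    match s with
    | 0 => exact hμ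
    | 1 => exact hφ.1
    | _ + 2 => exact zero_mem _
  have hfam : ∀ i j k, familyConstants (linearFamily μ φ) i j k =
      PowerSeries.C (structureConstants μ i j k) +
        PowerSeries.C (structureConstants φ i j k) * PowerSeries.X := by
    intro i j k
    ext s
    match s with
    | 0 => simp [familyConstants, linearFamily]
    | 1 => simp [familyConstants, linearFamily, PowerSeries.coeff_C]
    | s + 2 =>
      rw [show s + 2 = (s + 1) + 1 from rfl, map_add, PowerSeries.coeff_succ_mul_X]
      simp [familyConstants, linearFamily, structureConstants]
  refine ⟨rfl, hsym, isJacobiJordan_formalMul (fun i j k => ?_) fun i j k m => ?_⟩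
  · ext s
    simp only [familyConstants, PowerSeries.coeff_mk]
    exact (mem_symBilin_iff _).1 (hsym s) i j k
  · have h0 : (PowerSeries.C : F →+* F⟦X⟧) _ = _ := congrArg _ (hJ i j k m)
    have h1 : (PowerSeries.C : F →+* F⟦X⟧) _ = _ := congrArg _ (((mem_Z2_iff _ _).1 hφ).2 i j k m)
    have h2 : (PowerSeries.C : F →+* F⟦X⟧) _ = _ := congrArg _ (hφ' i j k m)
    simp only [map_add, ← jacobiator_map, map_zero] at h0 h1 h2
    -- The Jacobiator of μ + tφ is quadratic in t: its coefficients are the Jacobiator of μ, the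
    -- differential of φ and the Jacobiator of φ.
    have h3 : jacobiator (familyConstants (linearFamily μ φ)) (familyConstants (linearFamily μ φ))
        i j k m =
        jacobiator (fun i j k => PowerSeries.C (structureConstants μ i j k))
          (fun i j k => PowerSeries.C (structureConstants μ i j k)) i j k m +
        (jacobiator (fun i j k => PowerSeries.C (structureConstants φ i j k))
          (fun i j k => PowerSeries.C (structureConstants μ i j k)) i j k m +
        jacobiator (fun i j k => PowerSeries.C (structureConstants μ i j k))
          (fun i j k => PowerSeries.C (structureConstants φ i j k)) i j k m) * PowerSeries.X +
        jacobiator (fun i j k => PowerSeries.C (structureConstants φ i j k))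
          (fun i j k => PowerSeries.C (structureConstants φ i j k)) i j k m *
            PowerSeries.X ^ 2 := by
      simp only [jacobiator, hfam, add_mul, Finset.sum_mul, ← Finset.sum_add_distrib]
      refine Finset.sum_congr rfl fun l _ => ?_
      ring
    rw [h3, h0, h1, h2]
    simp

theorem specialize_linearFamily {V : Type*} [AddCommGroup V] [Module F V] (μ φ : BilinMap F V)
    (t : F) : specialize (linearFamily μ φ) t = μ + t • φ := by
  have : (Function.support fun s => t ^ s • linearFamily μ φ s) ⊆ (Finset.range 2 : Finset ℕ) := by
    intro s hs
    match s with
    | 0 => simp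
    | 1 => simp
    | s + 2 => simp [linearFamily] at hs
  rw [specialize, finsum_eq_sum_of_support_subset _ this]
  simp [Finset.sum_range_succ, linearFamily]

theorem support_linearFamily_finite {V : Type*} [AddCommGroup V] [Module F V]
    (μ φ : BilinMap F V) : (Function.support (linearFamily μ φ)).Finite := by
  refine (Finset.finite_toSet (Finset.range 2)).subset fun s hs => ?_
  match s with
  | 0 => simp
  | 1 => simp
  | s + 2 => simp [linearFamily] at hs

end

/-! ### Sufficient tests for extendibility and for its failure -/

namespace Combination

/-- No output index of the combination is one of its input indices. -/
def isTwoStep (b : Combination) : Bool :=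
  b.all fun s => b.all fun t => !s.2.2.2.beq t.2.1 && !s.2.2.2.beq t.2.2.1

/-- Some multiplication operator has a trace that is a nonzero smooth integer. -/
def hasTrace (n : ℕ) (b : Combination) : Bool :=
  (List.range n).any fun i => IsSmooth ((List.range n).map fun j => b.entry i j j).sum

/-- An entry of the Jacobiator of a combination. -/
def jacobiEntry (n : ℕ) (b : Combination) (i j k m : ℕ) : ℤ :=
  ((List.range n).map fun l => b.entry i l m * b.entry j k l + b.entry j l m * b.entry k i l +
    b.entry k l m * b.entry i j l).sum

/-- The entries `(a, i, j, k, m)` of the list give a linear combination, with coefficients `a`, of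
the equations `d φ (e_i, e_j, e_k)_m = 0` that is trivial and whose value at the Jacobiator of `b` is
an invertible integer. -/
def obstructs (n : ℕ) (c b : Combination) (w : List (ℤ × ℕ × ℕ × ℕ × ℕ)) : Bool :=
  (w.all fun q => q.2.1.blt n && (q.2.2.1.blt n && (q.2.2.2.1.blt n && q.2.2.2.2.blt n))) &&
  ((LinForm.collect (w.flatMap fun q =>
    (d2Terms n c q.2.1 q.2.2.1 q.2.2.2.1 q.2.2.2.2).map fun p => (p.1, q.1 * p.2))).isEmpty &&
  IsSmooth (w.map fun q => q.1 * jacobiEntry n b q.2.1 q.2.2.1 q.2.2.2.1 q.2.2.2.2).sum)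

theorem exists_mem_of_coeff_ne_zero {c : Combination} {i j k : ℕ} (h : c.coeff i j k ≠ 0) :
    ∃ s ∈ c, (s.2.1 = i ∧ s.2.2.1 = j ∨ s.2.1 = j ∧ s.2.2.1 = i) ∧ s.2.2.2 = k := by
  by_contra! hc
  refine h (List.sum_eq_zero fun a ha => ?_)
  obtain ⟨s, hs, rfl⟩ := List.mem_map.1 ha
  exact if_neg fun h' => hc s hs h'.1 h'.2

/-- A nonzero product would make `l` an output index of one term and an input index of another. -/
theorem entry_mul_entry_eq_zero {b : Combination} (h : isTwoStep b = true) (i j k l m : ℕ) :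
    b.entry i l m * b.entry j k l = 0 := by
  by_contra hne
  obtain ⟨h1, h2⟩ := mul_ne_zero_iff.1 hne
  obtain ⟨t, ht, ht', -⟩ := exists_mem_of_coeff_ne_zero (entry_eq_coeff .. ▸ h1)
  obtain ⟨s, hs, -, hs'⟩ := exists_mem_of_coeff_ne_zero (entry_eq_coeff .. ▸ h2)
  have h3 := List.all_eq_true.1 (List.all_eq_true.1 h s hs) t ht
  simp only [Bool.and_eq_true, Bool.not_eq_true', ← Bool.not_eq_true, Nat.beq_eq, hs'] at h3
  rcases ht' with ⟨-, h4⟩ | ⟨h4, -⟩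
  · exact h3.2 h4.symm
  · exact h3.1 h4.symm

variable {F : Type*} [Field F] {n : ℕ}

theorem structureConstants_toBilin_eq (c : Combination) : structureConstants (c.toBilin F n) =
    fun i j k : Fin n => (c.entry i j k : F) :=
  funext fun i => funext fun j => funext fun k => structureConstants_toBilin c i j k

theorem jacobiator_eq_zero_of_isTwoStep {b : Combination} (h : isTwoStep b = true)
    (i j k m : Fin n) : jacobiator (structureConstants (b.toBilin F n))
      (structureConstants (b.toBilin F n)) i j k m = 0 := by
  rw [structureConstants_toBilin_eq]
  refine Finset.sum_eq_zero fun l _ => ?_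
  have key : ∀ i j k l m : ℕ, (b.entry i l m : F) * b.entry j k l = 0 := fun i j k l m => by
    exact_mod_cast congrArg (Int.cast : ℤ → F) (entry_mul_entry_eq_zero h i j k l m)
  rw [key, key, key, add_zero, add_zero]

theorem isFormalDeformation_of_isTwoStep (h2 : (2 : F) ≠ 0) {c b : Combination}
    (hc : isCocycle n c c = true) (hb : isCocycle n c b = true) (hb' : isTwoStep b = true) :
    IsFormalDeformation (c.toBilin F n) (linearFamily (c.toBilin F n) (b.toBilin F n)) :=
  isFormalDeformation_linearFamily (toBilin_mem_symBilin c)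
    ((isJJAlgebra_iff _).1 (isJJAlgebra_toBilin h2 hc)).2 (toBilin_mem_Z2 hb)
    (jacobiator_eq_zero_of_isTwoStep hb')

theorem not_isExtendible_of_hasTrace (h2 : (2 : F) ≠ 0) (h3 : (3 : F) ≠ 0) (h6 : (6 : F) ≠ 0)
    {μ : BilinMap F (Fin n → F)} {b : Combination} (h : hasTrace n b = true) :
    ¬ IsExtendible μ (b.toBilin F n) := by
  rintro ⟨φ, hφ, h1⟩
  obtain ⟨i, hi, hs⟩ := List.any_eq_true.1 h
  have h4 := sum_structureConstants_eq_zero h2 h3 hφ ⟨i, List.mem_range.1 hi⟩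
  rw [h1, structureConstants_toBilin_eq] at h4
  refine IsSmooth.cast_ne_zero h6 hs ?_
  rw [sum_map_range, Int.cast_sum]
  exact h4

theorem cast_jacobiEntry (b : Combination) (i j k m : Fin n) :
    (jacobiEntry n b i j k m : F) = jacobiator (structureConstants (b.toBilin F n))
      (structureConstants (b.toBilin F n)) i j k m := by
  rw [structureConstants_toBilin_eq, jacobiEntry, sum_map_range, Int.cast_sum]
  refine Finset.sum_congr rfl fun l _ => ?_
  push_cast
  rfl

/-- The list `w` is a functional on trilinear maps that vanishes identically on the differentials of
symmetric cochains. Applied to the equation of order two it removes φ₂, so its value at the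
Jacobiator of `b` would be zero, although that value is an integer invertible in `F`. -/
theorem not_isExtendible_of_obstructs (h6 : (6 : F) ≠ 0) {c b : Combination}
    {w : List (ℤ × ℕ × ℕ × ℕ × ℕ)} (h : obstructs n c b w = true) :
    ¬ IsExtendible (c.toBilin F n) (b.toBilin F n) := by
  rintro ⟨φ, hφ, h1⟩
  simp only [obstructs, Bool.and_eq_true, List.isEmpty_iff] at h
  obtain ⟨hw, hnil, hs⟩ := h
  refine IsSmooth.cast_ne_zero h6 hs ?_
  have h2 := LinForm.eval_collect (bilinCoords F n (φ 2)) (w.flatMap fun q =>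
    (d2Terms n c q.2.1 q.2.2.1 q.2.2.2.1 q.2.2.2.2).map fun p => (p.1, q.1 * p.2))
  rw [hnil, LinForm.eval_nil] at h2
  -- Stated for arbitrary `w` so that induction on the list works; each entry contributes `a` times
  -- one equation of order two.
  have key : ∀ w : List (ℤ × ℕ × ℕ × ℕ × ℕ),
      (w.all fun q => q.2.1.blt n && (q.2.2.1.blt n && (q.2.2.2.1.blt n && q.2.2.2.2.blt n))) = true →
      (((w.map fun q => q.1 * jacobiEntry n b q.2.1 q.2.2.1 q.2.2.2.1 q.2.2.2.2).sum : ℤ) : F) =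
      -LinForm.eval (bilinCoords F n (φ 2)) (w.flatMap fun q =>
        (d2Terms n c q.2.1 q.2.2.1 q.2.2.2.1 q.2.2.2.2).map fun p => (p.1, q.1 * p.2)) := by
    intro w
    induction w with
    | nil => simp
    | cons q w ih =>
      intro hw
      obtain ⟨a, i, j, k, m⟩ := q
      rw [List.all_cons, Bool.and_eq_true] at hw
      simp only [Bool.and_eq_true, Nat.blt_eq] at hw
      obtain ⟨⟨hi, hj, hk, hm⟩, hw⟩ := hw
      have h3 := jacobiator_order_two hφ ⟨i, hi⟩ ⟨j, hj⟩ ⟨k, hk⟩ ⟨m, hm⟩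
      have h4 := eval_d2Terms (bilinCoords F n (φ 2)) c ⟨i, hi⟩ ⟨j, hj⟩ ⟨k, hk⟩ ⟨m, hm⟩
      simp only [bilinCoords_triVar (hφ.2.1 2), ← structureConstants_toBilin] at h4
      have h5 := cast_jacobiEntry (F := F) b ⟨i, hi⟩ ⟨j, hj⟩ ⟨k, hk⟩ ⟨m, hm⟩
      have h7 : ∀ l : List (ℕ × ℤ), LinForm.eval (bilinCoords F n (φ 2))
          (l.map fun p => (p.1, a * p.2)) = a * LinForm.eval (bilinCoords F n (φ 2)) l := by
        intro l
        induction l with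
        | nil => simp
        | cons p l ihl =>
          rw [List.map_cons, LinForm.eval_cons, LinForm.eval_cons, ihl]
          push_cast
          ring
      rw [h1] at h3
      rw [List.map_cons, List.sum_cons, List.flatMap_cons, LinForm.eval_append, Int.cast_add,
        ih (by simpa using hw), h7, Int.cast_mul]
      dsimp only at h4 h5 ⊢
      rw [h4, h5]
      linear_combination (a : F) * h3
  rw [key w hw, ← h2, neg_zero]

end Combination

/-! ### Isomorphisms from bases and from rescaling -/

section

variable {F : Type*} [Field F] {n : ℕ}

/-- Vectors that multiply as the basis vectors of an algebra give an isomorphism with it. -/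
theorem algIso_of_vectors {φ μ : BilinMap F (Fin n → F)} (v : Fin n → Fin n → F)
    (hv : LinearIndependent F v)
    (h : ∀ i j, μ (v i) (v j) = ∑ l, structureConstants φ i j l • v l) : AlgIso φ μ := by
  have hinj : Function.Injective (Fintype.linearCombination F v) := by
    exact hv.fintypeLinearCombination_injective
  refine ⟨LinearEquiv.ofInjectiveEndo _ hinj, fun x y => ?_⟩
  rw [LinearEquiv.coe_ofInjectiveEndo]
  have key : φ.compr₂ (Fintype.linearCombination F v) =
      μ.compl₁₂ (Fintype.linearCombination F v) (Fintype.linearCombination F v) := by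
    refine LinearMap.ext_basis (Pi.basisFun F (Fin n)) (Pi.basisFun F (Fin n)) fun i j => ?_
    simp only [LinearMap.compr₂_apply, LinearMap.compl₁₂_apply, Pi.basisFun_apply,
      Fintype.linearCombination_apply_single, one_smul, h]
    rfl
  exact LinearMap.congr_fun₂ key x y

/-- Rescaling of the basis vectors as an isomorphism. -/
theorem algIso_of_scaling {φ ψ : BilinMap F (Fin n → F)} (s : Fin n → F) (hs : ∀ i, s i ≠ 0)
    (h : ∀ i j k, s k * structureConstants φ i j k = s i * s j * structureConstants ψ i j k) :
    AlgIso φ ψ := by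
  refine algIso_of_vectors (fun i => s i • Pi.single i 1) ?_ fun i j => ?_
  · have h1 : LinearIndependent F (fun i : Fin n => (Pi.single i 1 : Fin n → F)) := by
      convert (Pi.basisFun F (Fin n)).linearIndependent
      rw [Pi.basisFun_apply]
    exact h1.units_smul fun i => Units.mk0 (s i) (hs i)
  · funext k
    simp only [map_smul, LinearMap.smul_apply, Pi.smul_apply, Finset.sum_apply, smul_eq_mul]
    rw [Finset.sum_eq_single k]
    · rw [Pi.single_eq_same, mul_one, mul_comm (structureConstants φ i j k), h]
      change _ * (_ * structureConstants ψ i j k) = _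
      ring
    · intro l _ hl
      rw [Pi.single_eq_of_ne hl.symm, mul_zero, mul_zero]
    · simp

end

/-! ### Gradings and integral base changes -/

namespace Combination

/-- The multiple of a combination by an integer. -/
def scale (ε : ℤ) (b : Combination) : Combination := b.map fun s => (ε * s.1, s.2)

theorem entry_scale (ε : ℤ) (b : Combination) (i j k : ℕ) :
    (scale ε b).entry i j k = ε * b.entry i j k := by
  rw [entry_eq_coeff, entry_eq_coeff]
  unfold coeff scale
  rw [List.map_map, ← List.sum_map_mul_left]
  refine congrArg List.sum (List.map_congr_left fun s _ => ?_)
  simp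

theorem entry_append (a b : Combination) (i j k : ℕ) :
    (a ++ b : Combination).entry i j k = a.entry i j k + b.entry i j k := by
  simp [entry_eq_coeff, coeff]

/-- The weight function `w` on the basis vectors makes the combination homogeneous of degree
`-d`. -/
def isHomogeneous (w : List ℕ) (d : ℕ) (c : Combination) : Bool :=
  c.all fun s => (w.getD (s.2.1 - 1) 0 + w.getD (s.2.2.1 - 1) 0).beq (w.getD (s.2.2.2 - 1) 0 + d)

theorem add_eq_of_isHomogeneous {w : List ℕ} {d : ℕ} {c : Combination}
    (h : isHomogeneous w d c = true) {i j k : ℕ} (hne : c.entry i j k ≠ 0) :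
    w.getD i 0 + w.getD j 0 = w.getD k 0 + d := by
  obtain ⟨s, hs, h1, h2⟩ := exists_mem_of_coeff_ne_zero (entry_eq_coeff .. ▸ hne)
  have h3 := List.all_eq_true.1 h s hs
  rw [Nat.beq_eq, h2] at h3
  rcases h1 with ⟨h4, h5⟩ | ⟨h4, h5⟩ <;> rw [h4, h5] at h3 <;>
    simp only [Nat.add_sub_cancel] at h3 <;> omega

/-- The multiplication `∑ l, c_{ij}^l v_l`, with `v_l` the rows, agrees with the product of the rows
for `M`. -/
def preserves (n : ℕ) (c M : Combination) (rows : List LinForm) : Bool :=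
  rows.all (fun r => r.all fun p => p.1.blt n) &&
  (List.range n).all fun j => (List.range (j + 1)).all fun i => (List.range n).all fun k =>
    LinForm.isZero (LinForm.eval (fun p => LinForm.eval (fun q => M.entry p q k) (rows.getD j []))
      (rows.getD i []) - ((List.range n).map fun l =>
        c.entry i j l * LinForm.eval (fun v => bif v.beq k then 1 else 0) (rows.getD l [])).sum)

/-- The rows form an invertible matrix. -/
def isInvertible (n : ℕ) (rows : List LinForm) : Bool :=
  let B := LinForm.echelon ((List.range n).map fun k => LinForm.collect ((List.range n).map fun i =>
    (i, LinForm.eval (fun v => bif v.beq k then 1 else 0) (rows.getD i []))))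
  B.all LinForm.isPivotForm && (List.range n).all fun i => (LinForm.pivots B).contains i

variable {F : Type*} [Field F] {n : ℕ}

/-- With σ^d = εt the substitution e_i ↦ σ^{w_i} e_i leaves the part of degree 0 unchanged and
absorbs the factor t of the other part. The sign ε allows a target over the integers where the
opposite sign would call for a square root of -1. -/
theorem algIso_scale [IsAlgClosed F] {a b : Combination} {w : List ℕ} {d : ℕ} {ε : ℤ}
    (hd : 0 < d) (hε : ε * ε = 1) (ha : isHomogeneous w 0 a = true)
    (hb : isHomogeneous w d b = true) {t : F} (ht : t ≠ 0) :
    AlgIso (a.toBilin F n + t • b.toBilin F n) ((a ++ scale ε b : Combination).toBilin F n) := by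
  have hε' : (ε : F) * ε = 1 := by exact_mod_cast congrArg (Int.cast : ℤ → F) hε
  obtain ⟨σ, hσ⟩ := IsAlgClosed.exists_pow_nat_eq ((ε : F) * t) hd
  have hσ0 : σ ≠ 0 := by
    rintro rfl
    rw [zero_pow hd.ne'] at hσ
    exact mul_ne_zero (left_ne_zero_of_mul_eq_one hε') ht hσ.symm
  refine algIso_of_scaling (fun i => σ ^ w.getD i 0) (fun i => pow_ne_zero _ hσ0) fun i j k => ?_
  have h1 : structureConstants (a.toBilin F n + t • b.toBilin F n) i j k =
      (a.entry i j k : F) + t * b.entry i j k := by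
    rw [← structureConstants_toBilin, ← structureConstants_toBilin]
    rfl
  rw [h1, structureConstants_toBilin, entry_append, entry_scale, ← pow_add]
  have h2 : σ ^ w.getD k 0 * (a.entry i j k : F) =
      σ ^ (w.getD i 0 + w.getD j 0) * a.entry i j k := by
    by_cases h : a.entry i j k = 0
    · simp [h]
    · rw [add_eq_of_isHomogeneous ha h, add_zero]
  have h3 : σ ^ w.getD k 0 * (t * b.entry i j k : F) =
      σ ^ (w.getD i 0 + w.getD j 0) * (ε * b.entry i j k) := by
    by_cases h : b.entry i j k = 0
    · simp [h]
    · rw [add_eq_of_isHomogeneous hb h, pow_add, hσ]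
      linear_combination (-(σ ^ w.getD k 0 * t * b.entry i j k)) * hε'
  push_cast
  linear_combination h2 + h3

/-- The vector with the given coordinates. -/
def rowVector (F : Type*) [Field F] (n : ℕ) (r : LinForm) : Fin n → F :=
  fun k => LinForm.eval (fun v => if v = k then 1 else 0) r

theorem rowVector_apply (r : LinForm) (k : Fin n) : rowVector F n r k =
    ((LinForm.eval (fun v => bif v.beq k then 1 else 0) r : ℤ) : F) := by
  refine Eq.trans ?_ (LinForm.eval_map _ (Int.castRingHom F) r)
  unfold rowVector
  congr 1
  funext v
  simp only [Bool.cond_eq_ite, Nat.beq_eq]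
  split_ifs <;> simp

theorem map_rowVector {W : Type*} [AddCommGroup W] [Module F W] (f : (Fin n → F) →ₗ[F] W)
    (r : LinForm) : f (rowVector F n r) =
      (r.map fun p => (p.2 : F) • f fun k : Fin n => if p.1 = (k : ℕ) then 1 else 0).sum := by
  induction r with
  | nil => exact map_zero f
  | cons p r ih =>
    have : rowVector F n (p :: r) =
        (p.2 : F) • (fun k : Fin n => if p.1 = k then (1 : F) else 0) + rowVector F n r := by
      funext k
      simp [rowVector]
    rw [this, map_add, map_smul, ih, List.map_cons, List.sum_cons]

theorem toBilin_rowVector (M : Combination) {r s : LinForm} (hr : ∀ p ∈ r, p.1 < n)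
    (hs : ∀ p ∈ s, p.1 < n) (k : Fin n) :
    M.toBilin F n (rowVector F n r) (rowVector F n s) k =
      ((LinForm.eval (fun p => LinForm.eval (fun q => M.entry p q k) s) r : ℤ) : F) := by
  have hsingle : ∀ p (hp : p < n), (fun k : Fin n => if p = k then (1 : F) else 0) =
      Pi.single ⟨p, hp⟩ 1 := by
    intro p hp
    funext k
    simp [Pi.single_apply, Fin.ext_iff, eq_comm]
  have h1 : ∀ x, M.toBilin F n (rowVector F n r) x k =
      (r.map fun p => (p.2 : F) * M.toBilin F n (fun k : Fin n => if p.1 = (k : ℕ) then 1 else 0) x k).sum := by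
    intro x
    exact map_rowVector (LinearMap.proj k ∘ₗ (M.toBilin F n).flip x) r
  have h2 : ∀ x, M.toBilin F n x (rowVector F n s) k =
      (s.map fun p => (p.2 : F) * M.toBilin F n x (fun k : Fin n => if p.1 = (k : ℕ) then 1 else 0) k).sum := by
    intro x
    exact map_rowVector (LinearMap.proj k ∘ₗ M.toBilin F n x) s
  have h3 : ∀ (x : ℕ → ℤ) (r : LinForm), ((LinForm.eval x r : ℤ) : F) =
      (r.map fun p => (p.2 : F) * (x p.1 : F)).sum := fun x r =>
    (LinForm.eval_map x (Int.castRingHom F) r).symm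
  rw [h1, h3]
  refine congrArg List.sum (List.map_congr_left fun p hp => congrArg _ ?_)
  rw [h2, h3]
  refine congrArg List.sum (List.map_congr_left fun q hq => congrArg _ ?_)
  rw [hsingle _ (hr p hp), hsingle _ (hs q hq)]
  exact structureConstants_toBilin M ⟨p.1, hr p hp⟩ ⟨q.1, hs q hq⟩ k

/-- The elimination is run on the transposed matrix: the unknowns are the coefficients of a linear
relation, with one equation for each coordinate. If every unknown is a pivot, only the trivial
relation remains. -/
theorem linearIndependent_rowVector (h6 : (6 : F) ≠ 0) {rows : List LinForm}
    (h : isInvertible n rows = true) :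
    LinearIndependent F fun i : Fin n => rowVector F n (rows.getD i []) := by
  simp only [isInvertible, Bool.and_eq_true] at h
  rw [Fintype.linearIndependent_iff]
  intro g hg i
  let x : ℕ → F := fun v => if h : v < n then g ⟨v, h⟩ else 0
  have hx : ∀ i : Fin n, x i = g i := fun i => by simp [x]
  rw [← hx]
  refine LinForm.eq_zero_of_echelon h6 h.1 x ?_ (N := n) (v₀ := 0) (fun v hv => ?_)
    (fun v _ hv => ?_) i (Nat.zero_le _)
  · refine LinForm.eval_echelon x fun r hr => ?_
    simp only [List.mem_map, List.mem_range] at hr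
    obtain ⟨k, hk, rfl⟩ := hr
    rw [LinForm.eval_collect, LinForm.eval, List.map_map, sum_map_range]
    have h1 := congrFun hg ⟨k, hk⟩
    rw [Finset.sum_apply] at h1
    refine Eq.trans (Finset.sum_congr rfl fun i _ => ?_) h1
    rw [Pi.smul_apply, smul_eq_mul, rowVector_apply, Function.comp_apply, hx, mul_comm]
  · simp [x, Nat.not_lt.2 hv]
  · by_cases hvn : v < n
    · exact absurd (by simpa using List.all_eq_true.1 h.2 v (List.mem_range.2 hvn)) hv
    · simp [x, hvn]

theorem algIso_of_rows (h6 : (6 : F) ≠ 0) {c M : Combination} {rows : List LinForm}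
    (h : preserves n c M rows = true) (h' : isInvertible n rows = true) :
    AlgIso (c.toBilin F n) (M.toBilin F n) := by
  simp only [preserves, Bool.and_eq_true] at h
  obtain ⟨h1, h2⟩ := h
  have h3 : ∀ i : ℕ, ∀ p ∈ rows.getD i [], p.1 < n := by
    intro i p hp
    by_cases hi : i < rows.length
    · rw [List.getD_eq_getElem _ _ hi] at hp
      simpa using List.all_eq_true.1 (List.all_eq_true.1 h1 _ (List.getElem_mem hi)) p hp
    -- Past the end of the list the default row is the empty form, for which the bound holds
    -- vacuously.
    · rw [List.getD_eq_default _ _ (not_lt.1 hi)] at hp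
      simp at hp
  refine algIso_of_vectors _ (linearIndependent_rowVector h6 h') ?_
  have hle : ∀ i j : Fin n, i ≤ j →
      M.toBilin F n (rowVector F n (rows.getD i [])) (rowVector F n (rows.getD j [])) =
        ∑ l : Fin n, structureConstants (c.toBilin F n) i j l • rowVector F n (rows.getD l []) := by
    intro i j hij
    funext k
    have h4 := List.all_eq_true.1 h2 j (List.mem_range.2 j.2)
    have h5 := List.all_eq_true.1 h4 i (List.mem_range.2 (Nat.lt_succ_of_le hij))
    have h7 := sub_eq_zero.1 ((LinForm.isZero_iff _).1
      (List.all_eq_true.1 h5 k (List.mem_range.2 k.2)))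
    rw [toBilin_rowVector M (h3 i) (h3 j), h7, sum_map_range, Int.cast_sum, Finset.sum_apply]
    refine Finset.sum_congr rfl fun l _ => ?_
    rw [Pi.smul_apply, smul_eq_mul, structureConstants_toBilin, rowVector_apply, Int.cast_mul]
  intro i j
  -- The test covers i ≤ j only; commutativity of both products gives the rest.
  rcases le_total i j with hij | hij
  · exact hle i j hij
  · rw [toBilin_mem_symBilin M, hle j i hij]
    refine Finset.sum_congr rfl fun l _ => ?_
    rw [structureConstants_toBilin, structureConstants_toBilin, entry_comm]

end Combination

/-! ### Recognition of J_{4,5} and roots of quadratics and cubics -/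

section

variable {F : Type*} [Field F] [IsAlgClosed F]

/-- A five dimensional algebra is isomorphic to `J_{4,5}` if it has three orthogonal elements whose
squares are nonzero multiples of distinct elements `r p + q`, for some independent annihilating
elements `p` and `q`. -/
theorem algIso_J45 {μ : BilinMap F (Fin 5 → F)} (u : Fin 3 → Fin 5 → F) (c r : Fin 3 → F)
    {p q : Fin 5 → F} (hμ : μ ∈ symBilin F (Fin 5 → F)) (hlt : ∀ i j, i < j → μ (u i) (u j) = 0)
    (hsq : ∀ i, μ (u i) (u i) = c i • (r i • p + q)) (hc : ∀ i, c i ≠ 0)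
    (hr : Function.Injective r) (hpq : ∀ a b : F, a • p + b • q = 0 → a = 0 ∧ b = 0)
    (hp : ∀ x, μ x p = 0) (hq : ∀ x, μ x q = 0) :
    AlgIso μ (JJName.J45.table.toBilin F 5) := by
  refine AlgIso.symm ?_
  have hp' : ∀ x, μ p x = 0 := fun x => (hμ _ _).trans (hp x)
  have hq' : ∀ x, μ q x = 0 := fun x => (hμ _ _).trans (hq x)
  have hu : ∀ i j, i ≠ j → μ (u i) (u j) = 0 := fun i j hij =>
    hij.lt_or_gt.elim (hlt i j) fun h => (hμ _ _).trans (hlt j i h)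
  -- The scalings fit the linear relation among three vectors of a plane, (r₀ - r₂)(r₁p + q) - (r₁ -
  -- r₂)(r₀p + q) = (r₀ - r₁)(r₂p + q), which becomes e₅² = e₄ - e₂.
  obtain ⟨α, hα⟩ := IsAlgClosed.exists_pow_nat_eq ((r 1 - r 2) / c 0) two_pos
  obtain ⟨β, hβ⟩ := IsAlgClosed.exists_pow_nat_eq ((r 0 - r 2) / c 1) two_pos
  obtain ⟨γ, hγ⟩ := IsAlgClosed.exists_pow_nat_eq ((r 0 - r 1) / c 2) two_pos
  have h12 : r 1 - r 2 ≠ 0 := sub_ne_zero.2 (hr.ne (by decide))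
  have h02 : r 0 - r 2 ≠ 0 := sub_ne_zero.2 (hr.ne (by decide))
  have h01 : r 0 - r 1 ≠ 0 := sub_ne_zero.2 (hr.ne (by decide))
  have hα' : α * α * c 0 = r 1 - r 2 := by rw [← pow_two, hα, div_mul_cancel₀ _ (hc 0)]
  have hβ' : β * β * c 1 = r 0 - r 2 := by rw [← pow_two, hβ, div_mul_cancel₀ _ (hc 1)]
  have hγ' : γ * γ * c 2 = r 0 - r 1 := by rw [← pow_two, hγ, div_mul_cancel₀ _ (hc 2)]
  have h0 : α • α • μ (u 0) (u 0) = (r 1 - r 2) • (r 0 • p + q) := by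
    rw [hsq, ← hα', smul_smul, smul_smul]
  have h1 : β • β • μ (u 1) (u 1) = (r 0 - r 2) • (r 1 • p + q) := by
    rw [hsq, ← hβ', smul_smul, smul_smul]
  have h2 : γ • γ • μ (u 2) (u 2) =
      -((r 1 - r 2) • (r 0 • p + q)) + (r 0 - r 2) • (r 1 • p + q) := by
    rw [hsq, smul_smul, smul_smul, hγ']
    module
  refine algIso_of_vectors ![α • u 0, (r 1 - r 2) • (r 0 • p + q), β • u 1,
    (r 0 - r 2) • (r 1 • p + q), γ • u 2] ?_ ?_
  · have hne : ∀ s : F, s • p + q ≠ 0 := fun s h =>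
      one_ne_zero (hpq s 1 (by rw [one_smul]; exact h)).2
    have hcancel : ∀ a s b : F, b ≠ 0 → a • b • (s • p + q) = 0 → a = 0 := fun a s b hb h => by
      rw [smul_smul] at h
      exact (mul_eq_zero.1 ((smul_eq_zero.1 h).resolve_right (hne s))).resolve_right hb
    rw [Fintype.linearIndependent_iff]
    intro g hg
    simp only [Fin.sum_univ_five, Matrix.cons_val] at hg
    -- Multiplying a relation by one of the orthogonal vectors annihilates all its terms except the
    -- multiple of that vector.
    have e0 := congrArg (μ (α • u 0)) hg
    have e1 := congrArg (μ (β • u 1)) hg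
    have e2 := congrArg (μ (γ • u 2)) hg
    simp only [map_add, map_smul, hp, hq, LinearMap.smul_apply, hu 0 1 (by decide),
      hu 0 2 (by decide), hu 1 0 (by decide), hu 1 2 (by decide), hu 2 0 (by decide),
      hu 2 1 (by decide), smul_zero, add_zero, zero_add, map_zero, hsq] at e0 e1 e2
    have g0 : g 0 = 0 := by
      refine hcancel _ (r 0) _ h12 ?_
      rw [← hα', ← e0]
      module
    have g2 : g 2 = 0 := by
      refine hcancel _ (r 1) _ h02 ?_
      rw [← hβ', ← e1]
      module
    have g4 : g 4 = 0 := by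
      refine hcancel _ (r 2) _ h01 ?_
      rw [← hγ', ← e2]
      module
    rw [g0, g2, g4] at hg
    -- What is left is a relation between two vectors of the plane spanned by p and q, independent
    -- because r₀ ≠ r₁.
    obtain ⟨e3, e4⟩ := hpq (g 1 * (r 1 - r 2) * r 0 + g 3 * (r 0 - r 2) * r 1)
      (g 1 * (r 1 - r 2) + g 3 * (r 0 - r 2)) (by rw [← hg]; module)
    have g1 : g 1 = 0 := by
      have : g 1 * ((r 1 - r 2) * (r 0 - r 1)) = 0 := by linear_combination e3 - r 1 * e4
      exact (mul_eq_zero.1 this).resolve_right (mul_ne_zero h12 h01)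
    have g3 : g 3 = 0 := by
      rw [g1] at e4
      exact (mul_eq_zero.1 (by simpa using e4)).resolve_right h02
    intro i
    fin_cases i <;> assumption
  · intro i j
    simp only [Fin.sum_univ_five, Combination.structureConstants_toBilin]
    have e (i j k : Fin 5) : JJName.J45.table.entry i j k =
      (![![![0,1,0,0,0],0,0,0,0],0,![0,0,![0,0,0,1,0],0,0],0,
        ![0,0,0,0,![0,-1,0,1,0]]] : Fin 5 → Fin 5 → Fin 5 → ℤ) i j k := by
      revert i j k
      decide
    simp only [e]
    fin_cases i <;> fin_cases j <;>
      simp [h0, h1, h2, hp, hp', hq, hq', hu 0 1 (by decide), hu 0 2 (by decide), hu 1 0 (by decide),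
        hu 1 2 (by decide), hu 2 0 (by decide), hu 2 1 (by decide), -smul_add]

theorem injective_cons_cons_cons {α : Type*} {a b c : α} (hab : a ≠ b) (hac : a ≠ c) (hbc : b ≠ c) :
    Function.Injective ![a, b, c] := by
  intro i j hij
  fin_cases i <;> fin_cases j <;> simp_all [eq_comm]

theorem exists_add_eq_mul_eq (s p : F) : ∃ a b : F, a + b = s ∧ a * b = p := by
  obtain ⟨a, ha⟩ := IsAlgClosed.exists_root (Polynomial.X ^ 2 + (-Polynomial.C s * Polynomial.X +
    Polynomial.C p)) (by
      have : (Polynomial.X ^ 2 + (-Polynomial.C s * Polynomial.X + Polynomial.C p) :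
        Polynomial F).degree = 2 := by compute_degree!
      rw [this]
      decide)
  simp only [Polynomial.IsRoot, Polynomial.eval_add, Polynomial.eval_pow, Polynomial.eval_X,
    Polynomial.eval_mul, Polynomial.eval_neg, Polynomial.eval_C] at ha
  exact ⟨a, s - a, by ring, by linear_combination -ha⟩

/-- A cubic polynomial with nonzero discriminant has three distinct roots. -/
theorem exists_cubic_roots {p q : F} (h : 4 * p ^ 3 + 27 * q ^ 2 ≠ 0) :
    ∃ r : Fin 3 → F, Function.Injective r ∧ (∀ i, r i ^ 3 + p * r i + q = 0) ∧
      ∀ i j, i ≠ j → r i ^ 2 + r i * r j + r j ^ 2 = -p ∧ r i * r j * (r i + r j) = q := by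
  obtain ⟨a, ha⟩ := IsAlgClosed.exists_root (Polynomial.X ^ 3 + (Polynomial.C p * Polynomial.X +
    Polynomial.C q)) (by
      have : (Polynomial.X ^ 3 + (Polynomial.C p * Polynomial.X + Polynomial.C q) :
        Polynomial F).degree = 3 := by compute_degree!
      rw [this]
      decide)
  simp only [Polynomial.IsRoot, Polynomial.eval_add, Polynomial.eval_pow, Polynomial.eval_X,
    Polynomial.eval_mul, Polynomial.eval_C] at ha
  -- Division by X - a leaves X² + aX + a² + p, whose roots have sum -a and product a² + p.
  obtain ⟨b, c, hs, hm⟩ := exists_add_eq_mul_eq (-a) (a ^ 2 + p)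
  obtain rfl : c = -a - b := by linear_combination hs
  obtain rfl : p = -(a ^ 2 + a * b + b ^ 2) := by linear_combination -hm
  obtain rfl : q = a * b * (a + b) := by linear_combination ha
  -- The product of the differences of the roots a, b, -a - b; its square is -(4p³ + 27q²).
  have hd : (a - b) * ((2 * a + b) * (a + 2 * b)) ≠ 0 := fun h0 => h (by
    linear_combination (-((a - b) * ((2 * a + b) * (a + 2 * b)))) * h0)
  obtain ⟨h1, h2, h3⟩ : a - b ≠ 0 ∧ 2 * a + b ≠ 0 ∧ a + 2 * b ≠ 0 := by
    simpa [mul_ne_zero_iff] using hd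
  refine ⟨![a, b, -a - b], ?_, ?_, ?_⟩
  · exact injective_cons_cons_cons (sub_ne_zero.1 h1) (fun e => h2 (by linear_combination e))
      fun e => h3 (by linear_combination e)
  · intro i
    fin_cases i <;> simp <;> ring
  · intro i j hij
    fin_cases i <;> fin_cases j <;> first | exact absurd rfl hij | (constructor <;> simp <;> ring)

/-! ### Products in coordinates -/

open Combination in
theorem JJName.J35_apply {F : Type*} [Field F] (x y : Fin 5 → F) :
    JJName.J35.table.toBilin F 5 x y =
      ![0, x 0 * y 0 - x 2 * y 2, 0, 0, x 0 * y 3 + x 3 * y 0 + (x 2 * y 3 + x 3 * y 2) + x 2 * y 2] := by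
  funext k
  fin_cases k <;> simp [toBilin_apply, Fin.sum_univ_five, coeff, table] <;> ring

open Combination in
theorem JJName.J25_apply {F : Type*} [Field F] (x y : Fin 5 → F) :
    JJName.J25.table.toBilin F 5 x y =
      ![0, x 0 * y 0, 0, 0, x 0 * y 3 + x 3 * y 0 + x 2 * y 2] := by
  funext k
  fin_cases k <;> simp [toBilin_apply, Fin.sum_univ_five, coeff, table]
  ring

open Combination in
theorem JJName.J55_apply {F : Type*} [Field F] (x y : Fin 5 → F) :
    JJName.J55.table.toBilin F 5 x y =
      ![0, x 0 * y 0 - (x 2 * y 4 + x 4 * y 2), 0, x 2 * y 2 + (x 2 * y 4 + x 4 * y 2), 0] := by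
  funext k
  fin_cases k <;> simp [toBilin_apply, Fin.sum_univ_five, coeff, table] <;> ring

open Combination in
theorem JJName.J65_apply {F : Type*} [Field F] (x y : Fin 5 → F) :
    JJName.J65.table.toBilin F 5 x y =
      ![0, x 0 * y 0 + (x 0 * y 3 + x 3 * y 0), 0, 0, x 0 * y 2 + x 2 * y 0] := by
  funext k
  fin_cases k <;> simp [toBilin_apply, Fin.sum_univ_five, coeff, table]
  ring

open Combination in
theorem Combination.toBilin_e442_apply {F : Type*} [Field F] (x y : Fin 5 → F) :
    toBilin F 5 [(1, 4, 4, 2)] x y = ![0, x 3 * y 3, 0, 0, 0] := by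
  funext k
  fin_cases k <;> simp [toBilin_apply, Fin.sum_univ_five, coeff]

open Combination in
theorem Combination.toBilin_e445_apply {F : Type*} [Field F] (x y : Fin 5 → F) :
    toBilin F 5 [(1, 4, 4, 5)] x y = ![0, 0, 0, 0, x 3 * y 3] := by
  funext k
  fin_cases k <;> simp [toBilin_apply, Fin.sum_univ_five, coeff]

open Combination in
theorem Combination.toBilin_e552_apply {F : Type*} [Field F] (x y : Fin 5 → F) :
    toBilin F 5 [(1, 5, 5, 2)] x y = ![0, x 4 * y 4, 0, 0, 0] := by
  funext k
  fin_cases k <;> simp [toBilin_apply, Fin.sum_univ_five, coeff]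

open Combination in
theorem Combination.toBilin_e342_apply {F : Type*} [Field F] (x y : Fin 5 → F) :
    toBilin F 5 [(1, 3, 4, 2)] x y = ![0, x 2 * y 3 + x 3 * y 2, 0, 0, 0] := by
  funext k
  fin_cases k <;> simp [toBilin_apply, Fin.sum_univ_five, coeff]

end

/-! ### The five exceptional families -/

section

variable {F : Type*} [Field F] [IsAlgClosed F]

/-- Let A and B be the quadratic forms in x₁, x₃, x₄ given by the e₂- and e₅-components of the
product. Then det(A + rB) = -(r³ - tr + t), and u_i spans the kernel of A + r_iB. Kernel vectors for
distinct r are orthogonal for both forms, and A(u, u) = -rB(u, u), which is the shape `algIso_J45`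
asks for. The discriminant t²(4t - 27) explains the excluded value. -/
theorem algIso_J35_e442 (h2 : (2 : F) ≠ 0) {t : F} (ht : t ≠ 0)
    (ht' : t ≠ 27 / 4) : AlgIso (JJName.J35.table.toBilin F 5 +
      t • Combination.toBilin F 5 [(1, 4, 4, 2)]) (JJName.J45.table.toBilin F 5) := by
  have h4 : (4 : F) ≠ 0 := by
    rw [show (4 : F) = 2 * 2 by norm_num]
    exact mul_ne_zero h2 h2
  have hd : 4 * (-t) ^ 3 + 27 * t ^ 2 ≠ 0 := by
    intro h
    have h5 : t * t * (27 - 4 * t) = 0 := by linear_combination h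
    refine ht' ((eq_div_iff h4).2 ?_)
    linear_combination -((mul_eq_zero.1 h5).resolve_left (mul_ne_zero ht ht))
  obtain ⟨r, hr, hroot, hpair⟩ := exists_cubic_roots hd
  refine algIso_J45 (fun i => ![r i * (r i - 1), 0, r i, 1 - r i, 0])
    (fun i => r i ^ 2 * (3 - 2 * r i)) r (p := ![0, -1, 0, 0, 0]) (q := ![0, 0, 0, 0, 1])
    (add_mem (Combination.toBilin_mem_symBilin _)
      (Submodule.smul_mem _ _ (Combination.toBilin_mem_symBilin _))) ?_ ?_ ?_ hr ?_ ?_ ?_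
  · intro i j hij
    obtain ⟨e1, e2⟩ := hpair i j hij.ne
    funext k
    simp only [LinearMap.add_apply, LinearMap.smul_apply, JJName.J35_apply,
      Combination.toBilin_e442_apply]
    fin_cases k <;> simp
    · linear_combination -(r i * r j) * e1 + (r i + r j - 1) * e2
    · linear_combination e1 - e2
  · intro i
    have e := hroot i
    funext k
    simp only [LinearMap.add_apply, LinearMap.smul_apply, JJName.J35_apply,
      Combination.toBilin_e442_apply]
    fin_cases k <;> simp
    · linear_combination (1 - r i) * e
    · ring
  · intro i
    have e := hroot i
    -- Inserted into the cubic, r = 0 gives t = 0, and 2r = 3 gives t = 27/4.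
    refine mul_ne_zero (pow_ne_zero _ fun h0 => ht ?_) fun h0 => ht' ((eq_div_iff h4).2 ?_)
    · rw [h0] at e
      linear_combination e
    · linear_combination (-8) * e + (4 * t - (4 * r i ^ 2 + 6 * r i + 9)) * h0
  · intro a b hab
    have e1 := congrFun hab 1
    have e2 := congrFun hab 4
    simp at e1 e2
    exact ⟨e1, e2⟩
  all_goals
    intro x
    funext k
    simp only [LinearMap.add_apply, LinearMap.smul_apply, JJName.J35_apply,
      Combination.toBilin_e442_apply]
    fin_cases k <;> simp

/-- The same pencil argument, now with det(A + rB) = -(r³ + t²) and kernel vectors (r², t, -r). Its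
roots are distinct for every nonzero t since 3 is invertible. -/
theorem algIso_J25_e342 (h3 : (3 : F) ≠ 0) {t : F} (ht : t ≠ 0) :
    AlgIso (JJName.J25.table.toBilin F 5 + t • Combination.toBilin F 5 [(1, 3, 4, 2)])
      (JJName.J45.table.toBilin F 5) := by
  have hd : 4 * (0 : F) ^ 3 + 27 * (t ^ 2) ^ 2 ≠ 0 := by
    rw [show 4 * (0 : F) ^ 3 + 27 * (t ^ 2) ^ 2 = 3 ^ 3 * t ^ 4 by ring]
    exact mul_ne_zero (pow_ne_zero _ h3) (pow_ne_zero _ ht)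
  obtain ⟨r, hr, hroot, hpair⟩ := exists_cubic_roots hd
  refine algIso_J45 (fun i => ![r i ^ 2, 0, t, -r i, 0])
    (fun i => 3 * t ^ 2) r (p := ![0, -1, 0, 0, 0]) (q := ![0, 0, 0, 0, 1])
    (add_mem (Combination.toBilin_mem_symBilin _)
      (Submodule.smul_mem _ _ (Combination.toBilin_mem_symBilin _))) ?_ ?_ ?_ hr ?_ ?_ ?_
  · intro i j hij
    obtain ⟨e1, e2⟩ := hpair i j hij.ne
    funext k
    simp only [LinearMap.add_apply, LinearMap.smul_apply, JJName.J25_apply,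
      Combination.toBilin_e342_apply]
    fin_cases k <;> simp
    · linear_combination -(r i * r j) * e1 + (r i + r j) * e2
    · linear_combination -e2
  · intro i
    have e := hroot i
    funext k
    simp only [LinearMap.add_apply, LinearMap.smul_apply, JJName.J25_apply,
      Combination.toBilin_e342_apply]
    fin_cases k <;> simp
    · linear_combination r i * e
    · linear_combination -2 * e
  · exact fun i => mul_ne_zero h3 (pow_ne_zero _ ht)
  · intro a b hab
    have e1 := congrFun hab 1
    have e2 := congrFun hab 4
    simp at e1 e2
    exact ⟨e1, e2⟩
  all_goals
    intro x
    funext k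
    simp only [LinearMap.add_apply, LinearMap.smul_apply, JJName.J25_apply,
      Combination.toBilin_e342_apply]
    fin_cases k <;> simp

/-- Here det(A + rB) = -r(r² - tr + t). The root 0 has kernel vector e₄, and the roots a, b of the
quadratic factor coincide when t = 4. -/
theorem algIso_J35_e445 {t : F} (ht : t ≠ 0) (ht' : t ≠ 4) :
    AlgIso (JJName.J35.table.toBilin F 5 + t • Combination.toBilin F 5 [(1, 4, 4, 5)])
      (JJName.J45.table.toBilin F 5) := by
  obtain ⟨a, b, hs, hp⟩ := exists_add_eq_mul_eq t t
  have ha : a ≠ 0 := fun h => ht (by rw [← hp, h, zero_mul])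
  have hb : b ≠ 0 := fun h => ht (by rw [← hp, h, mul_zero])
  have ea : a ^ 2 - t * a + t = 0 := by linear_combination a * hs - hp
  have eb : b ^ 2 - t * b + t = 0 := by linear_combination b * hs - hp
  have hab : a ≠ b := by
    rintro rfl
    have h1 : a * (a - 2) = 0 := by linear_combination hp - hs
    have h2 := (mul_eq_zero.1 h1).resolve_left ha
    exact ht' (by linear_combination 2 * h2 - hs)
  -- The squares of the kernel vectors contain the factor 2 - m, and m = 2 would give t = 4.
  have hne2 : ∀ m : F, m ^ 2 - t * m + t = 0 → 2 - m ≠ 0 := fun m hm h => ht' (by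
    linear_combination (t - m - 2) * h - hm)
  refine algIso_J45 ![![0, 0, 0, 1, 0], ![a * (a - 1), 0, a, 1 - a, 0],
    ![b * (b - 1), 0, b, 1 - b, 0]] ![t, a ^ 2 * (2 - a), b ^ 2 * (2 - b)] ![0, a, b]
    (p := ![0, -1, 0, 0, 0]) (q := ![0, 0, 0, 0, 1]) (add_mem (Combination.toBilin_mem_symBilin _)
      (Submodule.smul_mem _ _ (Combination.toBilin_mem_symBilin _))) ?_ ?_ ?_ ?_ ?_ ?_ ?_
  · intro i j hij
    funext k
    simp only [LinearMap.add_apply, LinearMap.smul_apply, JJName.J35_apply,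
      Combination.toBilin_e445_apply]
    fin_cases i <;> fin_cases j <;> first | exact absurd hij (by decide) | skip
    all_goals fin_cases k <;> simp
    · linear_combination ea
    · linear_combination eb
    · linear_combination a * b * (hp - hs)
    · linear_combination (a + b - t) * (hs - hp) - hp
  · intro i
    funext k
    simp only [LinearMap.add_apply, LinearMap.smul_apply, JJName.J35_apply,
      Combination.toBilin_e445_apply]
    fin_cases i <;> fin_cases k <;> simp
    · ring
    · linear_combination (1 - a) * ea
    · ring
    · linear_combination (1 - b) * eb
  · intro i
    fin_cases i
    · exact ht
    · exact mul_ne_zero (pow_ne_zero _ ha) (hne2 a ea)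
    · exact mul_ne_zero (pow_ne_zero _ hb) (hne2 b eb)
  · exact injective_cons_cons_cons ha.symm hb.symm hab
  · intro a b hab
    have e1 := congrFun hab 1
    have e2 := congrFun hab 4
    simp at e1 e2
    exact ⟨e1, e2⟩
  all_goals
    intro x
    funext k
    simp only [LinearMap.add_apply, LinearMap.smul_apply, JJName.J35_apply,
      Combination.toBilin_e445_apply]
    fin_cases k <;> simp

/-- With A and B the e₂- and e₄-components in x₁, x₃, x₅, one has det(B + rA) = -r(r² - (2 + t)r +
1). The root 0 belongs to e₁; the other two differ because (a - b)² = t(t + 4). -/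
theorem algIso_J55_e552 {t : F} (ht : t ≠ 0) (ht' : t ≠ -4) :
    AlgIso (JJName.J55.table.toBilin F 5 + t • Combination.toBilin F 5 [(1, 5, 5, 2)])
      (JJName.J45.table.toBilin F 5) := by
  obtain ⟨a, b, hs, hp⟩ := exists_add_eq_mul_eq (2 + t) (1 : F)
  have ha : a ≠ 0 := left_ne_zero_of_mul_eq_one hp
  have hb : b ≠ 0 := right_ne_zero_of_mul_eq_one hp
  have hd : (a - b) * (a - b) ≠ 0 := fun h => by
    have h1 : t * (t + 4) = 0 := by linear_combination h - (a + b + 2 + t) * hs + 4 * hp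
    exact ht' (eq_neg_of_add_eq_zero_left ((mul_eq_zero.1 h1).resolve_left ht))
  have hab : a - b ≠ 0 := left_ne_zero_of_mul hd
  refine algIso_J45 ![![1, 0, 0, 0, 0], ![0, 0, 1 - a, 0, -1], ![0, 0, 1 - b, 0, -1]]
    ![1, 2 + t - 2 * a, 2 + t - 2 * b] ![0, a, b]
    (p := ![0, 0, 0, -1, 0]) (q := ![0, 1, 0, 0, 0]) (add_mem (Combination.toBilin_mem_symBilin _)
      (Submodule.smul_mem _ _ (Combination.toBilin_mem_symBilin _))) ?_ ?_ ?_ ?_ ?_ ?_ ?_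
  · intro i j hij
    funext k
    simp only [LinearMap.add_apply, LinearMap.smul_apply, JJName.J55_apply,
      Combination.toBilin_e552_apply]
    fin_cases i <;> fin_cases j <;> first | exact absurd hij (by decide) | skip
    all_goals fin_cases k <;> simp
    · linear_combination -hs
    · linear_combination hp
  · intro i
    funext k
    simp only [LinearMap.add_apply, LinearMap.smul_apply, JJName.J55_apply,
      Combination.toBilin_e552_apply]
    fin_cases i <;> fin_cases k <;> simp
    · ring
    · linear_combination hp - a * hs
    · ring
    · linear_combination hp - b * hs
  · intro i
    fin_cases i
    · exact one_ne_zero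
    · exact fun h : 2 + t - 2 * a = 0 => hab (by linear_combination -h - hs)
    · exact fun h : 2 + t - 2 * b = 0 => hab (by linear_combination h + hs)
  · exact injective_cons_cons_cons ha.symm hb.symm (sub_ne_zero.1 hab)
  · intro a b hab
    have e1 := congrFun hab 1
    have e2 := congrFun hab 3
    simp at e1 e2
    exact ⟨e2, e1⟩
  all_goals
    intro x
    funext k
    simp only [LinearMap.add_apply, LinearMap.smul_apply, JJName.J55_apply,
      Combination.toBilin_e552_apply]
    fin_cases k <;> simp

/-- The pencil of the e₂- and e₅-components, A + rB, has determinant -tr², with a double root for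
all t ≠ 0, so `algIso_J45` does not apply and a basis is written down. At t = 1 the e₂-component
drops to the square of x₁ + x₄. -/
theorem algIso_J65_e442 (h2 : (2 : F) ≠ 0) {t : F} (ht : t ≠ 0) (ht' : t ≠ 1) :
    AlgIso (JJName.J65.table.toBilin F 5 + t • Combination.toBilin F 5 [(1, 4, 4, 2)])
      (JJName.J55.table.toBilin F 5) := by
  refine AlgIso.symm ?_
  obtain ⟨α, hα⟩ := IsAlgClosed.exists_pow_nat_eq ((t - 1) / t ^ 2) two_pos
  have h1 : t - 1 ≠ 0 := sub_ne_zero.2 ht'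
  have hα' : t * (α * α) = (t - 1) / t := by
    rw [← pow_two, hα]
    field_simp
  have hα0 : α ≠ 0 := by
    rintro rfl
    rw [mul_zero, mul_zero] at hα'
    exact div_ne_zero h1 ht hα'.symm
  -- The entry -1/t makes the third vector orthogonal to e₄. Its square has e₂-component (t - 1)/t,
  -- and α is chosen so that the first vector squares to this multiple of e₂.
  refine algIso_of_vectors ![![0, 0, 0, α, 0], ![0, (t - 1) / t, 0, 0, 0], ![1, 0, 1, -t⁻¹, 0],
    ![0, (t - 1) / t, 0, 0, 2], ![0, 0, 2, 0, 0]] ?_ fun i j => ?_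
  · rw [Fintype.linearIndependent_iff]
    intro g hg
    have e0 := congrFun hg 0
    have e1 := congrFun hg 1
    have e2 := congrFun hg 2
    have e3 := congrFun hg 3
    have e4 := congrFun hg 4
    simp [Fin.sum_univ_five, h2] at e0 e4
    simp [Fin.sum_univ_five, h2, e0, e4, hα0, h1, ht] at e1 e2 e3
    intro i
    fin_cases i <;> assumption
  · have e (i j k : Fin 5) : JJName.J55.table.entry i j k =
      (![![![0,1,0,0,0],0,0,0,0],0,![0,0,![0,0,0,1,0],0,![0,-1,0,1,0]],0,
        ![0,0,![0,-1,0,1,0],0,0]] : Fin 5 → Fin 5 → Fin 5 → ℤ) i j k := by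
      revert i j k
      decide
    simp only [Fin.sum_univ_five, Combination.structureConstants_toBilin, e]
    simp only [LinearMap.add_apply, LinearMap.smul_apply, JJName.J65_apply,
      Combination.toBilin_e442_apply]
    funext k
    fin_cases i <;> fin_cases j <;> fin_cases k <;> simp [hα']
    all_goals field_simp
    all_goals ring

end

/-! ### Explicit data for jumps and obstructions -/

set_option maxRecDepth 10000

/-- A cocycle `b` together with an isomorphism from the generic member of the family that it defines
to the algebra `target`. Powers of a parameter with the exponents `weights` rescale the basis and
turn the family, of degree `degree` in the parameter, into the sum of the multiplication and
`sign * b`. The rows are the images, in the latter algebra, of the basis vectors of (a rescaled form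
of) the target. -/
structure JumpDatum where
  /-- The cocycle. -/
  cocycle : Combination
  /-- The sign with which it appears after rescaling. -/
  sign : ℤ
  /-- The power of the scaling parameter that it is multiplied by. -/
  degree : ℕ
  /-- The weights of the basis vectors. -/
  weights : List ℕ
  /-- The basis that has the multiplication table of the target. -/
  rows : List LinForm
  /-- Whether the rows give the rescaled form of the target. -/
  rescaled : Bool
  /-- The name of the target. -/
  target : JJName

namespace JJName

/-- A multiplication table of the algebra; for `J_{1,2} ⊕ J_{1,3}` and `J_{5,5}` there is a second one,
in which basis vectors are rescaled by a square root of `-1`. -/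
def form : JJName → Bool → Combination
  | .J12_J13, true => [(1, 1, 1, 2), (1, 3, 3, 4), (-1, 5, 5, 4)]
  | .J55, true => [(1, 1, 1, 2), (-1, 3, 3, 4), (1, 3, 5, 2), (-1, 3, 5, 4)]
  | X, _ => X.table

/-- Explicit isomorphisms for the generic members of the families given by cocycles. -/
def jumpData : JJName → List JumpDatum
  | .J12_F =>
    [ ⟨[(1, 3, 3, 2)], 1, 2, [0, 0, 1],
       [[(0, 1)], [(1, 1)], [(2, 1)]], false, .J13⟩ ]
  | .J12_F2 =>
    [ ⟨[(1, 1, 3, 4)], 1, 1, [0, 0, 1, 0],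
       [[(0, 1)], [(1, 1)], [(2, 1)], [(3, 1)]], false, .J14⟩,
      ⟨[(1, 1, 4, 3)], 1, 1, [0, 0, 0, 1],
       [[(0, 1)], [(1, 1)], [(3, 1)], [(2, 1)]], false, .J14⟩,
      ⟨[(1, 3, 3, 2)], 1, 2, [0, 0, 1, 0],
       [[(0, 1)], [(1, 1)], [(2, 1)], [(3, 1)]], false, .J13_F⟩,
      ⟨[(1, 3, 3, 4)], 1, 1, [0, 0, 1, 1],
       [[(0, 1)], [(1, 1)], [(2, 1)], [(3, 1)]], false, .J12_J12⟩,
      ⟨[(1, 3, 4, 2)], 1, 1, [0, 0, 0, 1],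
       [[(0, 1)], [(1, 1)], [(2, 1)], [(3, 1)]], false, .J24⟩,
      ⟨[(1, 4, 4, 2)], 1, 2, [0, 0, 0, 1],
       [[(0, 1)], [(1, 1)], [(3, 1)], [(2, 1)]], false, .J13_F⟩,
      ⟨[(1, 4, 4, 3)], 1, 1, [0, 0, 1, 1],
       [[(0, 1)], [(1, 1)], [(3, 1)], [(2, 1)]], false, .J12_J12⟩ ]
  | .J13_F =>
    [ ⟨[(1, 1, 1, 4)], 1, 1, [1, 2, 1, 1],
       [[(0, 1)], [(1, 1), (3, 1)], [(2, 1)], [(1, 1)]], false, .J12_J12⟩,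
      ⟨[(1, 1, 3, 4)], 1, 1, [1, 2, 1, 1],
       [[(0, 1), (2, 1)], [(1, 2), (3, 2)], [(0, 1), (2, -1)], [(1, 2), (3, -2)]], false, .J12_J12⟩,
      ⟨[(1, 4, 4, 2)], -1, 2, [0, 0, 0, 1],
       [[(0, 2)], [(1, 4)], [(2, 2), (3, 2)], [(2, 1), (3, -1)]], false, .J24⟩ ]
  | .J14 =>
    [ ⟨[(1, 3, 3, 2)], 1, 2, [0, 0, 1, 1],
       [[(0, 1), (2, 1)], [(1, 2), (3, 2)], [(0, 1), (2, -1)], [(1, 2), (3, -2)]], false, .J12_J12⟩ ]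
  | .J12_F3 =>
    [ ⟨[(1, 1, 3, 4)], 1, 1, [0, 0, 1, 0, 0],
       [[(0, 1)], [(1, 1)], [(2, 1)], [(3, 1)], [(4, 1)]], false, .J14_F⟩,
      ⟨[(1, 1, 3, 5)], 1, 1, [0, 0, 1, 0, 0],
       [[(0, 1)], [(1, 1)], [(2, 1)], [(4, 1)], [(3, 1)]], false, .J14_F⟩,
      ⟨[(1, 1, 4, 3)], 1, 1, [0, 0, 0, 1, 0],
       [[(0, 1)], [(1, 1)], [(3, 1)], [(2, 1)], [(4, 1)]], false, .J14_F⟩,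
      ⟨[(1, 1, 4, 5)], 1, 1, [0, 0, 0, 1, 0],
       [[(0, 1)], [(1, 1)], [(3, 1)], [(4, 1)], [(2, 1)]], false, .J14_F⟩,
      ⟨[(1, 1, 5, 3)], 1, 1, [0, 0, 0, 0, 1],
       [[(0, 1)], [(1, 1)], [(4, 1)], [(2, 1)], [(3, 1)]], false, .J14_F⟩,
      ⟨[(1, 1, 5, 4)], 1, 1, [0, 0, 0, 0, 1],
       [[(0, 1)], [(1, 1)], [(4, 1)], [(3, 1)], [(2, 1)]], false, .J14_F⟩,
      ⟨[(1, 3, 3, 2)], 1, 2, [0, 0, 1, 0, 0],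
       [[(0, 1)], [(1, 1)], [(2, 1)], [(3, 1)], [(4, 1)]], false, .J13_F2⟩,
      ⟨[(1, 3, 3, 4)], 1, 1, [0, 0, 1, 1, 0],
       [[(0, 1)], [(1, 1)], [(2, 1)], [(3, 1)], [(4, 1)]], false, .J12_J12_F⟩,
      ⟨[(1, 3, 3, 5)], 1, 1, [0, 0, 1, 0, 1],
       [[(0, 1)], [(1, 1)], [(2, 1)], [(4, 1)], [(3, 1)]], false, .J12_J12_F⟩,
      ⟨[(1, 3, 4, 2)], 1, 1, [0, 0, 0, 1, 0],
       [[(0, 1)], [(1, 1)], [(2, 1)], [(3, 1)], [(4, 1)]], false, .J24_F⟩,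
      ⟨[(1, 3, 4, 5)], 1, 1, [0, 0, 0, 1, 0],
       [[(0, 1)], [(1, 1)], [(2, 1), (3, 1)], [(4, 2)], [(2, 1), (3, -1)]], true, .J12_J13⟩,
      ⟨[(1, 3, 5, 2)], 1, 1, [0, 0, 0, 0, 1],
       [[(0, 1)], [(1, 1)], [(2, 1)], [(4, 1)], [(3, 1)]], false, .J24_F⟩,
      ⟨[(1, 3, 5, 4)], 1, 1, [0, 0, 0, 0, 1],
       [[(0, 1)], [(1, 1)], [(2, 1), (4, 1)], [(3, 2)], [(2, 1), (4, -1)]], true, .J12_J13⟩,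
      ⟨[(1, 4, 4, 2)], 1, 2, [0, 0, 0, 1, 0],
       [[(0, 1)], [(1, 1)], [(3, 1)], [(2, 1)], [(4, 1)]], false, .J13_F2⟩,
      ⟨[(1, 4, 4, 3)], 1, 1, [0, 0, 1, 1, 0],
       [[(0, 1)], [(1, 1)], [(3, 1)], [(2, 1)], [(4, 1)]], false, .J12_J12_F⟩,
      ⟨[(1, 4, 4, 5)], 1, 1, [0, 0, 0, 1, 1],
       [[(0, 1)], [(1, 1)], [(3, 1)], [(4, 1)], [(2, 1)]], false, .J12_J12_F⟩,
      ⟨[(1, 4, 5, 2)], 1, 1, [0, 0, 0, 0, 1],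
       [[(0, 1)], [(1, 1)], [(3, 1)], [(4, 1)], [(2, 1)]], false, .J24_F⟩,
      ⟨[(1, 4, 5, 3)], 1, 1, [0, 0, 0, 0, 1],
       [[(0, 1)], [(1, 1)], [(3, 1), (4, 1)], [(2, 2)], [(3, 1), (4, -1)]], true, .J12_J13⟩,
      ⟨[(1, 5, 5, 2)], 1, 2, [0, 0, 0, 0, 1],
       [[(0, 1)], [(1, 1)], [(4, 1)], [(2, 1)], [(3, 1)]], false, .J13_F2⟩,
      ⟨[(1, 5, 5, 3)], 1, 1, [0, 0, 1, 0, 1],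
       [[(0, 1)], [(1, 1)], [(4, 1)], [(2, 1)], [(3, 1)]], false, .J12_J12_F⟩,
      ⟨[(1, 5, 5, 4)], 1, 1, [0, 0, 0, 1, 1],
       [[(0, 1)], [(1, 1)], [(4, 1)], [(3, 1)], [(2, 1)]], false, .J12_J12_F⟩ ]
  | .J13_F2 =>
    [ ⟨[(1, 1, 1, 4)], 1, 1, [1, 2, 1, 1, 0],
       [[(0, 1)], [(1, 1), (3, 1)], [(2, 1)], [(1, 1)], [(4, 1)]], false, .J12_J12_F⟩,
      ⟨[(1, 1, 1, 5)], 1, 1, [1, 2, 1, 0, 1],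
       [[(0, 1)], [(1, 1), (4, 1)], [(2, 1)], [(1, 1)], [(3, 1)]], false, .J12_J12_F⟩,
      ⟨[(1, 1, 3, 4)], 1, 1, [1, 2, 1, 1, 0],
       [[(0, 1), (2, 1)], [(1, 2), (3, 2)], [(0, 1), (2, -1)], [(1, 2), (3, -2)], [(4, 1)]], false, .J12_J12_F⟩,
      ⟨[(1, 1, 3, 5)], 1, 1, [1, 2, 1, 0, 1],
       [[(0, 1), (2, 1)], [(1, 2), (4, 2)], [(0, 1), (2, -1)], [(1, 2), (4, -2)], [(3, 1)]], false, .J12_J12_F⟩,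
      ⟨[(1, 1, 4, 5)], 1, 1, [0, 0, 0, 1, 0],
       [[(2, 1)], [(1, 1)], [(0, 1), (3, 1)], [(1, 1), (4, 2)], [(3, 2)]], false, .J55⟩,
      ⟨[(1, 1, 5, 4)], 1, 1, [0, 0, 0, 0, 1],
       [[(2, 1)], [(1, 1)], [(0, 1), (4, 1)], [(1, 1), (3, 2)], [(4, 2)]], false, .J55⟩,
      ⟨[(1, 3, 4, 5)], 1, 1, [0, 0, 0, 1, 0],
       [[(0, 1)], [(1, 1)], [(2, 1), (3, 1)], [(1, 1), (4, 2)], [(3, 2)]], false, .J55⟩,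
      ⟨[(1, 3, 5, 4)], 1, 1, [0, 0, 0, 0, 1],
       [[(0, 1)], [(1, 1)], [(2, 1), (4, 1)], [(1, 1), (3, 2)], [(4, 2)]], false, .J55⟩,
      ⟨[(1, 4, 4, 2)], -1, 2, [0, 0, 0, 1, 0],
       [[(0, 2)], [(1, 4)], [(2, 2), (3, 2)], [(2, 1), (3, -1)], [(4, 1)]], false, .J24_F⟩,
      ⟨[(1, 5, 5, 2)], -1, 2, [0, 0, 0, 0, 1],
       [[(0, 2)], [(1, 4)], [(2, 2), (4, 2)], [(2, 1), (4, -1)], [(3, 1)]], false, .J24_F⟩,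
      ⟨[(1, 4, 4, 5)], 1, 1, [0, 0, 0, 1, 1],
       [[(3, 1)], [(4, 1)], [(0, 1)], [(1, 1)], [(2, 1)]], false, .J12_J13⟩,
      ⟨[(1, 5, 5, 4)], 1, 1, [0, 0, 0, 1, 1],
       [[(4, 1)], [(3, 1)], [(0, 1)], [(1, 1)], [(2, 1)]], false, .J12_J13⟩,
      ⟨[(1, 4, 5, 2)], 1, 1, [0, 0, 0, 0, 1],
       [[(0, 1)], [(1, 1)], [(2, 1)], [(3, 1)], [(4, 1)]], false, .J75⟩ ]
  | .J12_J12_F =>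
    [ ⟨[(1, 1, 3, 5)], 1, 1, [0, 0, 1, 2, 0],
       [[(0, 1)], [(1, 1)], [(2, 1)], [(3, 1)], [(4, 1)]], false, .J15⟩,
      ⟨[(1, 1, 5, 4)], 1, 1, [0, 0, 0, 0, 1],
       [[(0, 1)], [(1, 1)], [(2, 1)], [(4, 1)], [(3, 1)]], false, .J25⟩,
      ⟨[(1, 3, 5, 2)], 1, 1, [0, 0, 0, 0, 1],
       [[(2, 1)], [(3, 1)], [(0, 1)], [(4, 1)], [(1, 1)]], false, .J25⟩,
      ⟨[(1, 5, 5, 2)], 1, 2, [0, 0, 0, 0, 1],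
       [[(2, 1)], [(3, 1)], [(0, 1)], [(1, 1)], [(4, 1)]], false, .J12_J13⟩,
      ⟨[(1, 5, 5, 4)], 1, 2, [0, 0, 0, 0, 1],
       [[(0, 1)], [(1, 1)], [(2, 1)], [(3, 1)], [(4, 1)]], false, .J12_J13⟩ ]
  | .J14_F =>
    [ ⟨[(1, 1, 4, 5), (-2, 2, 3, 5)], 1, 1, [0, 0, 1, 1, 0],
       [[(0, 1)], [(1, 1)], [(4, -1)], [(2, 1)], [(3, 1)]], false, .J85⟩,
      ⟨[(1, 1, 5, 3), (-2, 2, 5, 4)], 1, 1, [0, 0, 0, 0, 1],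
       [[(0, 1)], [(1, 1)], [(3, -1)], [(4, 1)], [(2, 1)]], false, .J85⟩,
      ⟨[(1, 1, 5, 2)], 1, 1, [0, 0, 0, 0, 1],
       [[(0, 1)], [(1, 1)], [(2, 1)], [(4, 1)], [(3, 1)]], false, .J65⟩,
      ⟨[(1, 3, 3, 2)], 1, 2, [0, 0, 1, 1, 0],
       [[(0, 1), (2, 1)], [(1, 2), (3, 2)], [(0, 1), (2, -1)], [(1, 2), (3, -2)], [(4, 1)]], false, .J12_J12_F⟩,
      ⟨[(1, 3, 3, 5)], 1, 1, [0, 0, 1, 1, 1],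
       [[(0, 1)], [(1, 1)], [(2, 1)], [(4, 1)], [(3, 1)]], false, .J15⟩,
      ⟨[(1, 3, 5, 2)], 1, 1, [0, 0, 0, 0, 1],
       [[(0, 2), (2, 2), (4, 1)], [(1, 8), (3, 8)], [(0, -2), (2, 2), (4, 1)], [(4, 8)], [(1, 16)]], false, .J35⟩,
      ⟨[(1, 5, 5, 2)], 1, 2, [0, 0, 0, 0, 1],
       [[(4, 1)], [(1, 1)], [(0, 1), (2, 1)], [(1, 1), (3, 2)], [(2, 2)]], false, .J55⟩,
      ⟨[(1, 5, 5, 4)], 1, 1, [0, 0, 1, 1, 1],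
       [[(0, 1)], [(1, 1)], [(4, 1)], [(2, 1)], [(3, 1)]], false, .J25⟩ ]
  | .J24_F =>
    [ ⟨[(1, 1, 1, 5)], 1, 1, [1, 2, 0, 2, 1],
       [[(0, 1)], [(1, 1), (4, 1)], [(2, 1), (3, 1)], [(1, 2)], [(2, 1), (3, -1)]], true, .J12_J13⟩,
      ⟨[(1, 1, 3, 5)], 1, 1, [1, 2, 0, 2, 0],
       [[(0, 2), (2, 2), (3, 1)], [(1, 8), (4, 8)], [(0, -2), (2, 2), (3, 1)], [(3, 8)], [(1, 16)]], false, .J35⟩,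
      ⟨[(1, 1, 4, 5)], 1, 1, [1, 2, 2, 0, 0],
       [[(0, 2), (2, 1), (3, 2)], [(1, 8), (4, 8)], [(0, -2), (2, 1), (3, 2)], [(2, 8)], [(1, 16)]], false, .J35⟩,
      ⟨[(1, 3, 3, 5)], 1, 1, [1, 2, 1, 1, 1],
       [[(2, 1)], [(4, 1)], [(0, 1)], [(3, 1)], [(1, 1)]], false, .J25⟩,
      ⟨[(1, 4, 4, 5)], 1, 1, [1, 2, 1, 1, 1],
       [[(3, 1)], [(4, 1)], [(0, 1)], [(2, 1)], [(1, 1)]], false, .J25⟩,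
      ⟨[(1, 5, 5, 2)], 1, 2, [0, 0, 0, 0, 1],
       [[(0, 1)], [(1, 1)], [(4, 1)], [(2, 1)], [(3, 1)]], false, .J75⟩ ]
  | .J12_J13 =>
    [ ⟨[(1, 3, 3, 2)], 1, 2, [0, 0, 1, 2, 1],
       [[(0, 1)], [(1, 1)], [(2, 1)], [(1, 1), (3, 1)], [(4, 1)]], false, .J45⟩,
      ⟨[(1, 3, 5, 2)], 1, 2, [0, 0, 1, 2, 1],
       [[(0, 2)], [(1, 4)], [(2, 1), (4, 1)], [(1, 2), (3, 2)], [(2, 1), (4, -1)]], false, .J45⟩ ]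
  | .J15 =>
    [ ⟨[(1, 3, 5, 2), (-2, 1, 4, 2)], 1, 1, [1, 2, 1, 2, 2],
       [[(2, 1)], [(3, 1)], [(1, -4)], [(0, 4), (3, 1)], [(4, 4)]], false, .J85⟩,
      ⟨[(1, 1, 5, 4), (-2, 2, 3, 4)], 1, 1, [1, 2, 1, 2, 2],
       [[(0, 1)], [(1, 1)], [(3, -4)], [(1, 1), (2, 4)], [(4, 4)]], false, .J85⟩ ]
  | .J25 =>
    [ ⟨[(1, 1, 3, 4), (-2, 2, 3, 5)], 1, 1, [1, 2, 1, 1, 2],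
       [[(0, 1)], [(1, 1)], [(4, -4)], [(1, 1), (2, 4)], [(3, 4)]], false, .J85⟩,
      ⟨[(1, 1, 4, 2)], -1, 2, [0, 0, 1, 2, 2],
       [[(2, 2)], [(4, 4)], [(0, 2), (3, 2)], [(1, -4), (4, 8)], [(3, 2)]], false, .J55⟩,
      ⟨[(1, 4, 4, 2)], 1, 4, [0, 0, 1, 2, 2],
       [[(2, 2)], [(4, 4)], [(0, 1), (3, 1)], [(1, 2), (4, 2)], [(0, 1), (3, -1)]], false, .J45⟩ ]
  | .J35 =>
    [ ⟨[(1, 1, 3, 4), (-2, 2, 3, 5), (-2, 3, 3, 4)], 1, 1, [1, 2, 1, 1, 2],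
       [[(0, 1)], [(1, 1)], [(4, -4)], [(0, 4), (1, 1), (2, 4)], [(1, 4), (3, 4)]], false, .J85⟩ ]
  | .J55 =>
    [  ]
  | .J65 =>
    [ ⟨[(1, 1, 4, 3), (-2, 2, 4, 5), (4, 4, 4, 3)], 1, 1, [1, 2, 1, 1, 2],
       [[(0, 1)], [(1, 1)], [(4, 1)], [(0, 2), (3, -1)], [(1, 1), (2, -1)]], false, .J85⟩,
      ⟨[(1, 3, 5, 2), (-2, 3, 3, 4)], 1, 1, [1, 2, 1, 1, 2],
       [[(2, 1)], [(3, -2)], [(1, -2)], [(0, 2), (3, -1)], [(4, 2)]], false, .J85⟩,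
      ⟨[(1, 3, 3, 2)], 1, 2, [0, 0, 1, 0, 1],
       [[(0, 2), (2, 2)], [(1, 8), (4, 8)], [(0, 2), (2, -2)], [(3, 8)], [(1, 16)]], false, .J35⟩,
      ⟨[(1, 3, 3, 5)], 1, 1, [0, 0, 1, 0, 1],
       [[(2, 2)], [(4, 4)], [(0, 2), (2, -2)], [(1, -4), (4, 4)], [(3, 2)]], true, .J55⟩,
      ⟨[(1, 4, 4, 5)], 1, 1, [1, 2, 0, 1, 1],
       [[(0, 1)], [(1, 1)], [(0, 1), (3, -1)], [(2, 1)], [(4, 1)]], false, .J35⟩ ]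
  | _ => []

/-- The cocycles for which the generic member of the family is treated separately, and the names
of the targets. -/
def exceptionalJumps : JJName → List (Combination × JJName)
  | .J25 => [([(1, 3, 4, 2)], .J45)]
  | .J35 => [([(1, 4, 4, 2)], .J45), ([(1, 4, 4, 5)], .J45)]
  | .J55 => [([(1, 5, 5, 2)], .J45)]
  | .J65 => [([(1, 4, 4, 2)], .J55)]
  | _ => []

/-- All cocycles that define jump deformations, with the names of the targets. -/
def jumps (X : JJName) : List (Combination × JJName) :=
  (X.jumpData.map fun J => (J.cocycle, J.target)) ++ X.exceptionalJumps

/-- The test for a path of at most the given length in the diagrams. -/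
def reaches : ℕ → JJName → JJName → Bool
  | 0, _, _ => false
  | k + 1, X, Y => X.arrows.any fun Z => Z.ctorIdx.beq Y.ctorIdx || reaches k Z Y

/-- Order two obstructions to the extension of cocycles. -/
def obstructions : JJName → List (List (ℤ × ℕ × ℕ × ℕ × ℕ))
  | .J13_F => [[(1, 0, 3, 3, 0)]]
  | .J24 => [[(1, 2, 2, 2, 3)], [(1, 3, 3, 3, 2)]]
  | .J13_F2 => [[(1, 0, 3, 3, 0)], [(1, 0, 4, 4, 0)]]
  | .J14_F => [[(1, 2, 4, 4, 2)]]
  | .J24_F =>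
    [ [(1, 2, 2, 2, 3)],
      [(1, 3, 3, 3, 2)],
      [(1, 3, 4, 4, 2)],
      [(1, 2, 4, 4, 3)],
      [(1, 2, 4, 4, 2)] ]
  | .J12_J13 => [[(2, 0, 0, 2, 2), (-1, 1, 2, 2, 3), (1, 0, 0, 3, 3)]]
  | .J35 => [[(1, 1, 3, 3, 1)]]
  | .J45 => [[(1, 0, 0, 0, 0), (3, 0, 4, 4, 0), (-3, 0, 2, 2, 0)]]
  | .J55 =>
    [ [(1, 0, 4, 4, 0)],
      [(1, 0, 0, 0, 0), (3, 0, 2, 4, 0), (-3, 0, 2, 2, 0)],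
      [(2, 0, 0, 2, 2), (-1, 1, 2, 2, 3), (2, 0, 0, 2, 4), (1, 0, 0, 3, 3)] ]
  | .J65 => [[(1, 3, 3, 3, 3)], [(1, 2, 3, 3, 2)]]
  | .J75 =>
    [ [(1, 0, 0, 4, 3), (-1, 2, 2, 4, 3)],
      [(1, 0, 0, 3, 4), (-1, 2, 2, 3, 4)],
      [(1, 0, 3, 3, 0)],
      [(1, 0, 4, 4, 0)],
      [(1, 3, 3, 3, 4)],
      [(1, 4, 4, 4, 3)] ]
  | .J85 => [[(1, 3, 3, 3, 3)]]
  | _ => []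

end JJName

/-- The numerical conditions on the data of a jump deformation. -/
def JumpDatum.isValid (X : JJName) (J : JumpDatum) : Bool :=
  X.dim.beq J.target.dim && (Nat.blt 0 J.degree && (LinForm.isZero (J.sign * J.sign - 1) &&
    (Combination.isHomogeneous J.weights 0 X.table &&
      (Combination.isHomogeneous J.weights J.degree J.cocycle &&
        (Combination.preserves X.dim (J.target.form J.rescaled)
          (X.table ++ Combination.scale J.sign J.cocycle) J.rows &&
            Combination.isInvertible X.dim J.rows)))))

/-! ### Evaluation of the certificates -/

namespace JJName

set_option maxHeartbeats 4000000 in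
theorem isCocycle_and_isBasisH2 (X : JJName) :
    ((X.table :: X.representatives).all (Combination.isCocycle X.dim X.table) &&
      Combination.isBasisH2 X.dim X.table X.representatives) = true := by
  cases X <;> decide +kernel

theorem length_representatives (X : JJName) : X.representatives.length = X.dimH2 := by
  cases X <;> rfl

theorem extendible_subset (X : JJName) : X.extendible ⊆ X.representatives := by
  cases X <;> decide +kernel

theorem isTwoStep_extendible (X : JJName) :
    X.extendible.all Combination.isTwoStep = true := by
  cases X <;> decide +kernel

/-- Completeness of the two obstructions: each cocycle outside the list has a multiplication with
nonzero trace or fails at order two. -/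
theorem extendible_or_obstructed (X : JJName) : ∀ c ∈ X.representatives,
    c ∈ X.extendible ∨ Combination.hasTrace X.dim c = true ∨
      ∃ w ∈ X.obstructions, Combination.obstructs X.dim X.table c w = true := by
  cases X <;> decide +kernel

theorem isValid_jumpData (X : JJName) : X.jumpData.all (JumpDatum.isValid X) = true := by
  cases X <;> decide +kernel

theorem exists_mem_jumps (X : JJName) :
    ∀ c ∈ X.extendible, c ∈ X.jumps.map Prod.fst := by
  cases X <;> decide +kernel

theorem ctorIdx_arrows_subset (X : JJName) :
    ∀ Y ∈ X.arrows.map fun Y => Y.ctorIdx, Y ∈ X.jumps.map fun p => p.2.ctorIdx := by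
  cases X <;> decide +kernel

/-- The bound 6 exceeds the length of every path in the diagrams. The inequality of dimensions is
what later rules out an isomorphism between source and target. -/
theorem jumps_spec (X : JJName) : ∀ p ∈ X.jumps, p.1 ∈ X.extendible ∧
    reaches 6 X p.2 = true ∧ p.2.dimH2 ≠ X.dimH2 := by
  cases X <;> decide +kernel

theorem eq_of_ctorIdx_eq {X Y : JJName} (h : X.ctorIdx = Y.ctorIdx) : X = Y := by
  cases X <;> cases Y <;> first | rfl | cases h

end JJName

theorem AlgIso.refl {F V : Type*} [Field F] [AddCommGroup V] [Module F V] (μ : BilinMap F V) :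
    AlgIso μ μ := ⟨LinearEquiv.refl F V, fun _ _ => rfl⟩

/-- Source and target of a jump live on spaces whose dimensions are given by different expressions;
this identifies the two spaces. -/
theorem Combination.algIso_of_eq (F : Type*) [Field F] (c : Combination) {m n : ℕ} (h : m = n) :
    AlgIso (c.toBilin F m) (c.toBilin F n) := by
  subst h
  exact AlgIso.refl _

/-! ### Assembly of the theorem -/

namespace JJName

theorem transGen_of_reaches {k : ℕ} {X Y : JJName} (h : reaches k X Y = true) :
    Relation.TransGen (fun A B : JJName => B ∈ A.arrows) X Y := by
  induction k generalizing X with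
  | zero => simp [reaches] at h
  | succ k ih =>
    rw [reaches, List.any_eq_true] at h
    obtain ⟨Z, hZ, h⟩ := h
    rw [Bool.or_eq_true, Nat.beq_eq] at h
    rcases h with h | h
    · obtain rfl := eq_of_ctorIdx_eq h
      exact Relation.TransGen.single hZ
    · exact Relation.TransGen.head hZ (ih h)

variable {F : Type*} [Field F]

theorem isCocycle_table (X : JJName) : Combination.isCocycle X.dim X.table X.table = true := by
  have h := X.isCocycle_and_isBasisH2
  rw [List.all_cons, Bool.and_eq_true, Bool.and_eq_true] at h
  exact h.1.1

theorem isCocycle_representatives (X : JJName) :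
    ∀ c ∈ X.representatives, Combination.isCocycle X.dim X.table c = true := by
  have h := X.isCocycle_and_isBasisH2
  rw [List.all_cons, Bool.and_eq_true, Bool.and_eq_true] at h
  exact List.all_eq_true.1 h.1.2

theorem isJJAlgebra (h2 : (2 : F) ≠ 0) (X : JJName) : IsJJAlgebra (X.mul F) :=
  Combination.isJJAlgebra_toBilin h2 X.isCocycle_table

theorem basis_H2 (h2 : (2 : F) ≠ 0) (h6 : (6 : F) ≠ 0) (X : JJName) :
    ∃ h : ∀ i : Fin X.representatives.length,
      X.cochain F (X.representatives.get i) ∈ Z2 (X.mul F),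
      LinearIndependent F (fun i => H2.mk (X.mul F) _ (h i)) ∧
      Submodule.span F (Set.range fun i => H2.mk (X.mul F) _ (h i)) = ⊤ := by
  have hb := X.isCocycle_and_isBasisH2
  rw [Bool.and_eq_true] at hb
  obtain ⟨hind, hspan⟩ := Combination.cocycle_basis h6 X.isCocycle_table
    X.isCocycle_representatives hb.2
  exact ⟨fun i => Combination.toBilin_mem_Z2 (X.isCocycle_representatives _ (List.get_mem _ _)),
    H2.basis (X.isJJAlgebra h2) _ _ hind hspan⟩

theorem finrank_H2 (h2 : (2 : F) ≠ 0) (h6 : (6 : F) ≠ 0) (X : JJName) :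
    Module.finrank F (H2 (X.mul F)) = X.dimH2 := by
  obtain ⟨h, hb⟩ := X.basis_H2 h2 h6
  rw [finrank_H2_eq_of_basis hb, X.length_representatives]

theorem isFormalDeformation (h2 : (2 : F) ≠ 0) {X : JJName} {c : Combination}
    (hc : c ∈ X.extendible) :
    IsFormalDeformation (X.mul F) (linearFamily (X.mul F) (X.cochain F c)) :=
  Combination.isFormalDeformation_of_isTwoStep h2 X.isCocycle_table
    (X.isCocycle_representatives c (X.extendible_subset hc))
    (List.all_eq_true.1 X.isTwoStep_extendible c hc)

theorem isExtendible_iff (h2 : (2 : F) ≠ 0) (h3 : (3 : F) ≠ 0) (h6 : (6 : F) ≠ 0) {X : JJName}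
    {c : Combination} (hc : c ∈ X.representatives) :
    IsExtendible (X.mul F) (X.cochain F c) ↔ c ∈ X.extendible := by
  refine ⟨fun h => ?_, fun h => ⟨_, isFormalDeformation h2 h, rfl⟩⟩
  rcases X.extendible_or_obstructed c hc with h1 | h1 | ⟨w, -, h1⟩
  · exact h1
  · exact absurd h (Combination.not_isExtendible_of_hasTrace h2 h3 h6 h1)
  · exact absurd h (Combination.not_isExtendible_of_obstructs h6 h1)

variable [IsAlgClosed F]

theorem algIso_form (X : JJName) (b : Bool) :
    AlgIso ((X.form b).toBilin F X.dim) (X.mul F) := by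
  -- Both a - b and a + b are rescalings of the member of the family a + tb at t = 1, the first by a
  -- square root of -1.
  have key : ∀ (n : ℕ) (c c' a b : Combination) (w : List ℕ), c = a ++ Combination.scale (-1) b →
      c' = a ++ Combination.scale 1 b → Combination.isHomogeneous w 0 a = true →
      Combination.isHomogeneous w 2 b = true → AlgIso (c.toBilin F n) (c'.toBilin F n) := by
    rintro n _ _ a b w rfl rfl ha hb
    exact (Combination.algIso_scale two_pos (by norm_num) ha hb (t := 1) one_ne_zero).symm.trans
      (Combination.algIso_scale two_pos (by norm_num) ha hb one_ne_zero)
  cases b with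
  | false => cases X <;> exact AlgIso.refl _
  | true =>
    cases X
    case J12_J13 =>
      exact key _ _ _ [(1, 1, 1, 2), (1, 3, 3, 4)] [(1, 5, 5, 4)] [0, 0, 0, 0, 1]
        (by decide) (by decide) (by decide) (by decide)
    case J55 =>
      exact key _ _ _ [(1, 1, 1, 2)] [(1, 3, 3, 4), (-1, 3, 5, 2), (1, 3, 5, 4)] [0, 0, 1, 0, 1]
        (by decide) (by decide) (by decide) (by decide)
    all_goals exact AlgIso.refl _

/-- Rescaling removes t, the rows then identify μ ± φ with a form of the target, and `algIso_form`
returns to its standard table. No value of t besides 0 is lost. -/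
theorem algIso_of_isValid (h6 : (6 : F) ≠ 0) {X : JJName} {J : JumpDatum}
    (h : JumpDatum.isValid X J = true) {t : F} (ht : t ≠ 0) :
    AlgIso (X.mul F + t • X.cochain F J.cocycle) (J.target.mul F) := by
  simp only [JumpDatum.isValid, Bool.and_eq_true, Nat.beq_eq, Nat.blt_eq, LinForm.isZero_iff] at h
  obtain ⟨hdim, hd, hε, ha, hb, hp, hi⟩ := h
  exact (Combination.algIso_scale hd (sub_eq_zero.1 hε) ha hb ht).trans
    ((Combination.algIso_of_rows h6 hp hi).symm.trans
      ((Combination.algIso_of_eq F _ hdim).trans (algIso_form _ _)))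

theorem algIso_of_mem_exceptionalJumps (h2 : (2 : F) ≠ 0) (h3 : (3 : F) ≠ 0) (X : JJName)
    {p : Combination × JJName} (hp : p ∈ X.exceptionalJumps) : ∃ S : Finset F, ∀ t : F, t ≠ 0 →
      t ∉ S → AlgIso (X.mul F + t • X.cochain F p.1) (p.2.mul F) := by
  cases X
  case J25 =>
    obtain rfl : p = ([(1, 3, 4, 2)], .J45) := by simpa [exceptionalJumps] using hp
    exact ⟨∅, fun t ht _ => algIso_J25_e342 h3 ht⟩
  case J35 =>
    obtain rfl | rfl : p = ([(1, 4, 4, 2)], .J45) ∨ p = ([(1, 4, 4, 5)], .J45) := by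
      simpa [exceptionalJumps] using hp
    · exact ⟨{27 / 4}, fun t ht ht' => algIso_J35_e442 h2 ht (by simpa using ht')⟩
    · exact ⟨{4}, fun t ht ht' => algIso_J35_e445 ht (by simpa using ht')⟩
  case J55 =>
    obtain rfl : p = ([(1, 5, 5, 2)], .J45) := by simpa [exceptionalJumps] using hp
    exact ⟨{-4}, fun t ht ht' => algIso_J55_e552 ht (by simpa using ht')⟩
  case J65 =>
    obtain rfl : p = ([(1, 4, 4, 2)], .J55) := by simpa [exceptionalJumps] using hp
    exact ⟨{1}, fun t ht ht' => algIso_J65_e442 h2 ht (by simpa using ht')⟩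
  all_goals simp [exceptionalJumps] at hp

theorem isJumpDeformation (h2 : (2 : F) ≠ 0) (h3 : (3 : F) ≠ 0) (h6 : (6 : F) ≠ 0) {X : JJName}
    {p : Combination × JJName} (hp : p ∈ X.jumps) :
    IsJumpDeformation (X.mul F) (linearFamily (X.mul F) (X.cochain F p.1)) (p.2.mul F) := by
  obtain ⟨hext, -, hdim⟩ := X.jumps_spec p hp
  refine ⟨isFormalDeformation h2 hext, support_linearFamily_finite _ _, ?_, fun h => hdim ?_⟩
  · simp only [specialize_linearFamily]
    rcases List.mem_append.1 hp with hp | hp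
    · obtain ⟨J, hJ, rfl⟩ := List.mem_map.1 hp
      exact ⟨∅, fun t ht _ => algIso_of_isValid h6 (List.all_eq_true.1 X.isValid_jumpData J hJ) ht⟩
    · exact X.algIso_of_mem_exceptionalJumps h2 h3 hp
  -- An isomorphism would make the two dimensions of H² equal.
  · rw [← finrank_H2 h2 h6 X, ← finrank_H2 h2 h6 p.2]
    exact (h.finrank_H2_eq (X.isJJAlgebra h2) (p.2.isJJAlgebra h2)).symm

end JJName

theorem mainTheorem5 {F : Type*} [Field F] [IsAlgClosed F]
    (h2 : ringChar F ≠ 2) (h3 : ringChar F ≠ 3) :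
    -- the tables define Jacobi-Jordan algebras
    (∀ X : JJName, IsJJAlgebra (X.mul F)) ∧
    -- the dimensions of the second cohomology spaces
    (∀ X : JJName, Module.finrank F (H2 (X.mul F)) = X.dimH2) ∧
    -- the classes of the representative cocycles form a basis of the second cohomology space
    (∀ X : JJName, ∃ h : ∀ i : Fin X.representatives.length,
      X.cochain F (X.representatives.get i) ∈ Z2 (X.mul F),
      LinearIndependent F (fun i => H2.mk (X.mul F) _ (h i)) ∧
      Submodule.span F (Set.range fun i => H2.mk (X.mul F) _ (h i)) = ⊤) ∧
    -- exactly the listed ones define extendible infinitesimal deformations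
    (∀ X : JJName, X.extendible ⊆ X.representatives ∧
      ∀ c ∈ X.representatives,
        (IsExtendible (X.mul F) (X.cochain F c) ↔ c ∈ X.extendible)) ∧
    -- each of these gives a jump deformation, to an algebra further down in the diagram
    (∀ X : JJName, ∀ c ∈ X.extendible, ∃ Y : JJName,
      Relation.TransGen (fun A B : JJName => B ∈ A.arrows) X Y ∧
      IsJumpDeformation (X.mul F) (linearFamily (X.mul F) (X.cochain F c)) (Y.mul F)) ∧
    -- each arrow of the diagrams is a jump deformation given by one of these cocycles
    (∀ X Y : JJName, Y ∈ X.arrows → ∃ c ∈ X.extendible,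
      IsJumpDeformation (X.mul F) (linearFamily (X.mul F) (X.cochain F c)) (Y.mul F)) := by
  have h2' : (2 : F) ≠ 0 := Ring.two_ne_zero h2
  have h3' : (3 : F) ≠ 0 := by
    intro h
    have h4 : ringChar F ∣ 3 := (ringChar.spec F 3).1 (by exact_mod_cast h)
    rcases (Nat.dvd_prime Nat.prime_three).1 h4 with h5 | h5
    · exact CharP.ringChar_ne_one h5
    · exact h3 h5
  have h6 : (6 : F) ≠ 0 := by
    rw [show (6 : F) = 2 * 3 by norm_num]
    exact mul_ne_zero h2' h3'
  refine ⟨JJName.isJJAlgebra h2', JJName.finrank_H2 h2' h6, JJName.basis_H2 h2' h6,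
    fun X => ⟨X.extendible_subset, fun c hc => JJName.isExtendible_iff h2' h3' h6 hc⟩,
    fun X c hc => ?_, fun X Y hY => ?_⟩
  · obtain ⟨p, hp, rfl⟩ := List.mem_map.1 (X.exists_mem_jumps c hc)
    exact ⟨p.2, JJName.transGen_of_reaches (X.jumps_spec p hp).2.1,
      JJName.isJumpDeformation h2' h3' h6 hp⟩
  · obtain ⟨p, hp, h⟩ := List.mem_map.1
      (X.ctorIdx_arrows_subset _ (List.mem_map_of_mem hY))
    obtain rfl := JJName.eq_of_ctorIdx_eq h
    exact ⟨p.1, (X.jumps_spec p hp).1, JJName.isJumpDeformation h2' h3' h6 hp⟩
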